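/- For $x\in\{0,1\}^n$, a noisy example of $x$ with noise rate $\eta$ is a pair $(a,\ell)$ where $a$ is uniform in $\{0,1\}^n$ and, independently of $a$, $\ell=\langle a,x\rangle \bmod 2$ with probability $1-\eta$ and $\ell=1-(\langle a,x\rangle \bmod 2)$ with probability $\eta$. An algorithm solves $k$-LPN (learning $k$-parities with noise) on $n$ variables with noise rate $\eta$ and confidence parameter $\delta$, in time $T$ and with sample complexity $S$, if on input $n$ it always halts within time $T$ after drawing at most $S$ examples and, for every $x\in\{0,1\}^n$ of Hamming weight $k$, when it is given independent noisy examples of $x$ with noise rate $\eta$, it outputs $x$ with probability at least $1-\delta$. Time is measured on a random access machine with logarithmic cost. A function $g:\mathbb N\to\mathbb N$ is constructible if $g(n)$ can be computed from $n$ in time polynomial in $n$. Let $f:\mathbb N\to\mathbb N$ satisfy $1\ll f(n)\ll n/\log\log n$, that is, $f(n)\to\infty$ and $f(n)=o(n/\log\log n)$, and let $k(n)=\lfloor n/f(n)\rfloor$. Let $\alpha\in[1/2,1)$ and let $\eta:\mathbb N\to[0,1/2)$ satisfy $$\eta(n)=o\!\left(\frac{1}{f(n)^{\alpha}\log n}\right).$$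 Assume that $k$ and some function $t:\mathbb N\to\mathbb N$ with $t(n)=\Theta(n/f(n)^\alpha)$ are constructible. Then for every constant $\delta\in(0,1)$ there is a single algorithm that, for all sufficiently large $n$, solves $k(n)$-LPN on $n$ variables with noise rate $\eta(n)$ and confidence parameter $\delta$, in time $$T(n)\le e^{-k(n)/4.01+o(k(n))}\cdot\binom{n}{k(n)}^{1-\alpha}\cdot\mathrm{poly}(n)$$ and with sample complexity $O(k(n)\,f(n)^{\alpha})$. In particular this breaks the $\binom{n}{k/2}$ barrier: if $\log n=o(k(n))$, then $T(n)=o\!\left(\binom{n}{\lfloor k(n)/2\rfloor}\right)$. -/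

import Mathlib

open Filter MeasureTheory ProbabilityTheory Asymptotics
open scoped Topology

/-! ### Learning sparse parities with noise -/

/-- The parity `∑ i, x i * a i (mod 2)` of the bit vectors `x` and `a`. -/
def parity {n : ℕ} (x a : Fin n → Bool) : Bool :=
  decide (Odd (Finset.univ.filter fun i => x i = true ∧ a i = true).card)

/-- The Hamming weight of a bit vector. -/
def weight {n : ℕ} (x : Fin n → Bool) : ℕ :=
  (Finset.univ.filter fun i => x i = true).card

/-- A labelled example: a point of `{0,1}^n` and a label. -/
abbrev Example (n : ℕ) : Type := (Fin n → Bool) × Bool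

/-- The law of one noisy example of the parity `x`: the point `a` is uniform in `{0,1}^n` and,
independently, its label `parity x a` is flipped with probability `η`. -/
noncomputable def exampleLaw {n : ℕ} (x : Fin n → Bool) (η : unitInterval) : Measure (Example n) :=
  ((PMF.uniformOfFintype (Fin n → Bool)).toMeasure.prod (bernoulliMeasure true false η)).map
    fun z => (z.1, xor (parity x z.1) z.2)

/-- The law of an infinite sequence of independent noisy examples of the parity `x`. -/
noncomputable def sourceLaw {n : ℕ} (x : Fin n → Bool) (η : unitInterval) : Measure (ℕ → Example n) :=
  Measure.infinitePi fun _ => exampleLaw x η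

/-! ### Machine model: random access machine programs with logarithmic cost

A program works on natural numbers, held in finitely many variables and finitely many arrays
(those that occur in its text). Every operation is charged by the bit lengths (`Nat.size`) of the
numbers that it handles, array indices included. -/

/-- Arithmetic and comparison operations. -/
inductive Op where
  | add | sub | mul | div | mod | eq | lt

/-- The value of an operation; subtraction is truncated, comparisons return `0` or `1`. -/
def Op.eval : Op → ℕ → ℕ → ℕ
  | add, a, b => a + b
  | sub, a, b => a - b
  | mul, a, b => a * b
  | div, a, b => a / b
  | mod, a, b => a % b
  | eq, a, b => if a = b then 1 else 0
  | lt, a, b => if a < b then 1 else 0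

/-- Expressions: constants, variables, array cells, and operations. -/
inductive Expr where
  | lit (c : ℕ)
  | var (v : ℕ)
  | cell (A : ℕ) (index : Expr)
  | op (o : Op) (e₁ e₂ : Expr)

/-- A configuration: the variables, the arrays, and the number of examples drawn so far. -/
structure Config where
  var : ℕ → ℕ
  arr : ℕ → ℕ → ℕ
  drawn : ℕ

/-- The value of an expression. -/
def Expr.eval (s : Config) : Expr → ℕ
  | lit c => c
  | var v => s.var v
  | cell A e => s.arr A (e.eval s)
  | op o e₁ e₂ => o.eval (e₁.eval s) (e₂.eval s)

/-- The cost of evaluating an expression: reading a number costs its length (plus the length of its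
index for an array cell), an operation costs the product of the lengths of its arguments. -/
def Expr.cost (s : Config) : Expr → ℕ
  | lit c => 1 + c.size
  | var v => 1 + (s.var v).size
  | cell A e => e.cost s + 1 + (e.eval s).size + (s.arr A (e.eval s)).size
  | op _ e₁ e₂ => e₁.cost s + e₂.cost s + (1 + (e₁.eval s).size) * (1 + (e₂.eval s).size)

/-- Programs. `draw A` asks the example source for the next example `(a, ℓ)` and writes the bits
`a 0, …, a (n-1), ℓ` into the cells `0, …, n` of the array `A`. -/
inductive Prog where
  | skip
  | assign (v : ℕ) (e : Expr)
  | store (A : ℕ) (index e : Expr)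
  | draw (A : ℕ)
  | seq (p q : Prog)
  | cond (e : Expr) (p q : Prog)
  | loop (e : Expr) (p : Prog)

/-- The result of `assign`. -/
def Config.setVar (s : Config) (v m : ℕ) : Config :=
  { s with var := Function.update s.var v m }

/-- The result of `store`. -/
def Config.setCell (s : Config) (A i m : ℕ) : Config :=
  { s with arr := Function.update s.arr A (Function.update (s.arr A) i m) }

/-- The result of `draw`. -/
def Config.load {n : ℕ} (s : Config) (A : ℕ) (ex : Example n) : Config where
  var := s.var
  arr := Function.update s.arr A fun i =>
    if h : i < n then (ex.1 ⟨i, h⟩).toNat else if i = n then ex.2.toNat else s.arr A i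
  drawn := s.drawn + 1

/-- `Exec ω p s τ s'`: with the sequence of examples `ω`, the program `p` started in the
configuration `s` halts after exactly `τ` time steps in the configuration `s'`. -/
inductive Exec {n : ℕ} (ω : ℕ → Example n) : Prog → Config → ℕ → Config → Prop
  | skip (s : Config) : Exec ω .skip s 1 s
  | assign (v : ℕ) (e : Expr) (s : Config) :
      Exec ω (.assign v e) s (e.cost s + 1 + (e.eval s).size) (s.setVar v (e.eval s))
  | store (A : ℕ) (d e : Expr) (s : Config) :
      Exec ω (.store A d e) s (d.cost s + e.cost s + 1 + (d.eval s).size + (e.eval s).size)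
        (s.setCell A (d.eval s) (e.eval s))
  | draw (A : ℕ) (s : Config) :
      Exec ω (.draw A) s ((n + 1) * (1 + n.size)) (s.load A (ω s.drawn))
  | seq {p q : Prog} {s s₁ s₂ : Config} {τ₁ τ₂ : ℕ} :
      Exec ω p s τ₁ s₁ → Exec ω q s₁ τ₂ s₂ → Exec ω (.seq p q) s (τ₁ + τ₂) s₂
  | cond_true {e : Expr} {p q : Prog} {s s' : Config} {τ : ℕ} :
      e.eval s ≠ 0 → Exec ω p s τ s' → Exec ω (.cond e p q) s (e.cost s + 1 + τ) s'
  | cond_false {e : Expr} {p q : Prog} {s s' : Config} {τ : ℕ} :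
      e.eval s = 0 → Exec ω q s τ s' → Exec ω (.cond e p q) s (e.cost s + 1 + τ) s'
  | loop_stop {e : Expr} {p : Prog} {s : Config} :
      e.eval s = 0 → Exec ω (.loop e p) s (e.cost s + 1) s
  | loop_step {e : Expr} {p : Prog} {s s₁ s₂ : Config} {τ₁ τ₂ : ℕ} :
      e.eval s ≠ 0 → Exec ω p s τ₁ s₁ → Exec ω (.loop e p) s₁ τ₂ s₂ →
        Exec ω (.loop e p) s (e.cost s + 1 + τ₁ + τ₂) s₂

/-- The initial configuration on input `n`: variable `0` holds `n`, everything else is `0`. -/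
def Config.init (n : ℕ) : Config where
  var := fun v => if v = 0 then n else 0
  arr := fun _ _ => 0
  drawn := 0

/-- `g` is constructible: a program that draws no examples computes `g n` from `n` (leaving it in
variable `0`) in time polynomial in `n`. -/
def Constructible (g : ℕ → ℕ) : Prop :=
  ∃ (p : Prog) (c : ℕ), ∀ (n : ℕ) (ω : ℕ → Example n), ∃ (τ : ℕ) (s : Config),
    Exec ω p (Config.init n) τ s ∧ τ ≤ c * (n + 1) ^ c ∧ s.drawn = 0 ∧ s.var 0 = g n

/-- In the configuration `s`, the vector `x` is written in the cells `0, …, n-1` of array `0`. -/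
def Config.Outputs {n : ℕ} (s : Config) (x : Fin n → Bool) : Prop :=
  ∀ i : Fin n, s.arr 0 i = (x i).toNat

/-- On input `n`, the program `p` solves the problem of learning parities of weight `k` on `n`
variables with noise rate `η` and confidence parameter `δ`, in time `T` and with `S` examples:
whatever examples it sees, it halts within time `T` after drawing at most `S` examples, and for
every hidden vector `x` of weight `k` it outputs `x` with probability at least `1 - δ` over the
independent noisy examples of `x`. -/
def SolvesLPN (p : Prog) (n k : ℕ) (η : unitInterval) (δ : ℝ) (T S : ℕ) : Prop :=
  (∀ ω : ℕ → Example n, ∃ (τ : ℕ) (s : Config),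
    Exec ω p (Config.init n) τ s ∧ τ ≤ T ∧ s.drawn ≤ S) ∧
  ∀ x : Fin n → Bool, weight x = k →
    1 - δ ≤ (sourceLaw x η).real
      {ω | ∃ (τ : ℕ) (s : Config), Exec ω p (Config.init n) τ s ∧ s.Outputs x}

/-! Cut the `n` positions into at most `k * q` blocks of length `B`, where `q` is of order `f ^ (1 -
α)` with a small constant and `B` of order `f ^ α` with a large one. A vector `x` of weight `k`
meets at most `k` blocks, so once these are known only `k * B` bits are unknown. Draw `m = 2 * k *
B` examples. The expected number of wrong labels is `m * η = o(k / log n)`, so by Markov's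
inequality at most `w = k / n.size` labels are wrong, except with small probability. The algorithm
tries every pair of a set of at most `k` blocks and a set of at most `w` wrong labels: it corrects
the labels, solves the linear system in the selected unknowns by Gaussian elimination, and accepts
the result if it has weight `k` and explains all examples up to the guessed errors.

Cost. Stars and bars encode the blocks in `4 ^ k * q ^ k` ways, and the errors cost `(m + 1) ^ w ≤ 2
^ k`, so that all pairs have codes below `(8 * q) ^ k` (`exists_code`). The constant `D` in `q = t /
(D * k)` is so large that `8 * q ≤ e⁻¹ * f ^ (1 - α)`. Since `f ^ k ≤ n.choose k`, the number of
codes is at most `e ^ (-k) * (n.choose k) ^ (1 - α)` (`pow_le_exp_mul_choose_rpow`). A larger `D`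
costs only a constant factor in `B`, hence in the number of examples.

Failure. Three events are excluded, each of probability at most `δ / 3`: another vector supported in
the blocks of `x` agrees with `x` on all examples (`sourceLaw_ambiguous_le`, at most `2 ^ (-k *
B)`); another vector of weight `k` explains the examples under some code (`sourceLaw_confused_le`, a
union bound over vectors and codes); too many labels are wrong (`sourceLaw_errors_le`). Outside them
the right code produces `x`, and no code makes the test accept anything else (`FProg.search_spec`).

Machine. The algorithm is written with counted loops only (`FProg`), so that it has a denotation
`FProg.den` to reason about. Stored numbers never exceed a fixed bound, and all loops but the one
over codes have polynomially many rounds, which makes one round polynomial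
(`FProg.exists_time_bound`). The given programs for `k` and `t` are run first on renamed, disjoint
variables (`Exec.rename`).

Barrier. `n.choose k ≤ n * (n.choose (k / 2)) ^ 2` and `1 - α ≤ 1 / 2`, so the time is below
`n.choose (k / 2)` up to `e ^ (-k)` and a power of `n`. -/

/-! ### Bounded configurations and running times -/

/-- All numbers held by the configuration are at most `M`. -/
def Config.Bounded (M : ℕ) (s : Config) : Prop :=
  (∀ v, s.var v ≤ M) ∧ ∀ A i, s.arr A i ≤ M

theorem Config.Bounded.mono {M M' : ℕ} {s : Config} (h : s.Bounded M) (hM : M ≤ M') :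
    s.Bounded M' :=
  ⟨fun v => (h.1 v).trans hM, fun A i => (h.2 A i).trans hM⟩

theorem Config.Bounded.setVar {M : ℕ} {s : Config} (h : s.Bounded M) {v m : ℕ} (hm : m ≤ M) :
    (s.setVar v m).Bounded M := by
  refine ⟨fun w => ?_, h.2⟩
  by_cases hw : w = v
  · subst hw; simpa [Config.setVar] using hm
  · simpa [Config.setVar, hw] using h.1 w

theorem Config.Bounded.setCell {M : ℕ} {s : Config} (h : s.Bounded M) {A i m : ℕ} (hm : m ≤ M) :
    (s.setCell A i m).Bounded M := by
  refine ⟨h.1, fun A' i' => ?_⟩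
  by_cases hA : A' = A
  · subst hA
    by_cases hi : i' = i
    · subst hi; simpa [Config.setCell] using hm
    · simpa [Config.setCell, hi] using h.2 A' i'
  · simpa [Config.setCell, hA] using h.2 A' i'

theorem Config.Bounded.load {M n : ℕ} {s : Config} (h : s.Bounded M) (hM : 1 ≤ M) (A : ℕ)
    (ex : Example n) : (s.load A ex).Bounded M := by
  refine ⟨h.1, fun A' i' => ?_⟩
  by_cases hA : A' = A
  · subst hA
    simp only [Config.load, Function.update_self]
    split_ifs
    · exact (Bool.toNat_le _).trans hM
    · exact (Bool.toNat_le _).trans hM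
    · exact h.2 A' i'
  · simpa [Config.load, hA] using h.2 A' i'

theorem Nat.size_add_le (a b : ℕ) : (a + b).size ≤ a.size + b.size + 1 := by
  rw [Nat.size_le]
  have ha := Nat.lt_size_self a
  have hb := Nat.lt_size_self b
  have h1 : 2 ^ a.size ≤ 2 ^ (a.size + b.size) := Nat.pow_le_pow_right (by norm_num) (by omega)
  have h2 : 2 ^ b.size ≤ 2 ^ (a.size + b.size) := Nat.pow_le_pow_right (by norm_num) (by omega)
  rw [pow_succ]; omega

theorem Nat.size_mul_le (a b : ℕ) : (a * b).size ≤ a.size + b.size := by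
  rw [Nat.size_le, pow_add]
  exact Nat.mul_lt_mul'' (Nat.lt_size_self a) (Nat.lt_size_self b)

theorem Op.size_eval_le (o : Op) (a b : ℕ) : (o.eval a b).size ≤ a.size + b.size + 1 := by
  have h1 : (1 : ℕ).size ≤ a.size + b.size + 1 := by simp
  cases o
  · exact Nat.size_add_le a b
  · exact (Nat.size_le_size (Nat.sub_le a b)).trans (by omega)
  · exact (Nat.size_mul_le a b).trans (by omega)
  · exact (Nat.size_le_size (Nat.div_le_self a b)).trans (by omega)
  · exact (Nat.size_le_size (Nat.mod_le a b)).trans (by omega)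
  · simp only [Op.eval]; split_ifs <;> simp
  · simp only [Op.eval]; split_ifs <;> simp

/-- Intermediate values may exceed `M`, but an operation at most adds the lengths of its arguments
and `1`, so lengths stay linear in `M.size` with a constant depending on the expression. The charge
for an operation is a product of two lengths, whence the square. -/
theorem Expr.exists_cost_bound (e : Expr) : ∃ C : ℕ, ∀ (s : Config) (M : ℕ), s.Bounded M →
    (e.eval s).size ≤ C * (M.size + 1) ∧ e.cost s ≤ C * (M.size + 1) ^ 2 := by
  induction e with
  | lit c =>
    refine ⟨1 + c.size, fun s M _ => ⟨?_, ?_⟩⟩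
    · simp only [Expr.eval]; nlinarith [Nat.zero_le M.size, Nat.zero_le c.size]
    · simp only [Expr.cost]; exact Nat.le_mul_of_pos_right _ (by positivity)
  | var v =>
    refine ⟨1, fun s M h => ?_⟩
    have := Nat.size_le_size (h.1 v)
    simp only [Expr.eval, Expr.cost]
    constructor <;> nlinarith
  | cell A e ih =>
    obtain ⟨C, hC⟩ := ih
    refine ⟨2 * C + 2, fun s M h => ?_⟩
    obtain ⟨h1, h2⟩ := hC s M h
    have h3 := Nat.size_le_size (h.2 A (e.eval s))
    simp only [Expr.eval, Expr.cost]
    generalize M.size = L at *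
    constructor <;> nlinarith [Nat.zero_le (C * L), Nat.zero_le (C * L * L)]
  | op o e₁ e₂ ih₁ ih₂ =>
    obtain ⟨C₁, hC₁⟩ := ih₁
    obtain ⟨C₂, hC₂⟩ := ih₂
    refine ⟨C₁ + C₂ + (1 + C₁) * (1 + C₂), fun s M h => ?_⟩
    obtain ⟨h1, h2⟩ := hC₁ s M h
    obtain ⟨h3, h4⟩ := hC₂ s M h
    have h5 := o.size_eval_le (e₁.eval s) (e₂.eval s)
    simp only [Expr.eval, Expr.cost]
    have h6 : (1 + (e₁.eval s).size) * (1 + (e₂.eval s).size)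
        ≤ ((1 + C₁) * (M.size + 1)) * ((1 + C₂) * (M.size + 1)) :=
      Nat.mul_le_mul (by nlinarith) (by nlinarith)
    constructor
    · nlinarith [Nat.zero_le (C₁ * C₂ * M.size), Nat.zero_le (C₁ * C₂),
        Nat.zero_le (C₁ * M.size), Nat.zero_le (C₂ * M.size)]
    · nlinarith

/-- With the examples `ω`, the program `p` takes `s` to `s'` in at most `T` steps. -/
def Runs {n : ℕ} (ω : ℕ → Example n) (p : Prog) (s : Config) (T : ℕ) (s' : Config) : Prop :=
  ∃ τ ≤ T, Exec ω p s τ s'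

theorem Runs.mono {n : ℕ} {ω : ℕ → Example n} {p : Prog} {s s' : Config} {T T' : ℕ}
    (h : Runs ω p s T s') (hT : T ≤ T') : Runs ω p s T' s' :=
  let ⟨τ, hτ, h'⟩ := h; ⟨τ, hτ.trans hT, h'⟩

theorem Runs.seq {n : ℕ} {ω : ℕ → Example n} {p q : Prog} {s s₁ s₂ : Config} {T₁ T₂ : ℕ}
    (h₁ : Runs ω p s T₁ s₁) (h₂ : Runs ω q s₁ T₂ s₂) : Runs ω (.seq p q) s (T₁ + T₂) s₂ :=
  let ⟨_, hτ₁, e₁⟩ := h₁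
  let ⟨_, hτ₂, e₂⟩ := h₂
  ⟨_, Nat.add_le_add hτ₁ hτ₂, .seq e₁ e₂⟩

/-- The values of a run are bounded by its length. -/
theorem Exec.bounded {n : ℕ} {ω : ℕ → Example n} {p : Prog} {s s' : Config} {τ M : ℕ}
    (h : Exec ω p s τ s') (hs : s.Bounded M) (hM : 2 ^ τ ≤ M) : s'.Bounded M := by
  have key : ∀ {a b : ℕ}, a ≤ b → 2 ^ b ≤ M → 2 ^ a ≤ M := fun hab hb =>
    (Nat.pow_le_pow_right (by norm_num) hab).trans hb
  -- Writing a number costs at least its length, so a written number is below `2 ^ τ`.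
  have key' : ∀ {x b : ℕ}, x.size ≤ b → 2 ^ b ≤ M → x ≤ M := fun hab hb =>
    ((Nat.lt_size_self _).le.trans (key hab hb))
  induction h with
  | skip s => exact hs
  | assign v e s => exact hs.setVar (key' (by omega) hM)
  | store A d e s => exact hs.setCell (key' (by omega) hM)
  | draw A s => exact hs.load (Nat.one_le_two_pow.trans hM) _ _
  | seq _ _ ih₁ ih₂ => exact ih₂ (ih₁ hs (key (by omega) hM)) (key (by omega) hM)
  | cond_true _ _ ih => exact ih hs (key (by omega) hM)
  | cond_false _ _ ih => exact ih hs (key (by omega) hM)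
  | loop_stop _ => exact hs
  | loop_step _ _ _ ih₁ ih₂ => exact ih₂ (ih₁ hs (key (by omega) hM)) (key (by omega) hM)

/-! ### Renaming of variables and arrays -/

def Expr.rename (φ : ℕ → ℕ) : Expr → Expr
  | lit c => lit c
  | var v => var (φ v)
  | cell A e => cell (φ A) (e.rename φ)
  | op o e₁ e₂ => op o (e₁.rename φ) (e₂.rename φ)

def Prog.rename (φ : ℕ → ℕ) : Prog → Prog
  | skip => skip
  | assign v e => assign (φ v) (e.rename φ)
  | store A d e => store (φ A) (d.rename φ) (e.rename φ)
  | draw A => draw (φ A)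
  | seq p q => seq (p.rename φ) (q.rename φ)
  | cond e p q => cond (e.rename φ) (p.rename φ) (q.rename φ)
  | loop e p => loop (e.rename φ) (p.rename φ)

/-- `u` holds in the renamed variables and arrays what `s` holds in the original ones. -/
structure Config.Renamed (φ : ℕ → ℕ) (s u : Config) : Prop where
  var : ∀ v, u.var (φ v) = s.var v
  arr : ∀ A, u.arr (φ A) = s.arr A
  drawn : u.drawn = s.drawn

theorem Expr.eval_rename {φ : ℕ → ℕ} {s u : Config} (h : s.Renamed φ u) (e : Expr) :
    (e.rename φ).eval u = e.eval s := by
  induction e with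
  | lit c => rfl
  | var v => exact h.var v
  | cell A e ih => simp only [Expr.rename, Expr.eval, ih, h.arr]
  | op o e₁ e₂ ih₁ ih₂ => simp only [Expr.rename, Expr.eval, ih₁, ih₂]

theorem Expr.cost_rename {φ : ℕ → ℕ} {s u : Config} (h : s.Renamed φ u) (e : Expr) :
    (e.rename φ).cost u = e.cost s := by
  induction e with
  | lit c => rfl
  | var v => simp only [Expr.rename, Expr.cost, h.var]
  | cell A e ih => simp only [Expr.rename, Expr.cost, Expr.eval_rename h, ih, h.arr]
  | op o e₁ e₂ ih₁ ih₂ => simp only [Expr.rename, Expr.cost, Expr.eval_rename h, ih₁, ih₂]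

/-- The two configurations agree outside the range of `φ`. -/
def Config.AgreeOff (φ : ℕ → ℕ) (u u' : Config) : Prop :=
  (∀ v, v ∉ Set.range φ → u'.var v = u.var v) ∧ ∀ A, A ∉ Set.range φ → u'.arr A = u.arr A

theorem Config.AgreeOff.refl (φ : ℕ → ℕ) (u : Config) : u.AgreeOff φ u :=
  ⟨fun _ _ => rfl, fun _ _ => rfl⟩

theorem Config.AgreeOff.trans {φ : ℕ → ℕ} {u u' u'' : Config} (h : u.AgreeOff φ u')
    (h' : u'.AgreeOff φ u'') : u.AgreeOff φ u'' :=
  ⟨fun v hv => (h'.1 v hv).trans (h.1 v hv), fun A hA => (h'.2 A hA).trans (h.2 A hA)⟩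

/-- This allows a given program to run inside a larger one on private variables and arrays, at
unchanged cost: expressions have the same values and costs, and injectivity sends each write to
exactly one renamed place. `AgreeOff` protects everything else. -/
theorem Exec.rename {n : ℕ} {ω : ℕ → Example n} {p : Prog} {s s' : Config} {τ : ℕ}
    (h : Exec ω p s τ s') {φ : ℕ → ℕ} (hφ : φ.Injective) {u : Config} (hu : s.Renamed φ u) :
    ∃ u', Exec ω (p.rename φ) u τ u' ∧ s'.Renamed φ u' ∧ u.AgreeOff φ u' := by
  have ne : ∀ {v w : ℕ}, v ∉ Set.range φ → v ≠ φ w := fun hv h => hv ⟨_, h.symm⟩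
  induction h generalizing u with
  | skip s => exact ⟨u, .skip u, hu, .refl _ _⟩
  | assign v e s =>
    have := Exec.assign (ω := ω) (φ v) (e.rename φ) u
    rw [Expr.eval_rename hu, Expr.cost_rename hu] at this
    refine ⟨_, this, ⟨fun w => ?_, hu.arr, hu.drawn⟩, fun w hw => ?_, fun _ _ => rfl⟩
    · by_cases hw : w = v
      · subst hw; simp [Config.setVar]
      · simp [Config.setVar, hw, hφ.ne hw, hu.var]
    · simp [Config.setVar, ne hw]
  | store A d e s =>
    have := Exec.store (ω := ω) (φ A) (d.rename φ) (e.rename φ) u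
    rw [Expr.eval_rename hu, Expr.cost_rename hu, Expr.eval_rename hu, Expr.cost_rename hu] at this
    refine ⟨_, this, ⟨hu.var, fun w => ?_, hu.drawn⟩, fun _ _ => rfl, fun w hw => ?_⟩
    · by_cases hw : w = A
      · subst hw; simp [Config.setCell, hu.arr]
      · simp [Config.setCell, hw, hφ.ne hw, hu.arr]
    · simp [Config.setCell, ne hw]
  | draw A s =>
    have := Exec.draw (ω := ω) (φ A) u
    rw [hu.drawn] at this
    refine ⟨_, this, ⟨hu.var, fun w => ?_, ?_⟩, fun _ _ => rfl, fun w hw => ?_⟩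
    · by_cases hw : w = A
      · subst hw; simp [Config.load, hu.arr]
      · simp [Config.load, hw, hφ.ne hw, hu.arr]
    · simp [Config.load, hu.drawn]
    · simp [Config.load, ne hw]
  | seq _ _ ih₁ ih₂ =>
    obtain ⟨u₁, e₁, h₁, a₁⟩ := ih₁ hu
    obtain ⟨u₂, e₂, h₂, a₂⟩ := ih₂ h₁
    exact ⟨u₂, .seq e₁ e₂, h₂, a₁.trans a₂⟩
  | @cond_true _ _ q _ _ _ he _ ih =>
    obtain ⟨u₁, e₁, h₁, a₁⟩ := ih hu
    refine ⟨u₁, ?_, h₁, a₁⟩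
    have := Exec.cond_true (q := q.rename φ) (by rwa [Expr.eval_rename hu]) e₁
    rwa [Expr.cost_rename hu] at this
  | @cond_false _ p _ _ _ _ he _ ih =>
    obtain ⟨u₁, e₁, h₁, a₁⟩ := ih hu
    refine ⟨u₁, ?_, h₁, a₁⟩
    have := Exec.cond_false (p := p.rename φ) (by rwa [Expr.eval_rename hu]) e₁
    rwa [Expr.cost_rename hu] at this
  | loop_stop he =>
    rename_i p _
    refine ⟨u, ?_, hu, .refl _ _⟩
    have := Exec.loop_stop (ω := ω) (p := p.rename φ) (by rwa [Expr.eval_rename hu])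
    rwa [Expr.cost_rename hu] at this
  | loop_step he _ _ ih₁ ih₂ =>
    obtain ⟨u₁, e₁, h₁, a₁⟩ := ih₁ hu
    obtain ⟨u₂, e₂, h₂, a₂⟩ := ih₂ h₁
    refine ⟨u₂, ?_, h₂, a₁.trans a₂⟩
    have := Exec.loop_step (by rwa [Expr.eval_rename hu]) e₁ e₂
    rwa [Expr.cost_rename hu] at this

/-! ### Programs with counted loops -/

/-- `for v < u do p`. -/
def Prog.forLoop (v u : ℕ) (p : Prog) : Prog :=
  .seq (.assign v (.lit 0))
    (.loop (.op .lt (.var v) (.var u)) (.seq p (.assign v (.op .add (.var v) (.lit 1)))))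

theorem runs_forLoop {n : ℕ} {ω : ℕ → Example n} {v u : ℕ} {p : Prog} {M c T : ℕ}
    (S : ℕ → Config) {s : Config} (h0 : S 0 = s.setVar v 0)
    (hstep : ∀ i < c, ∃ s', Runs ω p (S i) T s' ∧ s'.var v = i ∧ s'.Bounded M ∧
      S (i + 1) = s'.setVar v (i + 1))
    (hu : ∀ i ≤ c, (S i).var u = c) (hM : (S c).Bounded M) :
    Runs ω (.forLoop v u p) s ((c + 1) * (T + 11 * (M.size + 1) ^ 2)) (S c) := by
  have hv : ∀ i ≤ c, (S i).var v = i := by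
    intro i hi
    rcases i with _ | i
    · simp [h0, Config.setVar]
    · obtain ⟨s', _, _, _, h⟩ := hstep i hi
      simp [h, Config.setVar]
  have hc : c ≤ M := (hu c le_rfl) ▸ hM.1 u
  set L := M.size + 1 with hL
  have hsz : ∀ {x}, x ≤ M → 1 + x.size ≤ L := fun hx => by
    have := Nat.size_le_size hx; omega
  -- The guard costs `4 * L ^ 2` and the increment of the counter `7 * L ^ 2`; together they give
  -- the constant `11`.
  have hguard : ∀ i ≤ c, (Expr.op .lt (.var v) (.var u)).cost (S i) + 1 ≤ 4 * L ^ 2 := by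
    intro i hi
    simp only [Expr.cost, Expr.eval, hv i hi, hu i hi]
    have h1 := hsz (hi.trans hc)
    have h2 := hsz hc
    have h3 := Nat.mul_le_mul h1 h2
    nlinarith
  have main : ∀ j i, i + j = c →
      Runs ω (.loop (.op .lt (.var v) (.var u)) (.seq p (.assign v (.op .add (.var v) (.lit 1)))))
        (S i) (j * (T + 11 * L ^ 2) + 4 * L ^ 2) (S c) := by
    intro j
    induction j with
    | zero =>
      intro i hi
      obtain rfl : i = c := by omega
      refine ⟨_, (hguard i le_rfl).trans (by omega), Exec.loop_stop ?_⟩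
      simp [Expr.eval, Op.eval, hv i le_rfl, hu i le_rfl]
    | succ j ih =>
      intro i hi
      obtain ⟨τ₂, hτ₂, e₂⟩ := ih (i + 1) (by omega)
      obtain ⟨s', ⟨τ₁, hτ₁, e₁⟩, hs', hb, hS⟩ := hstep i (by omega)
      have e₃ := Exec.assign (ω := ω) v (.op .add (.var v) (.lit 1)) s'
      have hval : (Expr.op .add (.var v) (.lit 1)).eval s' = i + 1 := by
        simp [Expr.eval, Op.eval, hs']
      rw [hval, ← hS] at e₃
      refine ⟨_, ?_, Exec.loop_step ?_ (Exec.seq e₁ e₃) e₂⟩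
      · have h1 := hguard i (by omega)
        have h2 := hsz (show i ≤ M by omega)
        have h3 := hsz (show i + 1 ≤ M by omega)
        have h4 : (Expr.op .add (.var v) (.lit 1)).cost s' + 1 + (i + 1).size ≤ 7 * L ^ 2 := by
          simp only [Expr.cost, Expr.eval, hs', Nat.size_one]
          nlinarith
        nlinarith
      · simp only [Expr.eval, Op.eval, hv i (by omega), hu i (by omega)]
        rw [if_pos (by omega)]; norm_num
  have e₀ := Exec.assign (ω := ω) v (.lit 0) s
  rw [show (Expr.lit 0).eval s = 0 from rfl, ← h0] at e₀
  obtain ⟨τ, hτ, e⟩ := main c 0 (by omega)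
  refine ⟨_, ?_, Exec.seq e₀ e⟩
  simp only [Expr.cost, Nat.size_zero]
  nlinarith

/-- Programs whose only loops are counted loops. -/
inductive FProg where
  | assign (v : ℕ) (e : Expr)
  | store (A : ℕ) (d e : Expr)
  | draw (A : ℕ)
  | seq (p q : FProg)
  | cond (e : Expr) (p q : FProg)
  | forb (v u : ℕ) (p : FProg)

namespace FProg

def compile : FProg → Prog
  | assign v e => .assign v e
  | store A d e => .store A d e
  | draw A => .draw A
  | seq p q => .seq p.compile q.compile
  | cond e p q => .cond e p.compile q.compile
  | forb v u p => .forLoop v u p.compile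

/-- The configuration after `i` rounds of a loop with counter `v` and body `g`. -/
def rounds (g : Config → Config) (v : ℕ) : ℕ → Config → Config
  | 0, s => s.setVar v 0
  | i + 1, s => (g (rounds g v i s)).setVar v (i + 1)

/-- The configuration in which the program ends. -/
def den {n : ℕ} (ω : ℕ → Example n) : FProg → Config → Config
  | assign v e, s => s.setVar v (e.eval s)
  | store A d e, s => s.setCell A (d.eval s) (e.eval s)
  | draw A, s => s.load A (ω s.drawn)
  | seq p q, s => q.den ω (p.den ω s)
  | cond e p q, s => if e.eval s ≠ 0 then p.den ω s else q.den ω s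
  | forb v u p, s => rounds (p.den ω) v (s.var u) s

/-- The variables that the program may change. -/
def writes : FProg → List ℕ
  | assign v _ => [v]
  | store _ _ _ => []
  | draw _ => []
  | seq p q => p.writes ++ q.writes
  | cond _ p q => p.writes ++ q.writes
  | forb v _ p => v :: p.writes

/-- The arrays that the program may change. -/
def stores : FProg → List ℕ
  | assign _ _ => []
  | store A _ _ => [A]
  | draw A => [A]
  | seq p q => p.stores ++ q.stores
  | cond _ p q => p.stores ++ q.stores
  | forb _ _ p => p.stores

/-- The program draws no examples. -/
def drawless : FProg → Bool
  | assign _ _ => true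
  | store _ _ _ => true
  | draw _ => false
  | seq p q => p.drawless && q.drawless
  | cond _ p q => p.drawless && q.drawless
  | forb _ _ p => p.drawless

theorem rounds_var {g : Config → Config} {v w : ℕ} (hw : w ≠ v)
    (hg : ∀ s, (g s).var w = s.var w) (i : ℕ) (s : Config) :
    (rounds g v i s).var w = s.var w := by
  induction i with
  | zero => simp [rounds, Config.setVar, hw]
  | succ i ih => simp [rounds, Config.setVar, hw, hg, ih]

theorem rounds_self (g : Config → Config) (v i : ℕ) (s : Config) :
    (rounds g v i s).var v = i := by
  cases i <;> simp [rounds, Config.setVar]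

theorem den_var {n : ℕ} (ω : ℕ → Example n) {w : ℕ} (p : FProg) (hw : w ∉ p.writes) (s : Config) :
    (p.den ω s).var w = s.var w := by
  induction p generalizing s with
  | assign v e => simp [writes] at hw; simp [den, Config.setVar, hw]
  | store A d e => rfl
  | draw A => rfl
  | seq p q ihp ihq =>
    simp [writes] at hw
    simp [den, ihp hw.1, ihq hw.2]
  | cond e p q ihp ihq =>
    simp [writes] at hw
    simp only [den]; split_ifs
    exacts [ihp hw.1 s, ihq hw.2 s]
  | forb v u p ih =>
    simp [writes] at hw
    exact rounds_var hw.1 (ih hw.2) _ _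

theorem den_arr {n : ℕ} (ω : ℕ → Example n) {A : ℕ} (p : FProg) (hA : A ∉ p.stores) (s : Config) :
    (p.den ω s).arr A = s.arr A := by
  induction p generalizing s with
  | assign v e => rfl
  | store A d e => simp [stores] at hA; simp [den, Config.setCell, hA]
  | draw A => simp [stores] at hA; simp [den, Config.load, hA]
  | seq p q ihp ihq =>
    simp [stores] at hA
    simp [den, ihp hA.1, ihq hA.2]
  | cond e p q ihp ihq =>
    simp [stores] at hA
    simp only [den]; split_ifs
    exacts [ihp hA.1 s, ihq hA.2 s]
  | forb v u p ih =>
    simp only [den]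
    generalize s.var u = i
    induction i with
    | zero => rfl
    | succ i ih' => simpa [rounds, Config.setVar, ih hA] using ih'

theorem den_drawn {n : ℕ} (ω : ℕ → Example n) (p : FProg) (hp : p.drawless = true) (s : Config) :
    (p.den ω s).drawn = s.drawn := by
  induction p generalizing s with
  | assign v e => rfl
  | store A d e => rfl
  | draw A => simp [drawless] at hp
  | seq p q ihp ihq =>
    simp [drawless] at hp
    simp [den, ihp hp.1, ihq hp.2]
  | cond e p q ihp ihq =>
    simp [drawless] at hp
    simp only [den]; split_ifs
    exacts [ihp hp.1 s, ihq hp.2 s]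
  | forb v u p ih =>
    simp only [den]
    generalize s.var u = i
    induction i with
    | zero => rfl
    | succ i ih' => simpa [rounds, Config.setVar, ih hp] using ih'

/-- Loop rule: an invariant `I`, indexed by the loop counter, holds at the end. -/
theorem den_forb {n : ℕ} (ω : ℕ → Example n) {v u : ℕ} {p : FProg} {s : Config}
    (I : ℕ → Config → Prop) (c : ℕ) (hc : s.var u = c) (h0 : I 0 (s.setVar v 0))
    (hstep : ∀ i < c, ∀ s', I i s' → s'.var v = i → I (i + 1) ((p.den ω s').setVar v (i + 1))) :
    I c ((forb v u p).den ω s) := by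
  simp only [den, hc]
  have : ∀ i ≤ c, I i (rounds (p.den ω) v i s) := by
    intro i
    induction i with
    | zero => exact fun _ => h0
    | succ i ih => exact fun hi => hstep i hi _ (ih (by omega)) (rounds_self _ _ _ _)
  exact this c le_rfl

end FProg

/-! ### Bounds on the values and the running time of programs with counted loops. -/

/-- Expressions whose value never exceeds the largest number in the configuration (or `1`). -/
def Expr.tame : Expr → Bool
  | lit c => c ≤ 1
  | var _ => true
  | cell _ _ => true
  | op .sub e _ => e.tame
  | op .div e _ => e.tame
  -- A remainder modulo `2` is at most `1` whatever its argument; this is how sums and products can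
  -- be stored.
  | op .mod e (lit 2) => true || e.tame
  | op .mod e _ => e.tame
  | op .eq _ _ => true
  | op .lt _ _ => true
  | _ => false

theorem Expr.eval_le_of_tame {e : Expr} {M : ℕ} {s : Config} (he : e.tame = true)
    (hs : s.Bounded M) (hM : 1 ≤ M) : e.eval s ≤ M := by
  induction e using Expr.tame.induct with
  | case1 c => simp [Expr.tame] at he; exact le_trans he hM
  | case2 v => exact hs.1 v
  | case3 A e => exact hs.2 _ _
  | case4 e _ ih => exact (Nat.sub_le _ _).trans (ih (by simpa [Expr.tame] using he))
  | case5 e _ ih => exact (Nat.div_le_self _ _).trans (ih (by simpa [Expr.tame] using he))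
  | case6 e ih =>
    have : e.eval s % 2 < 2 := Nat.mod_lt _ (by norm_num)
    simp only [Expr.eval, Op.eval]; omega
  | case7 e e' h ih =>
    refine (Nat.mod_le _ _).trans (ih ?_)
    rw [Expr.tame.eq_7 _ _ h] at he
    exact he
  | case8 => simp only [Expr.eval, Op.eval]; split_ifs <;> omega
  | case9 => simp only [Expr.eval, Op.eval]; split_ifs <;> omega
  | case10 => simp [Expr.tame] at he

namespace FProg

/-- Assignments and stores are tame, variables below `10` are only read, and loops count up to the
value of a variable below `r`. -/
def wf (r : ℕ) : FProg → Bool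
  | assign v e => 10 ≤ v && e.tame
  | store _ _ e => e.tame
  | draw _ => true
  | seq p q => p.wf r && q.wf r
  | cond _ p q => p.wf r && q.wf r
  | forb v u p => u < r && 10 ≤ v && !p.writes.contains v && p.wf r

theorem notMem_writes_of_wf {r : ℕ} {p : FProg} (hp : p.wf r = true) {v : ℕ} (hv : v < 10) :
    v ∉ p.writes := by
  induction p with
  | assign w e => simp [wf] at hp; simp [writes]; omega
  | store A d e => simp [writes]
  | draw A => simp [writes]
  | seq p q ihp ihq => simp [wf] at hp; simp [writes, ihp hp.1, ihq hp.2]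
  | cond e p q ihp ihq => simp [wf] at hp; simp [writes, ihp hp.1, ihq hp.2]
  | forb w u p ih =>
    simp [wf] at hp
    simp [writes, ih hp.2]; omega

/-- The bound does not grow with the number of rounds, so numbers keep polynomial length even in a
loop with exponentially many rounds. -/
theorem bounded_den {n r : ℕ} (ω : ℕ → Example n) {M : ℕ} (hM : 1 ≤ M) {p : FProg}
    (hp : p.wf r = true) {s : Config} (hs : s.Bounded M) : (p.den ω s).Bounded M := by
  induction p generalizing s with
  | assign v e => simp [wf] at hp; exact hs.setVar (Expr.eval_le_of_tame hp.2 hs hM)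
  | store A d e => exact hs.setCell (Expr.eval_le_of_tame hp hs hM)
  | draw A => exact hs.load hM _ _
  | seq p q ihp ihq => simp [wf] at hp; exact ihq hp.2 (ihp hp.1 hs)
  | cond e p q ihp ihq =>
    simp [wf] at hp
    simp only [den]; split_ifs
    exacts [ihp hp.1 hs, ihq hp.2 hs]
  | forb v u p ih =>
    simp [wf] at hp
    exact (den_forb ω (fun _ s' => s'.Bounded M) _ rfl (hs.setVar (by omega))
      (fun i hi s' hs' _ => (ih hp.2 hs').setVar (by have := hs.1 u; omega)))

/-- The running time of a loop, from that of its body. -/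
theorem runs_forb {n r : ℕ} (ω : ℕ → Example n) {v u : ℕ} {p : FProg}
    (hp : (forb v u p).wf r = true) (hr : r ≤ 10)
    {M T : ℕ} (hM : 1 ≤ M) {s : Config} (hs : s.Bounded M)
    (hbody : ∀ s' : Config, s'.Bounded M → (∀ w < 10, s'.var w = s.var w) →
      Runs ω p.compile s' T (p.den ω s')) :
    Runs ω (forb v u p).compile s ((s.var u + 1) * (T + 11 * (M.size + 1) ^ 2))
      ((forb v u p).den ω s) := by
  have hp' := hp
  simp only [wf, Bool.and_eq_true, decide_eq_true_eq, Bool.not_eq_true', List.contains_eq_mem,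
    decide_eq_false_iff_not] at hp'
  obtain ⟨⟨⟨hu, hv⟩, hvp⟩, hp1⟩ := hp'
  have hro : ∀ i, ∀ w < 10, (rounds (p.den ω) v i s).var w = s.var w := fun i w hw =>
    rounds_var (by omega) (fun s' => den_var ω p (notMem_writes_of_wf hp1 hw) s') i s
  have hbd : ∀ i ≤ s.var u, (rounds (p.den ω) v i s).Bounded M := by
    intro i
    induction i with
    | zero => exact fun _ => hs.setVar (by omega)
    | succ i ih =>
      exact fun hi => Config.Bounded.setVar (bounded_den ω hM hp1 (ih (by omega)))
        (hi.trans (hs.1 u))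
  refine runs_forLoop (fun i => rounds (p.den ω) v i s) rfl (fun i hi => ?_)
    (fun i _ => hro i u (by omega)) (hbd _ le_rfl)
  refine ⟨p.den ω (rounds (p.den ω) v i s), hbody _ (hbd i hi.le) (hro i), ?_,
    bounded_den ω hM hp1 (hbd i hi.le), rfl⟩
  rw [den_var ω p hvp, rounds_self]

/-- The nesting depth of loops is fixed by the text and each loop has at most `R` rounds, because
its bound is a variable below `r` that is never written. Values enter only through their length
`M.size`. -/
theorem exists_time_bound {r : ℕ} (hr : r ≤ 10) {p : FProg} (hp : p.wf r = true) : ∃ C : ℕ,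
    ∀ (n : ℕ) (ω : ℕ → Example n) (s : Config) (M R : ℕ), 1 ≤ M → s.Bounded M →
      (∀ w < r, s.var w ≤ R) →
      Runs ω p.compile s (C * ((R + 1) * (M.size + 1) * (n + 1)) ^ C) (p.den ω s) := by
  have hY : ∀ R L n : ℕ, L + 1 ≤ (R + 1) * (L + 1) * (n + 1) ∧ n + 1 ≤ (R + 1) * (L + 1) * (n + 1)
      ∧ R + 1 ≤ (R + 1) * (L + 1) * (n + 1) := fun R L n =>
    ⟨by rw [mul_comm (R + 1), mul_assoc]; exact Nat.le_mul_of_pos_right _ (by positivity),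
      Nat.le_mul_of_pos_left _ (by positivity),
      by rw [mul_assoc]; exact Nat.le_mul_of_pos_right _ (by positivity)⟩
  have hC : ∀ {a b Y : ℕ}, 1 ≤ Y → a ≤ b → Y ^ a ≤ Y ^ b := fun h h' =>
    Nat.pow_le_pow_right h h'
  induction p with
  | assign v e =>
    obtain ⟨C, h⟩ := e.exists_cost_bound
    refine ⟨2 * C + 2, fun n ω s M R hM hs hR => ⟨_, ?_, .assign v e s⟩⟩
    obtain ⟨h1, h2⟩ := h s M hs
    obtain ⟨h3, -, -⟩ := hY R M.size n
    set Y := (R + 1) * (M.size + 1) * (n + 1)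
    have h4 : (M.size + 1) ^ 2 ≤ Y ^ (2 * C + 2) :=
      (Nat.pow_le_pow_left h3 2).trans (hC (by omega) (by omega))
    have h5 : M.size + 1 ≤ (M.size + 1) ^ 2 := Nat.le_self_pow (by norm_num) _
    nlinarith
  | store A d e =>
    obtain ⟨C, h⟩ := e.exists_cost_bound
    obtain ⟨C', h'⟩ := d.exists_cost_bound
    refine ⟨2 * C + 2 * C' + 2, fun n ω s M R hM hs hR => ⟨_, ?_, .store A d e s⟩⟩
    obtain ⟨h1, h2⟩ := h s M hs
    obtain ⟨h1', h2'⟩ := h' s M hs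
    obtain ⟨h3, -, -⟩ := hY R M.size n
    set Y := (R + 1) * (M.size + 1) * (n + 1)
    have h4 : (M.size + 1) ^ 2 ≤ Y ^ (2 * C + 2 * C' + 2) :=
      (Nat.pow_le_pow_left h3 2).trans (hC (by omega) (by omega))
    have h5 : M.size + 1 ≤ (M.size + 1) ^ 2 := Nat.le_self_pow (by norm_num) _
    nlinarith
  | draw A =>
    refine ⟨2, fun n ω s M R hM hs hR => ⟨_, ?_, .draw A s⟩⟩
    obtain ⟨-, h2, -⟩ := hY R M.size n
    set Y := (R + 1) * (M.size + 1) * (n + 1)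
    have : n.size ≤ n + 1 := by
      rw [Nat.size_le]; exact Nat.lt_two_pow_self.trans (Nat.pow_lt_pow_right (by norm_num) (by omega))
    nlinarith
  | seq p q ihp ihq =>
    simp only [wf, Bool.and_eq_true] at hp
    obtain ⟨C, h⟩ := ihp hp.1
    obtain ⟨C', h'⟩ := ihq hp.2
    refine ⟨C + C', fun n ω s M R hM hs hR => ?_⟩
    refine ((h n ω s M R hM hs hR).seq (h' n ω _ M R hM (bounded_den ω hM hp.1 hs)
      (fun w hw => ?_))).mono ?_
    · rw [den_var ω p (notMem_writes_of_wf hp.1 (by omega))]; exact hR w hw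
    · have h3 := (hY R M.size n).1
      set Y := (R + 1) * (M.size + 1) * (n + 1)
      rw [add_mul]
      exact Nat.add_le_add (Nat.mul_le_mul_left _ (hC (by omega) (by omega)))
        (Nat.mul_le_mul_left _ (hC (by omega) (by omega)))
  | cond e p q ihp ihq =>
    simp only [wf, Bool.and_eq_true] at hp
    obtain ⟨C, h⟩ := ihp hp.1
    obtain ⟨C', h'⟩ := ihq hp.2
    obtain ⟨D, hD⟩ := e.exists_cost_bound
    refine ⟨C + C' + D + 2, fun n ω s M R hM hs hR => ?_⟩
    have h3 := (hY R M.size n).1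
    have h2 := (hD s M hs).2
    obtain ⟨τ, hτ, e1⟩ := h n ω s M R hM hs hR
    obtain ⟨τ', hτ', e2⟩ := h' n ω s M R hM hs hR
    set Y := (R + 1) * (M.size + 1) * (n + 1)
    have h4 : (M.size + 1) ^ 2 ≤ Y ^ (C + C' + D + 2) :=
      (Nat.pow_le_pow_left h3 2).trans (hC (by omega) (by omega))
    have h5 : Y ^ C ≤ Y ^ (C + C' + D + 2) := hC (by omega) (by omega)
    have h6 : Y ^ C' ≤ Y ^ (C + C' + D + 2) := hC (by omega) (by omega)
    have h7 : 1 ≤ Y ^ (C + C' + D + 2) := Nat.one_le_pow _ _ (by omega)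
    have h8 := Nat.mul_le_mul_left C h5
    have h9 := Nat.mul_le_mul_left C' h6
    have h10 := Nat.mul_le_mul_left D h4
    have h11 : ∀ x y : ℕ, x ≤ D * (M.size + 1) ^ 2 → (y ≤ C * Y ^ C ∨ y ≤ C' * Y ^ C') →
        x + 1 + y ≤ (C + C' + D + 2) * Y ^ (C + C' + D + 2) := by
      intro x y hx hy
      generalize Y ^ (C + C' + D + 2) = P at *
      rw [add_mul, add_mul, add_mul]
      rcases hy with hy | hy <;> linarith [Nat.zero_le (C * P), Nat.zero_le (C' * P)]
    by_cases he : e.eval s = 0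
    · have e3 := Exec.cond_false (p := p.compile) he e2
      rw [show (cond e p q).den ω s = q.den ω s by simp [den, he]]
      exact ⟨_, h11 _ _ h2 (.inr hτ'), e3⟩
    · have e3 := Exec.cond_true (q := q.compile) he e1
      rw [show (cond e p q).den ω s = p.den ω s by simp [den, he]]
      exact ⟨_, h11 _ _ h2 (.inl hτ), e3⟩
  | forb v u p ih =>
    have hp' := hp
    simp only [wf, Bool.and_eq_true, decide_eq_true_eq] at hp'
    obtain ⟨C, h⟩ := ih hp'.2
    refine ⟨C + 14, fun n ω s M R hM hs hR => ?_⟩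
    refine (runs_forb ω hp hr hM hs (fun s' hs' hw => h n ω s' M R hM hs' fun w hw' => ?_)).mono ?_
    · rw [hw w (by omega)]; exact hR w hw'
    · obtain ⟨h3, -, h4⟩ := hY R M.size n
      have hu := hR u hp'.1.1.1
      set Y := (R + 1) * (M.size + 1) * (n + 1)
      have h5 : (M.size + 1) ^ 2 ≤ Y ^ (C + 13) :=
        (Nat.pow_le_pow_left h3 2).trans (hC (by omega) (by omega))
      have h6 : Y ^ C ≤ Y ^ (C + 13) := hC (by omega) (by omega)
      clear_value Y
      -- One more factor `Y` pays for the rounds.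
      have h7 : Y * (C * Y ^ (C + 13) + 11 * Y ^ (C + 13)) = (C + 11) * Y ^ (C + 14) := by
        rw [pow_succ Y (C + 13)]; generalize Y ^ (C + 13) = P; ring
      have h8 : (s.var u + 1) * (C * Y ^ C + 11 * (M.size + 1) ^ 2)
          ≤ Y * (C * Y ^ (C + 13) + 11 * Y ^ (C + 13)) :=
        Nat.mul_le_mul (by omega)
          (Nat.add_le_add (Nat.mul_le_mul_left _ h6) (Nat.mul_le_mul_left _ h5))
      have h9 : (C + 11) * Y ^ (C + 14) ≤ (C + 14) * Y ^ (C + 14) := by gcongr; omega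
      omega

end FProg

/-! ### Codes for sets of blocks and for error patterns -/

/-- One step of decoding a set of blocks, in a state `(z, cur, hit)`: the lowest bit of the code `z`
says whether to select a block of the current superblock or to pass to the previous superblock;
`hit` records whether the block `b` has been selected. -/
def blockStep (q b : ℕ) (t : ℕ × ℕ × ℕ) : ℕ × ℕ × ℕ :=
  if t.1 % 2 ≠ 0 then
    (t.1 / 2 / q, t.2.1,
      if 0 < t.2.2 + (if t.2.1 * q + t.1 / 2 % q = b then 1 else 0) then 1 else 0)
  else (t.1 / 2, t.2.1 - 1, t.2.2)

/-- Whether the code `Z` selects the block `b`. -/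
def blockHit (q k Z b : ℕ) : ℕ := ((blockStep q b)^[2 * k] (Z, k, 0)).2.2

/-- What remains of the code `Z` when its blocks have been decoded. -/
def blockTail (q k Z : ℕ) : ℕ := ((blockStep q 0)^[2 * k] (Z, k, 0)).1

/-- The queried block and the flag `hit` never influence how the code is consumed; hence the tail
can be defined with block `0` and is the same for all queries. -/
theorem blockStep_iterate_fst (q b b' : ℕ) (j : ℕ) (z cur h h' : ℕ) :
    ((blockStep q b)^[j] (z, cur, h)).1 = ((blockStep q b')^[j] (z, cur, h')).1 := by
  induction j generalizing z cur h h' with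
  | zero => rfl
  | succ j ih =>
    rw [Function.iterate_succ_apply, Function.iterate_succ_apply]
    by_cases hz : z % 2 = 0 <;> simp only [blockStep, hz, ne_eq, not_true_eq_false, if_false,
      not_false_eq_true, if_true] <;> exact ih _ _ _ _

/-- Stars and bars: walk down from superblock `cur`, spending one bit on each descent, and one bit
and a base-`q` digit on each selected block. This takes at most `cur + S.card` steps, and one factor
`q` for each selected block. -/
theorem exists_block_code {q : ℕ} (hq : 1 ≤ q) {R tail : ℕ} (ht : tail < R) (F cur : ℕ)
    (S : Finset ℕ) (hS : ∀ b ∈ S, b / q ≤ cur) (hF : cur + S.card ≤ F) :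
    ∃ Z < 2 ^ F * q ^ S.card * R, ∀ b h, h ≤ 1 →
      ((blockStep q b)^[F] (Z, cur, h)).1 = tail ∧
      ((blockStep q b)^[F] (Z, cur, h)).2.2 = if b ∈ S then 1 else h := by
  induction F generalizing cur S with
  | zero =>
    obtain rfl : S = ∅ := Finset.card_eq_zero.mp (by omega)
    exact ⟨tail, by simpa using ht, fun b h _ => by simp⟩
  | succ F ih =>
    by_cases hb : ∃ b₀ ∈ S, b₀ / q = cur
    · obtain ⟨b₀, hb₀, hc⟩ := hb
      have hcard := Finset.card_erase_add_one hb₀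
      obtain ⟨Z, hZ, h⟩ := ih cur (S.erase b₀) (fun b hb => hS b (Finset.mem_of_mem_erase hb))
        (by omega)
      have hr : b₀ % q < q := Nat.mod_lt _ hq
      have e1 : (1 + 2 * (b₀ % q + q * Z)) % 2 = 1 := by omega
      have e2 : (1 + 2 * (b₀ % q + q * Z)) / 2 = b₀ % q + q * Z := by omega
      have e3 : (b₀ % q + q * Z) % q = b₀ % q := by rw [Nat.add_mul_mod_self_left, Nat.mod_mod]
      have e4 : (b₀ % q + q * Z) / q = Z := by
        rw [Nat.add_mul_div_left _ _ hq, Nat.div_eq_of_lt hr, zero_add]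
      have e5 : cur * q + b₀ % q = b₀ := by rw [← hc, mul_comm]; exact Nat.div_add_mod b₀ q
      -- The bit `1` and the digit `b₀ % q` are put in front of the code of the remaining blocks.
      refine ⟨1 + 2 * (b₀ % q + q * Z), ?_, fun b h₀ hh => ?_⟩
      · rw [← hcard]
        have h1 : q * (Z + 1) ≤ q * (2 ^ F * q ^ (S.erase b₀).card * R) :=
          Nat.mul_le_mul_left _ hZ
        have h2 : 2 ^ (F + 1) * q ^ ((S.erase b₀).card + 1) * R
            = 2 * (q * (2 ^ F * q ^ (S.erase b₀).card * R)) := by ring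
        have h3 : q * (Z + 1) = q * Z + q := by ring
        omega
      · rw [Function.iterate_succ_apply]
        simp only [blockStep, e1, e2, e3, e4, e5, ne_eq, one_ne_zero, not_false_eq_true, if_true]
        obtain ⟨h1, h2⟩ := h b (if 0 < h₀ + (if b₀ = b then 1 else 0) then 1 else 0)
          (by split_ifs <;> omega)
        refine ⟨h1, h2.trans ?_⟩
        by_cases hbb : b = b₀
        · subst hbb; simp [hb₀]
        · have : b₀ ≠ b := fun h => hbb h.symm
          by_cases hbS : b ∈ S
          · simp [hbS, hbb]
          · simp only [Finset.mem_erase, hbS, and_false, if_false, this, add_zero]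
            split_ifs <;> omega
    · push Not at hb
      have hb' : ∀ b ∈ S, b / q ≤ cur - 1 := fun b hbS => by
        have := hS b hbS; have := hb b hbS; omega
      have hF' : cur - 1 + S.card ≤ F := by
        -- At superblock `0` no block is left, and the remaining steps read bits `0` while the
        -- truncated subtraction stays at `0`.
        rcases Nat.eq_zero_or_pos cur with rfl | hc
        · have : S = ∅ := by
            by_contra hne
            obtain ⟨b, hbS⟩ := Finset.nonempty_iff_ne_empty.mpr hne
            exact hb b hbS (Nat.le_zero.mp (hS b hbS))
          simp [this]
        · omega
      obtain ⟨Z, hZ, h⟩ := ih (cur - 1) S hb' hF'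
      refine ⟨2 * Z, ?_, fun b h₀ hh => ?_⟩
      · calc 2 * Z < 2 * (2 ^ F * q ^ S.card * R) := by omega
          _ = _ := by ring
      · rw [Function.iterate_succ_apply]
        have e1 : 2 * Z % 2 = 0 := by omega
        have e2 : 2 * Z / 2 = Z := by omega
        simp only [blockStep, e1, e2, ne_eq, not_true_eq_false, if_false]
        exact h b h₀ hh

/-- One step of decoding an error pattern, in a state `(z, f)`: the digits of `z` in base `m + 1`
are the positions of the errors, shifted by one; `f` is the error bit of the `i`-th example. -/
def flipStep (m i : ℕ) (t : ℕ × ℕ) : ℕ × ℕ :=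
  (t.1 / (m + 1), (t.2 + if t.1 % (m + 1) = i + 1 then 1 else 0) % 2)

/-- The error bit of the `i`-th example in the error pattern with code `z`. -/
def flipBit (m k z i : ℕ) : ℕ := ((flipStep m i)^[k] (z, 0)).2

theorem flipBit_lt_two (m k z i : ℕ) : flipBit m k z i < 2 := by
  rcases k with _ | k
  · simp [flipBit]
  · rw [flipBit, Function.iterate_succ_apply']
    exact Nat.mod_lt _ (by norm_num)

/-- The error at `e` is the digit `e + 1`, so that the digit `0` means no error: a decoder with a
fixed number `F` of steps reads shorter patterns as padded by zeros, while the size of the code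
depends on `E.card` alone. -/
theorem exists_flip_code {m : ℕ} (F : ℕ) (E : Finset ℕ) (hE : ∀ e ∈ E, e < m)
    (hF : E.card ≤ F) : ∃ z < (m + 1) ^ E.card, ∀ i f, f < 2 →
      ((flipStep m i)^[F] (z, f)).2 = (f + if i ∈ E then 1 else 0) % 2 := by
  induction F generalizing E with
  | zero =>
    obtain rfl : E = ∅ := Finset.card_eq_zero.mp (by omega)
    exact ⟨0, by simp, fun i f hf => by simp [Nat.mod_eq_of_lt hf]⟩
  | succ F ih =>
    rcases E.eq_empty_or_nonempty with rfl | ⟨e, he⟩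
    · obtain ⟨z, hz, h⟩ := ih ∅ (by simp) (by simp)
      simp only [Finset.card_empty, pow_zero, Nat.lt_one_iff] at hz
      subst hz
      refine ⟨0, by simp, fun i f hf => ?_⟩
      rw [Function.iterate_succ_apply]
      simpa [flipStep, Nat.mod_eq_of_lt hf] using h i f hf
    · have hcard := Finset.card_erase_add_one he
      obtain ⟨z, hz, h⟩ := ih (E.erase e) (fun a ha => hE a (Finset.mem_of_mem_erase ha)) (by omega)
      have hem := hE e he
      have e1 : (e + 1 + (m + 1) * z) % (m + 1) = e + 1 := by
        rw [Nat.add_mul_mod_self_left, Nat.mod_eq_of_lt (by omega)]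
      have e2 : (e + 1 + (m + 1) * z) / (m + 1) = z := by
        rw [Nat.add_mul_div_left _ _ (by omega), Nat.div_eq_of_lt (by omega), zero_add]
      refine ⟨e + 1 + (m + 1) * z, ?_, fun i f hf => ?_⟩
      · rw [← hcard, pow_succ']
        calc e + 1 + (m + 1) * z < (m + 1) * (z + 1) := by rw [mul_add]; omega
          _ ≤ _ := Nat.mul_le_mul_left _ hz
      · rw [Function.iterate_succ_apply]
        simp only [flipStep, e1, e2]
        rw [h i _ (Nat.mod_lt _ (by norm_num))]
        by_cases hi : i = e
        · subst hi; simp [he]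
        · have : ¬ e = i := fun h => hi h.symm
          simp [Finset.mem_erase, hi, this]

/-- Every pair of a set `S` of at most `k` blocks and a sparse error pattern `E` has a code. -/
theorem exists_code {q k m : ℕ} (hq : 1 ≤ q) {S E : Finset ℕ} (hS : ∀ b ∈ S, b < k * q)
    (hSk : S.card ≤ k) (hE : ∀ e ∈ E, e < m) (hEk : E.card ≤ k) (hEm : (m + 1) ^ E.card ≤ 2 ^ k) :
    ∃ Z < (8 * q) ^ k, (∀ b, blockHit q k Z b = if b ∈ S then 1 else 0) ∧
      ∀ i, flipBit m k (blockTail q k Z) i = if i ∈ E then 1 else 0 := by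
  obtain ⟨z, hz, hflip⟩ := exists_flip_code k E hE hEk
  obtain ⟨Z, hZ, hblock⟩ := exists_block_code hq (hz.trans_le hEm) (2 * k) k S
    (fun b hb => (Nat.div_lt_of_lt_mul (by rw [mul_comm]; exact hS b hb)).le) (by omega)
  refine ⟨Z, hZ.trans_le ?_, fun b => (hblock b 0 (by norm_num)).2, fun i => ?_⟩
  · have h1 : q ^ S.card ≤ q ^ k := Nat.pow_le_pow_right hq hSk
    calc 2 ^ (2 * k) * q ^ S.card * 2 ^ k ≤ 2 ^ (2 * k) * q ^ k * 2 ^ k := by gcongr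
      _ = (8 * q) ^ k := by
        rw [mul_pow, show (8 : ℕ) = 2 ^ 3 by norm_num, ← pow_mul]; ring
  · rw [flipBit, blockTail, (hblock 0 0 (by norm_num)).1, hflip i 0 (by norm_num)]
    split_ifs <;> simp

/-! ### Gaussian elimination over the field with two elements -/

/-- `y` solves the linear system whose rows are `M 0, …, M (m - 1)`, with the right-hand sides in
column `n`. -/
def Solves (m n : ℕ) (M : ℕ → ℕ → ZMod 2) (y : ℕ → ZMod 2) : Prop :=
  ∀ r < m, ∑ c ∈ Finset.range n, M r c * y c = M r n

/-- The state of the elimination after `i` rows, for a system that has the solution `x` and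
determines the unknowns in `col`: each treated row is zero or has a pivot, recorded in `piv`. -/
structure Eliminated (m n : ℕ) (col : ℕ → Prop) (x : ℕ → ZMod 2) (i : ℕ) (M : ℕ → ℕ → ZMod 2)
    (piv : ℕ → ℕ) : Prop where
  solves : Solves m n M x
  unique : ∀ y, Solves m n M y → ∀ c < n, col c → y c = x c
  zero : ∀ r < m, ∀ c < n, ¬ col c → M r c = 0
  rows : ∀ r < i, (∀ c < n, M r c = 0) ∨
    ∃ p < n, piv p = r ∧ ∀ r' < m, M r' p = if r' = r then 1 else 0

theorem Eliminated.skip {m n : ℕ} {col : ℕ → Prop} {x : ℕ → ZMod 2} {i : ℕ} {M : ℕ → ℕ → ZMod 2}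
    {piv : ℕ → ℕ} (h : Eliminated m n col x i M piv) (hrow : ∀ c < n, M i c = 0) :
    Eliminated m n col x (i + 1) M piv := by
  refine ⟨h.solves, h.unique, h.zero, fun r hr => ?_⟩
  rcases Nat.lt_succ_iff_lt_or_eq.mp hr with hr | rfl
  · exact h.rows r hr
  · exact .inl hrow

theorem ZMod.two_eq_one_of_ne_zero {a : ZMod 2} (h : a ≠ 0) : a = 1 := by
  revert h; revert a; decide

theorem ZMod.two_add_self (a : ZMod 2) : a + a = 0 := by
  revert a; decide

/-- Adding multiples of row `i` to the other rows is invertible, so the solutions stay the same. Row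
`i` vanishes in the earlier pivot columns, so these columns stay unit vectors. -/
theorem Eliminated.step {m n : ℕ} {col : ℕ → Prop} {x : ℕ → ZMod 2} {i p : ℕ}
    {M M' : ℕ → ℕ → ZMod 2} {piv : ℕ → ℕ} (h : Eliminated m n col x i M piv) (hi : i < m)
    (hp : p < n) (hM : M i p ≠ 0)
    (hM' : ∀ r < m, ∀ c ≤ n, M' r c = M r c + if r = i then 0 else M r p * M i c) :
    Eliminated m n col x (i + 1) M' (Function.update piv p i) := by
  have hM1 := ZMod.two_eq_one_of_ne_zero hM
  have hsol : ∀ y, Solves m n M' y ↔ Solves m n M y := by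
    intro y
    have key : ∀ r < m, ∑ c ∈ Finset.range n, M' r c * y c
        = ∑ c ∈ Finset.range n, M r c * y c +
          if r = i then 0 else M r p * ∑ c ∈ Finset.range n, M i c * y c := by
      intro r hr
      rw [Finset.sum_congr rfl fun c hc => by
        rw [hM' r hr c (Finset.mem_range.mp hc).le]]
      split_ifs
      · simp
      · rw [Finset.mul_sum, ← Finset.sum_add_distrib]
        exact Finset.sum_congr rfl fun c _ => by ring
    have hii : (∑ c ∈ Finset.range n, M' i c * y c = M' i n) ↔
        ∑ c ∈ Finset.range n, M i c * y c = M i n := by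
      rw [key i hi, hM' i hi n le_rfl]; simp
    constructor
    · intro hy r hr
      have h1 := hy r hr
      have h2 := hii.mp (hy i hi)
      rw [key r hr, hM' r hr n le_rfl, h2] at h1
      exact add_right_cancel h1
    · intro hy r hr
      rw [key r hr, hM' r hr n le_rfl, hy r hr, hy i hi]
  refine ⟨(hsol x).mpr h.solves, fun y hy => h.unique y ((hsol y).mp hy), fun r hr c hc hcol => ?_,
    fun r hr => ?_⟩
  · rw [hM' r hr c hc.le, h.zero r hr c hc hcol, h.zero i hi c hc hcol]; simp
  · rcases Nat.lt_succ_iff_lt_or_eq.mp hr with hr | rfl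
    · rcases h.rows r hr with h0 | ⟨p', hp', hpiv, hcol⟩
      · refine .inl fun c hc => ?_
        rw [hM' r (hr.trans hi) c hc.le, h0 c hc, h0 p hp]; simp
      · have hip' : M i p' = 0 := by rw [hcol i hi, if_neg (by omega)]
        have hne : p' ≠ p := by rintro rfl; exact hM hip'
        refine .inr ⟨p', hp', by rw [Function.update_of_ne hne, hpiv], fun r' hr' => ?_⟩
        rw [hM' r' hr' p' hp'.le, hip', hcol r' hr']; simp
    · refine .inr ⟨p, hp, by simp, fun r' hr' => ?_⟩
      rw [hM' r' hr' p hp.le, hM1]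
      split_ifs with he
      · subst he; rw [hM1, add_zero]
      · rw [mul_one, ZMod.two_add_self]

/-- Every determined column is a pivot column, since a column without pivot gives a free variable.
Hence the pivot row of `c` has its only nonzero coefficient at `c`: the other determined columns are
pivots of other rows, and the remaining columns vanish. The right-hand side of that row is then `x
c`. -/
theorem Eliminated.eq_solution {m n : ℕ} {col : ℕ → Prop} {x : ℕ → ZMod 2}
    {M : ℕ → ℕ → ZMod 2} {piv : ℕ → ℕ} (h : Eliminated m n col x m M piv) {c : ℕ} (hc : c < n)
    (hcol : col c) : M (piv c) n = x c := by
  classical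
  have hrows : ∀ r, ∃ p, r < m → (∀ c < n, M r c = 0) ∨
      (p < n ∧ piv p = r ∧ ∀ r' < m, M r' p = if r' = r then 1 else 0) := fun r => by
    by_cases hr : r < m
    · rcases h.rows r hr with h0 | ⟨p, h1⟩
      · exact ⟨0, fun _ => .inl h0⟩
      · exact ⟨p, fun _ => .inr h1⟩
    · exact ⟨0, fun h' => absurd h' hr⟩
  choose σ hσ using hrows
  have pivot : ∀ c < n, col c → ∃ r < m, σ r = c ∧ piv c = r ∧
      ∀ r' < m, M r' c = if r' = r then 1 else 0 := by
    intro c hc hcol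
    by_contra hno
    push Not at hno
    have hno' : ∀ r < m, σ r = c → ∀ c < n, M r c = 0 := fun r hr hrc => by
      rcases hσ r hr with h0 | ⟨_, h2, h3⟩
      · exact h0
      · subst hrc
        obtain ⟨r', hr', h4⟩ := hno r hr rfl h2
        exact absurd (h3 r' hr') h4
    -- The kernel vector with free variable `c`: its coordinate at the pivot `σ r'` cancels the
    -- entry of row `r'` in column `c`. Adding it to `x` gives a second solution, which differs from
    -- `x` at `c`.
    let d : ℕ → ZMod 2 := fun c' =>
      (if c' = c then 1 else 0) + ∑ r' ∈ Finset.range m, if c' = σ r' then M r' c else 0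
    have hd : ∀ r < m, ∑ c' ∈ Finset.range n, M r c' * d c' = 0 := by
      intro r hr
      simp only [d, mul_add, Finset.sum_add_distrib, Finset.mul_sum]
      rw [Finset.sum_comm]
      have e1 : ∑ c' ∈ Finset.range n, M r c' * (if c' = c then (1 : ZMod 2) else 0) = M r c := by
        simp [hc]
      have e2 : ∀ r' ∈ Finset.range m,
          ∑ c' ∈ Finset.range n, M r c' * (if c' = σ r' then M r' c else 0)
            = if r = r' then M r' c else 0 := by
        intro r' hr'
        have hr'm := Finset.mem_range.mp hr'
        rcases hσ r' hr'm with h0 | ⟨h1, _, h3⟩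
        · simp [h0 c hc]
        · simp only [mul_ite, mul_zero, Finset.sum_ite_eq', Finset.mem_range, h1, if_true, h3 r hr]
          split_ifs <;> simp
      rw [e1, Finset.sum_congr rfl e2]
      simp [hr, ZMod.two_add_self]
    have hy : Solves m n M fun c' => x c' + d c' := fun r hr => by
      simp only [mul_add, Finset.sum_add_distrib, hd r hr, h.solves r hr, add_zero]
    have h1 := h.unique _ hy c hc hcol
    have h2 : d c = 1 := by
      simp only [d, if_true]
      rw [Finset.sum_eq_zero, add_zero]
      intro r' hr'
      split_ifs with hcr
      · exact hno' r' (Finset.mem_range.mp hr') hcr.symm c hc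
      · rfl
    simp [h2] at h1
  obtain ⟨r, hr, hσr, hpr, hcr⟩ := pivot c hc hcol
  rw [hpr, ← h.solves r hr, Finset.sum_eq_single_of_mem c (Finset.mem_range.mpr hc)]
  · rw [hcr r hr]; simp
  · intro c' hc' hne
    have hc'n := Finset.mem_range.mp hc'
    by_cases hcol' : col c'
    · obtain ⟨r', hr', hσr', -, hcr'⟩ := pivot c' hc'n hcol'
      rw [hcr' r hr, if_neg, zero_mul]
      rintro rfl
      exact hne (hσr'.symm.trans hσr)
    · rw [h.zero r hr c' hc'n hcol', zero_mul]

/-! ### The program -/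

theorem Config.setVar_var (s : Config) (v m w : ℕ) :
    (s.setVar v m).var w = if w = v then m else s.var w := by
  simp [Config.setVar, Function.update_apply]

theorem Config.setVar_arr (s : Config) (v m : ℕ) : (s.setVar v m).arr = s.arr := rfl

theorem Config.setVar_drawn (s : Config) (v m : ℕ) : (s.setVar v m).drawn = s.drawn := rfl

theorem Config.setCell_var (s : Config) (A i m : ℕ) : (s.setCell A i m).var = s.var := rfl

theorem Config.setCell_arr (s : Config) (A i m A' i' : ℕ) :
    (s.setCell A i m).arr A' i' = if A' = A ∧ i' = i then m else s.arr A' i' := by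
  simp only [Config.setCell, Function.update_apply]
  by_cases h : A' = A
  · subst h; by_cases h' : i' = i <;> simp [h']
  · simp [h]

namespace FProg

theorem den_assign {n : ℕ} (ω : ℕ → Example n) (v : ℕ) (e : Expr) (s : Config) :
    (assign v e).den ω s = s.setVar v (e.eval s) := rfl

theorem den_store {n : ℕ} (ω : ℕ → Example n) (A : ℕ) (d e : Expr) (s : Config) :
    (store A d e).den ω s = s.setCell A (d.eval s) (e.eval s) := rfl

theorem den_draw {n : ℕ} (ω : ℕ → Example n) (A : ℕ) (s : Config) :
    (draw A).den ω s = s.load A (ω s.drawn) := rfl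

theorem den_seq {n : ℕ} (ω : ℕ → Example n) (p q : FProg) (s : Config) :
    (seq p q).den ω s = q.den ω (p.den ω s) := rfl

theorem den_cond {n : ℕ} (ω : ℕ → Example n) (e : Expr) (p q : FProg) (s : Config) :
    (cond e p q).den ω s = if e.eval s ≠ 0 then p.den ω s else q.den ω s := rfl

/-- Loop rule with an invariant, which may use that the loop changes only what it writes. -/
theorem den_forb_frame {n : ℕ} (ω : ℕ → Example n) {v u : ℕ} {p : FProg} {s : Config}
    (I : ℕ → Config → Prop) {c : ℕ} (hc : s.var u = c) (h0 : I 0 (s.setVar v 0))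
    (hstep : ∀ i < c, ∀ s', I i s' → s'.var v = i →
      (∀ w, w ∉ (forb v u p).writes → s'.var w = s.var w) →
      (∀ A, A ∉ p.stores → s'.arr A = s.arr A) → I (i + 1) ((p.den ω s').setVar v (i + 1))) :
    I c ((forb v u p).den ω s) := by
  refine (den_forb ω (fun i s' => I i s' ∧
      (∀ w, w ∉ (forb v u p).writes → s'.var w = s.var w) ∧
      (∀ A, A ∉ p.stores → s'.arr A = s.arr A)) c hc ⟨h0, fun w hw => ?_, fun _ _ => rfl⟩
    fun i hi s' ⟨h1, h2, h3⟩ hv => ⟨hstep i hi s' h1 hv h2 h3, fun w hw => ?_, fun A hA => ?_⟩).1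
  · simp only [writes, List.mem_cons, not_or] at hw
    simp [Config.setVar_var, hw.1]
  · have hw' := hw
    simp only [writes, List.mem_cons, not_or] at hw'
    rw [Config.setVar_var, if_neg hw'.1, den_var ω p hw'.2, h2 w hw]
  · rw [Config.setVar_arr, den_arr ω p hA, h3 A hA]

/-- The index of the cell in row `r` and column `c` of a matrix with rows of length `n + 1`. -/
def entry (r c : ℕ) : Expr := .op .add (.op .mul (.var r) (.var 7)) (.var c)

/-- The cell in the last column of row `r`. -/
def lastEntry (r : Expr) : Expr := .op .add (.op .mul r (.var 7)) (.var 0)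

def mod2 (e : Expr) : Expr := .op .mod e (.lit 2)

theorem mod2_eval (e : Expr) (s : Config) : (mod2 e).eval s = e.eval s % 2 := rfl

/-- Draw the examples and store them as the rows of array `1`. -/
def readExamples : FProg :=
  .forb 18 4 (.seq (.draw 7) (.forb 15 7 (.store 1 (entry 18 15) (.cell 7 (.var 15)))))

/-- Decode the blocks of the code in variable `10`, with variable `13` recording whether the block
of the position in variable `15` is selected. -/
def decodeBlocks : FProg :=
  .seq (.assign 11 (.var 10)) (.seq (.assign 12 (.var 1)) (.seq (.assign 13 (.lit 0))
    (.forb 14 6 (.cond (mod2 (.var 11))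
      (.seq (.assign 11 (.op .div (.var 11) (.lit 2)))
        (.seq (.assign 13 (.op .lt (.lit 0) (.op .add (.var 13)
            (.op .eq (.op .add (.op .mul (.var 12) (.var 2)) (.op .mod (.var 11) (.var 2)))
              (.op .div (.var 15) (.var 3))))))
          (.assign 11 (.op .div (.var 11) (.var 2)))))
      (.seq (.assign 11 (.op .div (.var 11) (.lit 2)))
        (.assign 12 (.op .sub (.var 12) (.lit 1))))))))

/-- Mark the selected positions in array `2`, and keep the rest of the code in variable `16`. -/
def markColumns : FProg :=
  .seq decodeBlocks (.seq (.assign 16 (.var 11))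
    (.forb 15 0 (.seq decodeBlocks (.store 2 (.var 15) (.var 13)))))

/-- Decode the error pattern into array `3`. -/
def markErrors : FProg :=
  .forb 18 4 (.seq (.assign 11 (.var 16)) (.seq (.assign 17 (.lit 0)) (.seq
    (.forb 14 1 (.seq
      (.assign 17 (mod2 (.op .add (.var 17)
        (.op .eq (.op .mod (.var 11) (.var 5)) (.op .add (.var 18) (.lit 1))))))
      (.assign 11 (.op .div (.var 11) (.var 5)))))
    (.store 3 (.var 18) (.var 17)))))

/-- Write the linear system for the selected positions into array `4`. -/
def buildSystem : FProg :=
  .forb 18 4 (.seq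
    (.forb 15 0 (.store 4 (entry 18 15)
      (mod2 (.op .mul (.cell 1 (entry 18 15)) (.cell 2 (.var 15))))))
    (.store 4 (lastEntry (.var 18))
      (mod2 (.op .add (.cell 1 (lastEntry (.var 18))) (.cell 3 (.var 18))))))

/-- Look in row `18` of array `4` for a pivot, to be put into variable `19`. -/
def findPivot : FProg :=
  -- The value `n` stands for the absence of a pivot; the branch that assigns variable `19` to
  -- itself does nothing.
  .seq (.assign 19 (.var 0))
    (.forb 15 0 (.cond (mod2 (.cell 4 (entry 18 15))) (.assign 19 (.var 15))
      (.assign 19 (.var 19))))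

/-- Clear column `19` of array `4` outside row `18`. -/
def clearColumn : FProg :=
  .forb 20 4 (.seq
    (.assign 21 (mod2 (.op .mul (.cell 4 (entry 20 19))
      (.op .sub (.lit 1) (.op .eq (.var 20) (.var 18))))))
    (.forb 15 7 (.store 4 (entry 20 15) (mod2 (.op .add (.cell 4 (entry 20 15))
      (.op .mul (.var 21) (.cell 4 (entry 18 15))))))))

def eliminate : FProg :=
  .forb 18 4 (.seq findPivot (.cond (.op .lt (.var 19) (.var 0))
    (.seq (.store 5 (.var 19) (.var 18)) clearColumn) (.assign 19 (.var 19))))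

/-- Read off a candidate solution into array `6`. -/
def readSolution : FProg :=
  .forb 15 0 (.store 6 (.var 15)
    -- At unselected positions array `5` may hold stale rows; the mark from array `2` cancels what
    -- is read there.
    (mod2 (.op .mul (.cell 4 (lastEntry (.cell 5 (.var 15)))) (.cell 2 (.var 15)))))

/-- Compute `n` minus the weight of the candidate in variable `23`. -/
def checkWeight : FProg :=
  -- Counting down from `n` instead of up from `0` keeps the assignment tame.
  .seq (.assign 23 (.var 0)) (.forb 15 0 (.assign 23 (.op .sub (.var 23) (.cell 6 (.var 15)))))

/-- Leave `0` in variable `22` if the candidate explains all examples up to the errors. -/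
def checkExamples : FProg :=
  .seq (.assign 22 (.lit 0)) (.forb 18 4 (.seq
    (.assign 24 (mod2 (.op .add (.cell 1 (lastEntry (.var 18))) (.cell 3 (.var 18)))))
    (.seq
      (.forb 15 0 (.assign 24 (mod2 (.op .add (.var 24)
        (.op .mul (.cell 1 (entry 18 15)) (.cell 6 (.var 15)))))))
      (.assign 22 (.op .lt (.lit 0) (.op .add (.var 22) (.var 24)))))))

def writeOutput : FProg :=
  .cond (.op .mul (.op .eq (.op .add (.var 23) (.var 1)) (.var 0)) (.op .eq (.var 22) (.lit 0)))
    (.forb 15 0 (.store 0 (.var 15) (.cell 6 (.var 15)))) (.assign 15 (.var 15))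

/-- Compute a candidate from the selected positions and the error pattern. -/
def solveSystem : FProg :=
  .seq markColumns (.seq markErrors (.seq buildSystem (.seq eliminate readSolution)))

def testCandidate : FProg := .seq checkWeight (.seq checkExamples writeOutput)

/-- Try the code in variable `10`. -/
def tryCode : FProg := .seq solveSystem testCandidate

/-- The index `9` says that no loop inside is bounded by variable `9`, which holds the exponential
number of codes. -/
theorem wf_tryCode : tryCode.wf 9 = true := by decide

theorem wf_readExamples : readExamples.wf 9 = true := by decide

/-- The variables that hold the parameters of the algorithm. -/
structure Params (n k q B m : ℕ) (s : Config) : Prop where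
  v0 : s.var 0 = n
  v1 : s.var 1 = k
  v2 : s.var 2 = q
  v3 : s.var 3 = B
  v4 : s.var 4 = m
  v5 : s.var 5 = m + 1
  v6 : s.var 6 = 2 * k
  v7 : s.var 7 = n + 1

theorem Params.congr {n k q B m : ℕ} {s s' : Config} (h : Params n k q B m s)
    (hs : ∀ w < 8, s'.var w = s.var w) : Params n k q B m s' :=
  ⟨(hs 0 (by norm_num)).trans h.v0, (hs 1 (by norm_num)).trans h.v1,
    (hs 2 (by norm_num)).trans h.v2, (hs 3 (by norm_num)).trans h.v3,
    (hs 4 (by norm_num)).trans h.v4, (hs 5 (by norm_num)).trans h.v5,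
    (hs 6 (by norm_num)).trans h.v6, (hs 7 (by norm_num)).trans h.v7⟩

theorem Params.den {n n' k q B m r : ℕ} {s : Config} (h : Params n k q B m s)
    (ω : ℕ → Example n') {p : FProg} (hp : p.wf r = true) : Params n k q B m (p.den ω s) :=
  h.congr fun _ hw => den_var ω p (notMem_writes_of_wf hp (by omega)) s

/-! ### Correctness of the decoding, of the input and of the construction of the linear system. -/

variable {n' : ℕ} (ω : ℕ → Example n') {n k q B m : ℕ} {s : Config}

theorem entry_inj {r c r' c' : ℕ} (hc : c ≤ n) (hc' : c' ≤ n)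
    (h : r * (n + 1) + c = r' * (n + 1) + c') : r = r' ∧ c = c' := by
  have h1 : (r * (n + 1) + c) / (n + 1) = r := by
    rw [mul_comm, Nat.mul_add_div (by omega), Nat.div_eq_of_lt (by omega), add_zero]
  have h2 : (r' * (n + 1) + c') / (n + 1) = r' := by
    rw [mul_comm, Nat.mul_add_div (by omega), Nat.div_eq_of_lt (by omega), add_zero]
  have h3 : r = r' := by rw [← h1, ← h2, h]
  subst h3
  exact ⟨rfl, by omega⟩

/-- A loop that rewrites row `r` of a matrix. -/
theorem den_rowLoop {r u cnt A : ℕ} {e : Expr} (val : ℕ → ℕ) (h7 : s.var 7 = n + 1)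
    (hu : s.var u = cnt) (hr : r ≠ 15)
    (hval : ∀ i < cnt, ∀ s' : Config, s'.var 15 = i → (∀ w, w ≠ 15 → s'.var w = s.var w) →
      (∀ A', A' ≠ A → s'.arr A' = s.arr A') →
      (∀ j, (∀ c < i, j ≠ s.var r * (n + 1) + c) → s'.arr A j = s.arr A j) → e.eval s' = val i) :
    (∀ c < cnt, ((forb 15 u (.store A (entry r 15) e)).den ω s).arr A (s.var r * (n + 1) + c)
      = val c) ∧
    ∀ j, (∀ c < cnt, j ≠ s.var r * (n + 1) + c) →
      ((forb 15 u (.store A (entry r 15) e)).den ω s).arr A j = s.arr A j := by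
  refine den_forb_frame ω (fun i s' => (∀ c < i, s'.arr A (s.var r * (n + 1) + c) = val c) ∧
    ∀ j, (∀ c < i, j ≠ s.var r * (n + 1) + c) → s'.arr A j = s.arr A j) hu
    ⟨by simp, fun j _ => rfl⟩ ?_
  rintro i hi s' ⟨h1, h2⟩ hv hw hA
  simp only [writes, stores, List.mem_cons, List.not_mem_nil, or_false] at hw hA
  have he := hval i hi s' hv hw hA h2
  simp only [den_store, Config.setVar_arr, Config.setCell_arr, true_and, entry, Expr.eval, Op.eval, he,
    hv, hw r hr, hw 7 (by norm_num), h7]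
  refine ⟨fun c hc => ?_, fun j hj => ?_⟩
  · rcases Nat.lt_succ_iff_lt_or_eq.mp hc with hc' | rfl
    · rw [if_neg (by omega), h1 c hc']
    · simp
  · rw [if_neg (hj i (by omega)), h2 j fun c hc => hj c (by omega)]

theorem decodeBlocks_spec (h : Params n k q B m s) :
    (decodeBlocks.den ω s).var 11 =
      ((blockStep q (s.var 15 / B))^[2 * k] (s.var 10, k, 0)).1 ∧
    (decodeBlocks.den ω s).var 13 = blockHit q k (s.var 10) (s.var 15 / B) := by
  set b := s.var 15 / B
  suffices H : ((decodeBlocks.den ω s).var 11, (decodeBlocks.den ω s).var 12,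
      (decodeBlocks.den ω s).var 13) = (blockStep q b)^[2 * k] (s.var 10, k, 0) by
    rw [blockHit, ← H]; exact ⟨rfl, rfl⟩
  simp only [decodeBlocks, den_seq, den_assign]
  refine den_forb_frame ω (fun i s' => (s'.var 11, s'.var 12, s'.var 13) =
    (blockStep q b)^[i] (s.var 10, k, 0)) ?_ ?_ ?_
  · simp [Config.setVar_var, h.v6]
  · simp [Config.setVar_var, h.v1, Expr.eval]
  · intro i hi s' hI hv hw hA
    rw [Function.iterate_succ_apply', ← hI]
    have h2 : s'.var 2 = q := by rw [hw 2 (by decide)]; simp [Config.setVar_var, h.v2]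
    have h3 : s'.var 3 = B := by rw [hw 3 (by decide)]; simp [Config.setVar_var, h.v3]
    have h15 : s'.var 15 = s.var 15 := by rw [hw 15 (by decide)]; simp [Config.setVar_var]
    by_cases hz : s'.var 11 % 2 = 0 <;>
      simp [den_seq, den_assign, den_cond, Config.setVar_var, Expr.eval, Op.eval, mod2, blockStep, hz, h2, h3, h15, b]

theorem markColumns_spec (h : Params n k q B m s) :
    (∀ c < n, (markColumns.den ω s).arr 2 c = blockHit q k (s.var 10) (c / B)) ∧
    (markColumns.den ω s).var 16 = blockTail q k (s.var 10) := by
  have hwf : decodeBlocks.wf 9 = true := by decide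
  simp only [markColumns, den_seq, den_assign]
  constructor
  · refine den_forb_frame ω (fun i s' => ∀ c < i,
      s'.arr 2 c = blockHit q k (s.var 10) (c / B)) ?_ (by simp) ?_
    · simp [Config.setVar_var, (h.den ω hwf).v0]
    · intro i hi s' hI hv hw hA c hc
      have hp : Params n k q B m s' := ((h.den ω hwf).congr fun w hw' => by
        rw [hw w (notMem_writes_of_wf (r := 9) (by decide) (by omega)), Config.setVar_var, if_neg (by omega)])
      have h10 : s'.var 10 = s.var 10 := by
        rw [hw 10 (by decide), Config.setVar_var, if_neg (by decide), den_var ω _ (by decide)]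
      have hd := (decodeBlocks_spec ω hp).2
      have h15 : (decodeBlocks.den ω s').var 15 = i := by rw [den_var ω _ (by decide), hv]
      simp only [den_seq, den_store, Config.setVar_arr, Config.setCell_arr, true_and, Expr.eval, h15]
      split_ifs with hci
      · rw [hd, h10, hv, hci]
      · rw [den_arr ω _ (by decide)]; exact hI c (by omega)
  · rw [den_var ω _ (by decide), Config.setVar_var, if_pos rfl, Expr.eval,
      (decodeBlocks_spec ω h).1, blockTail]
    -- The first decoding is run with whatever variable `15` holds; the tail does not depend on it.
    exact blockStep_iterate_fst _ _ _ _ _ _ _ _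

theorem markErrors_spec (h : Params n k q B m s) :
    ∀ i < m, (markErrors.den ω s).arr 3 i = flipBit m k (s.var 16) i := by
  refine den_forb_frame ω (fun j s' => ∀ i < j, s'.arr 3 i = flipBit m k (s.var 16) i) h.v4
    (by simp) ?_
  intro i hi s' hI hv hw hA j hj
  have hp : Params n k q B m s' := h.congr fun w hw' =>
    hw w (notMem_writes_of_wf (r := 9) (by decide) (by omega))
  have h16 : s'.var 16 = s.var 16 := hw 16 (by decide)
  simp only [den_seq, den_assign, den_store, Config.setVar_arr, Config.setCell_arr, true_and,
    Expr.eval]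
  rw [den_var ω _ (by decide)]
  simp only [Config.setVar_var]
  norm_num
  rw [hv]
  split_ifs with hji
  · subst hji
    rw [flipBit]
    refine (congrArg Prod.snd (a₁ := ((_ : ℕ), _)) (den_forb_frame ω
      (fun t s' => (s'.var 11, s'.var 17) = (flipStep m j)^[t] (s.var 16, 0)) ?_ ?_ ?_ :))
    · simp [Config.setVar_var, hp.v1]
    · simp [Config.setVar_var, h16]
    · intro t ht s'' hI' hv' hw' hA'
      rw [Function.iterate_succ_apply', ← hI']
      have h5 : s''.var 5 = m + 1 := by rw [hw' 5 (by decide)]; simp [Config.setVar_var, hp.v5]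
      have h18 : s''.var 18 = j := by rw [hw' 18 (by decide)]; simp [Config.setVar_var, hv]
      simp [den_seq, den_assign, Config.setVar_var, Expr.eval, Op.eval, mod2, flipStep, h5, h18]
  · rw [den_arr ω _ (by decide)]
    exact hI j (by omega)

theorem lastEntry_eval (h : Params n k q B m s) (r : Expr) :
    (lastEntry r).eval s = r.eval s * (n + 1) + n := by
  simp [lastEntry, Expr.eval, Op.eval, h.v7, h.v0]

theorem entry_eval (h : Params n k q B m s) (r c : ℕ) :
    (entry r c).eval s = s.var r * (n + 1) + s.var c := by
  simp [entry, Expr.eval, Op.eval, h.v7]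

theorem buildSystem_spec (h : Params n k q B m s) :
    ∀ r < m, (∀ c < n, (buildSystem.den ω s).arr 4 (r * (n + 1) + c)
        = s.arr 1 (r * (n + 1) + c) * s.arr 2 c % 2) ∧
      (buildSystem.den ω s).arr 4 (r * (n + 1) + n)
        = (s.arr 1 (r * (n + 1) + n) + s.arr 3 r) % 2 := by
  refine den_forb_frame ω (fun i s' => ∀ r < i, (∀ c < n, s'.arr 4 (r * (n + 1) + c)
        = s.arr 1 (r * (n + 1) + c) * s.arr 2 c % 2) ∧
      s'.arr 4 (r * (n + 1) + n) = (s.arr 1 (r * (n + 1) + n) + s.arr 3 r) % 2) h.v4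
    (by simp) ?_
  intro i hi s' hI hv hw hA
  have hp : Params n k q B m s' := h.congr fun w hw' =>
    hw w (notMem_writes_of_wf (r := 9) (by decide) (by omega))
  have hA1 := hA 1 (by decide)
  have hA2 := hA 2 (by decide)
  have hA3 := hA 3 (by decide)
  obtain ⟨hL1, hL2⟩ := den_rowLoop ω (r := 18) (u := 0) (cnt := n) (A := 4) (s := s')
    (e := mod2 (.op .mul (.cell 1 (entry 18 15)) (.cell 2 (.var 15))))
    (fun c => s.arr 1 (i * (n + 1) + c) * s.arr 2 c % 2) hp.v7 hp.v0 (by norm_num) (by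
      intro c hc s'' hv' hw' hA' _
      simp [mod2, entry, Expr.eval, Op.eval, hv', hA' 1, hA' 2, hA1, hA2, hw' 18, hv, hw' 7, hp.v7])
  have hwf : (forb 15 0 (.store 4 (entry 18 15)
      (mod2 (.op .mul (.cell 1 (entry 18 15)) (.cell 2 (.var 15)))))).wf 9 = true := by decide
  simp only [den_seq, den_store, Config.setVar_arr, Config.setCell_arr, true_and]
  rw [hv] at hL1 hL2
  have hp' := hp.den ω hwf
  have e18 : (Expr.var 18).eval ((forb 15 0 (.store 4 (entry 18 15)
      (mod2 (.op .mul (.cell 1 (entry 18 15)) (.cell 2 (.var 15)))))).den ω s') = i := by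
    rw [Expr.eval, den_var ω _ (by decide), hv]
  rw [lastEntry_eval hp', e18]
  intro r hr
  rcases Nat.lt_succ_iff_lt_or_eq.mp hr with hr' | rfl
  · have hne : ∀ c ≤ n, ∀ c' ≤ n, r * (n + 1) + c ≠ i * (n + 1) + c' := fun c hc c' hc' he => by
      have := (entry_inj hc hc' he).1; omega
    refine ⟨fun c hc => ?_, ?_⟩
    · rw [if_neg (hne c hc.le n le_rfl), hL2 _ fun c' hc' => hne c hc.le c' hc'.le]
      exact (hI r hr').1 c hc
    · rw [if_neg (hne n le_rfl n le_rfl), hL2 _ fun c' hc' => hne n le_rfl c' hc'.le]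
      exact (hI r hr').2
  · refine ⟨fun c hc => ?_, ?_⟩
    · rw [if_neg (by omega), hL1 c hc]
    · rw [if_pos rfl]
      simp only [mod2_eval, Expr.eval, Op.eval, lastEntry_eval hp']
      rw [den_var ω _ (by decide), hv, den_arr ω _ (by decide), den_arr ω _ (by decide), hA1, hA3]

theorem readExamples_spec {n : ℕ} {s : Config} (ω : ℕ → Example n) (h : Params n k q B m s) :
    (∀ r < m, (∀ c : Fin n, (readExamples.den ω s).arr 1 (r * (n + 1) + c)
        = ((ω (s.drawn + r)).1 c).toNat) ∧
      (readExamples.den ω s).arr 1 (r * (n + 1) + n) = (ω (s.drawn + r)).2.toNat) ∧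
    (readExamples.den ω s).drawn = s.drawn + m := by
  refine den_forb_frame ω (fun i s' => (∀ r < i, (∀ c : Fin n, s'.arr 1 (r * (n + 1) + c)
        = ((ω (s.drawn + r)).1 c).toNat) ∧
      s'.arr 1 (r * (n + 1) + n) = (ω (s.drawn + r)).2.toNat) ∧
    s'.drawn = s.drawn + i) h.v4 (by simp [Config.setVar_drawn]) ?_
  rintro i hi s' ⟨hI, hd⟩ hv hw hA
  have hp : Params n k q B m s' := h.congr fun w hw' =>
    hw w (notMem_writes_of_wf (r := 9) (by decide) (by omega))
  have hp' : Params n k q B m (s'.load 7 (ω s'.drawn)) := hp.congr fun w _ => rfl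
  have hv' : (s'.load 7 (ω s'.drawn)).var 18 = i := hv
  obtain ⟨hL1, hL2⟩ := den_rowLoop ω (r := 18) (u := 7) (cnt := n + 1) (A := 1)
    (s := s'.load 7 (ω s'.drawn)) (e := .cell 7 (.var 15))
    (fun c => (s'.load 7 (ω s'.drawn)).arr 7 c) hp'.v7 hp'.v7 (by norm_num) (by
      intro c hc s'' hv' hw' hA' _
      simp [Expr.eval, hv', hA' 7])
  rw [hv'] at hL1 hL2
  simp only [den_seq, den_draw, Config.setVar_arr, Config.setVar_drawn]
  rw [den_drawn ω _ (by decide)]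
  refine ⟨fun r hr => ?_, by simp only [Config.load]; omega⟩
  rcases Nat.lt_succ_iff_lt_or_eq.mp hr with hr' | rfl
  · have hne : ∀ c ≤ n, ∀ c' < n + 1, r * (n + 1) + c ≠ i * (n + 1) + c' := fun c hc c' hc' he => by
      have := (entry_inj hc (by omega) he).1; omega
    have hl : (s'.load 7 (ω s'.drawn)).arr 1 = s'.arr 1 := by simp [Config.load]
    refine ⟨fun c => ?_, ?_⟩
    · rw [hL2 _ (hne c c.2.le), hl]
      exact (hI r hr').1 c
    · rw [hL2 _ (hne n le_rfl), hl]
      exact (hI r hr').2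
  · refine ⟨fun c => ?_, ?_⟩
    · rw [hL1 c (by omega)]
      simp [Config.load, hd]
    · rw [hL1 n (by omega)]
      simp [Config.load, hd]

end FProg

/-! ### Correctness of the elimination, of the test of candidates and of the search. -/

namespace FProg

variable {n' : ℕ} (ω : ℕ → Example n') {n k q B m : ℕ} {s : Config}

/-- The matrix held by array `4`. -/
def mat (n : ℕ) (s : Config) (r c : ℕ) : ZMod 2 := (s.arr 4 (r * (n + 1) + c) : ℕ)

theorem natCast_mod_two (a : ℕ) : ((a % 2 : ℕ) : ZMod 2) = a := ZMod.natCast_mod a 2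

theorem mod_two_eq_zero_iff (a : ℕ) : a % 2 = 0 ↔ (a : ZMod 2) = 0 := by
  rw [ZMod.natCast_eq_zero_iff]; omega

theorem findPivot_spec (h : Params n k q B m s) :
    ((findPivot.den ω s).var 19 = n ∧ ∀ c < n, mat n s (s.var 18) c = 0) ∨
    ((findPivot.den ω s).var 19 < n ∧
      mat n s (s.var 18) ((findPivot.den ω s).var 19) ≠ 0) := by
  rw [findPivot, den_seq]
  refine den_forb_frame ω (fun i s' =>
    (s'.var 19 = n ∧ ∀ c < i, mat n s (s.var 18) c = 0) ∨
    (s'.var 19 < n ∧ mat n s (s.var 18) (s'.var 19) ≠ 0)) ?_ ?_ ?_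
  · simp [den_assign, Config.setVar_var, h.v0]
  · simp [den_assign, Config.setVar_var, h.v0, Expr.eval]
  · intro i hi s' hI hv hw hA
    have hp : Params n k q B m s' := (h.den ω (p := .assign 19 (.var 0)) (r := 9)
      (by decide)).congr fun w hw' => hw w (notMem_writes_of_wf (r := 9) (by decide) (by omega))
    have h18 : s'.var 18 = s.var 18 := by
      rw [hw 18 (by decide)]; simp [den_assign, Config.setVar_var]
    have h4 : s'.arr 4 = s.arr 4 := by rw [hA 4 (by decide)]; rfl
    have hev : (mod2 (.cell 4 (entry 18 15))).eval s' = 0 ↔ mat n s (s.var 18) i = 0 := by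
      rw [mod2_eval, Expr.eval, entry_eval hp, h18, hv, h4, mod_two_eq_zero_iff, mat]
    rw [den_cond]
    by_cases hz : mat n s (s.var 18) i = 0
    · rw [if_neg (by simpa using hev.mpr hz)]
      simp only [den_assign, Config.setVar_var, Expr.eval]
      norm_num
      refine hI.imp (fun h => ⟨h.1, fun c hc => ?_⟩) id
      rcases (show c < i ∨ c = i by omega) with hc' | rfl
      exacts [h.2 c hc', hz]
    · rw [if_pos (fun h => hz (hev.mp h))]
      right
      simp [den_assign, Config.setVar_var, Expr.eval, hv, hi, hz]

theorem clearColumn_spec (h : Params n k q B m s) (hi : s.var 18 < m)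
    (hp : s.var 19 < n) :
    ∀ r < m, ∀ c ≤ n, mat n (clearColumn.den ω s) r c = mat n s r c +
      if r = s.var 18 then 0 else mat n s r (s.var 19) * mat n s (s.var 18) c := by
  -- The condition `r < m` becomes `r < j` in the loop invariant: only the rows below the counter
  -- have been cleared.
  suffices H : ∀ r < m, ∀ c ≤ n, mat n (clearColumn.den ω s) r c = mat n s r c +
      if r = s.var 18 then 0 else
        if r < m then mat n s r (s.var 19) * mat n s (s.var 18) c else 0 by
    intro r hr c hc
    rw [H r hr c hc, if_pos hr]
  refine den_forb_frame ω (fun j s' => ∀ r < m, ∀ c ≤ n, mat n s' r c = mat n s r c +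
      if r = s.var 18 then 0 else
        if r < j then mat n s r (s.var 19) * mat n s (s.var 18) c else 0) h.v4
    (by simp [mat, Config.setVar_arr]) ?_
  intro j hj s' hI hv hw hA
  have hp0 : Params n k q B m s' := h.congr fun w hw' =>
    hw w (notMem_writes_of_wf (r := 9) (by decide) (by omega))
  have h18 : s'.var 18 = s.var 18 := hw 18 (by decide)
  have h19 : s'.var 19 = s.var 19 := hw 19 (by decide)
  set i := s.var 18
  set p := s.var 19
  set E : Expr := mod2 (.op .mul (.cell 4 (entry 20 19))
      (.op .sub (.lit 1) (.op .eq (.var 20) (.var 18)))) with hE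
  have hx : ((E.eval s' : ℕ) : ZMod 2) = if j = i then 0 else mat n s j p := by
    have h1 : E.eval s' = (s'.arr 4 (j * (n + 1) + p) * (1 - if j = i then 1 else 0)) % 2 := by
      rw [hE, mod2_eval]
      simp only [Expr.eval, Op.eval, entry_eval hp0, hv, h18, h19]
    rw [h1, natCast_mod_two]
    have h2 := hI j hj p hp.le
    rw [mat] at h2
    split_ifs with hji
    · simp
    · simp only [hji, if_false, lt_irrefl, add_zero] at h2
      simp [h2]
  set s₁ := s'.setVar 21 (E.eval s') with hs₁
  have hp1 : Params n k q B m s₁ := hp0.congr fun w hw' => by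
    rw [hs₁, Config.setVar_var, if_neg (by omega)]
  have h1v : s₁.var 20 = j := by simp [hs₁, Config.setVar_var, hv]
  have h1i : s₁.var 18 = i := by simp [hs₁, Config.setVar_var, h18]
  have h1x : s₁.var 21 = E.eval s' := by simp [hs₁, Config.setVar_var]
  obtain ⟨hL1, hL2⟩ := den_rowLoop ω (r := 20) (u := 7) (cnt := n + 1) (A := 4) (s := s₁)
    (e := mod2 (.op .add (.cell 4 (entry 20 15)) (.op .mul (.var 21) (.cell 4 (entry 18 15)))))
    -- The multiplier was saved before its own cell is overwritten. For `j = i` the row being read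
    -- is also the row being written, which does no harm as the multiplier is then `0`.
    (fun c => if j = i then (s'.arr 4 (j * (n + 1) + c)) % 2 else
      (s'.arr 4 (j * (n + 1) + c) + E.eval s' * s'.arr 4 (i * (n + 1) + c)) % 2)
    hp1.v7 hp1.v7 (by norm_num) (by
      intro c hc s'' hv' hw' hA' hj'
      have hp2 : Params n k q B m s'' := hp1.congr fun w hw'' => hw' w (by omega)
      rw [h1v] at hj'
      have e1 : s''.arr 4 (j * (n + 1) + c) = s'.arr 4 (j * (n + 1) + c) :=
        hj' _ fun c' hc' => by omega
      rw [mod2_eval]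
      simp only [Expr.eval, Op.eval, entry_eval hp2, hw' 20 (by norm_num), hw' 18 (by norm_num),
        hw' 21 (by norm_num), h1v, h1i, h1x, hv', e1]
      split_ifs with hji
      · have hx0 : E.eval s' = 0 := by
          rw [hE, mod2_eval]
          simp [Expr.eval, Op.eval, hv, h18, hji]
        simp [hx0]
      · have e2 : s''.arr 4 (i * (n + 1) + c) = s'.arr 4 (i * (n + 1) + c) :=
          hj' _ fun c' hc' he => hji (entry_inj (n := n) (by omega) (by omega) he).1.symm
        rw [e2])
  rw [h1v] at hL1 hL2
  simp only [den_seq, den_assign]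
  rw [← hs₁]
  intro r hr c hc
  simp only [mat, Config.setVar_arr]
  by_cases hrj : r = j
  · subst hrj
    rw [hL1 c (by omega)]
    have e1 := hI r hr c hc
    simp only [lt_irrefl, if_false, ite_self, add_zero] at e1
    split_ifs with hri h'
    · rw [natCast_mod_two]
      exact e1.trans (by simp [mat])
    · rw [natCast_mod_two]
      push_cast
      rw [hx, if_neg hri]
      have e2 : mat n s' i c = mat n s i c := by simpa using hI i hi c hc
      change mat n s' r c + mat n s r p * mat n s' i c = _
      rw [e1, e2]; rfl
    · omega
  · rw [hL2 _ fun c' hc' he => hrj (entry_inj (n := n) hc (by omega) he).1]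
    refine (hI r hr c hc).trans ?_
    have : r < j + 1 ↔ r < j := by omega
    simp [this, mat]

theorem eliminate_spec (h : Params n k q B m s) {col : ℕ → Prop} {x : ℕ → ZMod 2}
    (h0 : Eliminated m n col x 0 (mat n s) (s.arr 5)) :
    Eliminated m n col x m (mat n (eliminate.den ω s)) ((eliminate.den ω s).arr 5) := by
  refine den_forb_frame ω (fun i s' => Eliminated m n col x i (mat n s') (s'.arr 5)) h.v4 h0 ?_
  intro i hi s' hI hv hw hA
  have hp : Params n k q B m s' := h.congr fun w hw' =>
    hw w (notMem_writes_of_wf (r := 9) (by decide) (by omega))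
  have hf := findPivot_spec ω hp
  set s₁ := findPivot.den ω s' with hs₁
  have hp1 : Params n k q B m s₁ := hp.den ω (r := 9) (by decide)
  have e4 : s₁.arr 4 = s'.arr 4 := den_arr ω _ (by decide) _
  have e5 : s₁.arr 5 = s'.arr 5 := den_arr ω _ (by decide) _
  have e18 : s₁.var 18 = i := (den_var ω _ (by decide) _).trans hv
  have em : mat n s₁ = mat n s' := by ext r c; simp [mat, e4]
  rw [hv] at hf
  simp only [den_seq, Config.setVar_arr]
  rw [← hs₁, den_cond]
  rcases hf with ⟨h1, h2⟩ | ⟨h1, h2⟩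
  · rw [if_neg (by simp [Expr.eval, Op.eval, h1, hp1.v0])]
    have := hI.skip h2
    have e : ∀ w x, mat n ((s₁.setVar 19 w).setVar 18 x) = mat n s' := by
      intro w x; ext r c; simp [mat, Config.setVar_arr, e4]
    rw [den_assign, e, Config.setVar_arr, e5]
    exact this
  · rw [if_pos (by simp [Expr.eval, Op.eval, h1, hp1.v0]), den_seq, den_store]
    simp only [Expr.eval, e18]
    set p := s₁.var 19 with hpv
    set s₂ := s₁.setCell 5 p i with hs₂
    have hp2 : Params n k q B m s₂ := hp1.congr fun w _ => rfl
    have em2 : mat n s₂ = mat n s' := by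
      ext r c; simp [mat, hs₂, Config.setCell_arr, e4]
    have hc := clearColumn_spec ω hp2 (by rw [hs₂, Config.setCell_var, e18]; exact hi)
      (by rw [hs₂, Config.setCell_var]; exact h1)
    have e5' : (clearColumn.den ω s₂).arr 5 = Function.update (s'.arr 5) p i := by
      rw [den_arr ω _ (by decide), hs₂]
      ext j
      simp [Config.setCell_arr, Function.update_apply, e5]
    rw [e5']
    refine hI.step hi h1 h2 fun r hr c hc' => ?_
    have := hc r hr c hc'
    rw [em2, hs₂, Config.setCell_var, e18, ← hpv, ← hs₂] at this
    exact this

theorem readSolution_spec (h : Params n k q B m s) :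
    ∀ c < n, (readSolution.den ω s).arr 6 c
      = s.arr 4 (s.arr 5 c * (n + 1) + n) * s.arr 2 c % 2 := by
  refine den_forb_frame ω (fun i s' => ∀ c < i, s'.arr 6 c
      = s.arr 4 (s.arr 5 c * (n + 1) + n) * s.arr 2 c % 2) h.v0 (by simp) ?_
  intro i hi s' hI hv hw hA c hc
  have hp : Params n k q B m s' := h.congr fun w hw' =>
    hw w (notMem_writes_of_wf (r := 9) (by decide) (by omega))
  simp only [den_store, Config.setVar_arr, Config.setCell_arr, true_and, mod2_eval, Expr.eval,
    Op.eval, lastEntry_eval hp, hv]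
  split_ifs with hci
  · subst hci
    rw [hA 4 (by decide), hA 5 (by decide), hA 2 (by decide)]
  · exact hI c (by omega)

theorem checkWeight_spec (h : Params n k q B m s) :
    (checkWeight.den ω s).var 23 = n - ∑ c ∈ Finset.range n, s.arr 6 c := by
  rw [checkWeight, den_seq]
  refine den_forb_frame ω (fun i s' => s'.var 23 = n - ∑ c ∈ Finset.range i, s.arr 6 c) ?_ ?_ ?_
  · simp [den_assign, Config.setVar_var, h.v0]
  · simp [den_assign, Config.setVar_var, h.v0, Expr.eval]
  · intro i hi s' hI hv hw hA
    rw [Finset.sum_range_succ, ← Nat.sub_sub, ← hI]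
    simp [den_assign, Config.setVar_var, Expr.eval, Op.eval, hv, show s'.arr 6 = s.arr 6 from hA 6 (by decide)]

theorem checkExamples_spec (h : Params n k q B m s) :
    (checkExamples.den ω s).var 22 = 0 ↔ ∀ r < m,
      ((s.arr 1 (r * (n + 1) + n) : ℕ) + (s.arr 3 r : ℕ) +
        ∑ c ∈ Finset.range n, ((s.arr 1 (r * (n + 1) + c) : ℕ) : ZMod 2) * (s.arr 6 c : ℕ)) = 0 := by
  rw [checkExamples, den_seq]
  refine den_forb_frame ω (fun i s' => s'.var 22 = 0 ↔ ∀ r < i,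
      ((s.arr 1 (r * (n + 1) + n) : ℕ) + (s.arr 3 r : ℕ) +
        ∑ c ∈ Finset.range n, ((s.arr 1 (r * (n + 1) + c) : ℕ) : ZMod 2) * (s.arr 6 c : ℕ)) = 0)
    ?_ ?_ ?_
  · simp [den_assign, Config.setVar_var, h.v4]
  · simp [den_assign, Config.setVar_var, Expr.eval]
  · intro i hi s' hI hv hw hA
    have hp : Params n k q B m s' := (h.den ω (p := .assign 22 (.lit 0)) (r := 9)
      (by decide)).congr fun w hw' => hw w (notMem_writes_of_wf (r := 9) (by decide) (by omega))
    have hA' : ∀ A, s'.arr A = s.arr A := fun A => by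
      rw [hA A (by simp [stores])]; rfl
    simp only [den_seq, den_assign (v := 24), den_assign (v := 22), Config.setVar_var]
    norm_num
    set s₁ := s'.setVar 24 _ with hs₁
    have hp1 : Params n k q B m s₁ := hp.congr fun w hw' => by
      rw [hs₁, Config.setVar_var, if_neg (by omega)]
    have e24 : s₁.var 24 = (s.arr 1 (i * (n + 1) + n) + s.arr 3 i) % 2 := by
      simp [hs₁, Config.setVar_var, mod2_eval, Expr.eval, Op.eval, lastEntry_eval hp, hv, hA']
    have key := den_forb_frame ω (v := 15) (u := 0) (s := s₁)
      (p := .assign 24 (mod2 (.op .add (.var 24)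
        (.op .mul (.cell 1 (entry 18 15)) (.cell 6 (.var 15))))))
      (fun t s'' => s''.var 24 < 2 ∧ ((s''.var 24 : ℕ) : ZMod 2) =
        ((s.arr 1 (i * (n + 1) + n) : ℕ) + (s.arr 3 i : ℕ) +
        ∑ c ∈ Finset.range t, ((s.arr 1 (i * (n + 1) + c) : ℕ) : ZMod 2) * (s.arr 6 c : ℕ)))
      hp1.v0 (by
        simp only [Config.setVar_var]
        norm_num
        rw [e24, natCast_mod_two]
        exact ⟨Nat.le_of_lt_succ (Nat.mod_lt _ Nat.two_pos), by push_cast; rfl⟩) (by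
        rintro t ht s'' ⟨h1, h2⟩ hv' hw' hA''
        have hp2 : Params n k q B m s'' := hp1.congr fun w hw'' =>
          hw' w (notMem_writes_of_wf (r := 9) (by decide) (by omega))
        have h18 : s''.var 18 = i := by
          rw [hw' 18 (by decide), hs₁]; simp [Config.setVar_var, hv]
        have hA3 : ∀ A, s''.arr A = s.arr A := fun A => by
          rw [hA'' A (by simp [stores]), hs₁, Config.setVar_arr, hA']
        simp only [den_assign, Config.setVar_var, mod2_eval, Expr.eval, Op.eval, entry_eval hp2,
          h18, hv', hA3]
        norm_num
        refine ⟨Nat.le_of_lt_succ (Nat.mod_lt _ Nat.two_pos), ?_⟩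
        rw [Finset.sum_range_succ, ← add_assoc, ← h2])
    set s₂ := (forb 15 0 _).den ω s₁ with hs₂
    obtain ⟨k1, k2⟩ := key
    have e22 : s₂.var 22 = s'.var 22 := by
      rw [hs₂, den_var ω _ (by decide), hs₁]; simp [Config.setVar_var]
    simp only [Expr.eval, Op.eval, e22]
    have : ((if 0 < s'.var 22 + s₂.var 24 then (1 : ℕ) else 0) = 0) ↔
        (s'.var 22 = 0 ∧ s₂.var 24 = 0) := by
      split_ifs with h0
      · simp only [false_iff]; omega
      · simp only [true_iff]; omega
    rw [this, hI]
    have h3 : s₂.var 24 = 0 ↔ ((s₂.var 24 : ℕ) : ZMod 2) = 0 := by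
      rw [← mod_two_eq_zero_iff]; omega
    rw [h3, k2]
    constructor
    · rintro ⟨h1, h2⟩ r hr
      rcases (show r < i ∨ r = i by omega) with hr' | rfl
      exacts [h1 r hr', h2]
    · exact fun h => ⟨fun r hr => h r (by omega), h i (by omega)⟩

theorem writeOutput_spec (h : Params n k q B m s) :
    (s.var 23 + k = n ∧ s.var 22 = 0 → ∀ c < n, (writeOutput.den ω s).arr 0 c = s.arr 6 c) ∧
    (¬ (s.var 23 + k = n ∧ s.var 22 = 0) → (writeOutput.den ω s).arr 0 = s.arr 0) := by
  rw [writeOutput, den_cond]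
  have e : (Expr.op .mul (.op .eq (.op .add (.var 23) (.var 1)) (.var 0))
      (.op .eq (.var 22) (.lit 0))).eval s ≠ 0 ↔ (s.var 23 + k = n ∧ s.var 22 = 0) := by
    by_cases h2 : s.var 22 = 0 <;> simp [Expr.eval, Op.eval, h.v0, h.v1, h2]
  constructor
  · intro hc
    rw [if_pos (e.mpr hc)]
    refine den_forb_frame ω (fun i s' => ∀ c < i, s'.arr 0 c = s.arr 6 c) h.v0 (by simp) ?_
    intro i hi s' hI hv hw hA c hc
    simp only [den_store, Config.setVar_arr, Config.setCell_arr, true_and, Expr.eval, hv]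
    split_ifs with hci
    · rw [hA 6 (by decide), hci]
    · exact hI c (by omega)
  · intro hc
    rw [if_neg (fun h' => hc (e.mp h'))]
    rfl

theorem eq_of_natCast_eq {a b : ℕ} (ha : a < 2) (hb : b < 2) (h : (a : ZMod 2) = b) : a = b := by
  rw [ZMod.natCast_eq_natCast_iff'] at h
  omega

theorem ZMod.two_add_eq_zero_iff {a b : ZMod 2} : a + b = 0 ↔ b = a := by
  revert a b; decide

theorem solveSystem_lt_two (h : Params n k q B m s) :
    ∀ c < n, (solveSystem.den ω s).arr 6 c < 2 := by
  intro c hc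
  simp only [solveSystem, den_seq]
  rw [readSolution_spec ω ((((h.den ω (p := markColumns) (r := 9) (by decide)).den ω
    (p := markErrors) (r := 9) (by decide)).den ω (p := buildSystem) (r := 9) (by decide)).den ω
    (p := eliminate) (r := 9) (by decide)) c hc]
  exact Nat.mod_lt _ Nat.two_pos

theorem solveSystem_errors (h : Params n k q B m s) :
    ∀ r < m, (solveSystem.den ω s).arr 3 r = flipBit m k (blockTail q k (s.var 10)) r := by
  intro r hr
  simp only [solveSystem, den_seq]
  rw [den_arr ω _ (by decide), den_arr ω _ (by decide), den_arr ω _ (by decide),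
    markErrors_spec ω (h.den ω (p := markColumns) (r := 9) (by decide)) r hr,
    (markColumns_spec ω h).2]

/-- Since `x` vanishes outside the selected positions, masking the columns does not affect its
equations. Thus `x` solves the system, and uniqueness among vectors supported there is all that
elimination requires. -/
theorem solveSystem_complete (h : Params n k q B m s) (x : ℕ → ℕ) (hx : ∀ c < n, x c < 2)
    (hhit : ∀ c < n, blockHit q k (s.var 10) (c / B) ≤ 1)
    (hsupp : ∀ c < n, blockHit q k (s.var 10) (c / B) = 0 → x c = 0)
    (hsol : ∀ r < m, ((s.arr 1 (r * (n + 1) + n) : ℕ) +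
      (flipBit m k (blockTail q k (s.var 10)) r : ℕ) +
      ∑ c ∈ Finset.range n, ((s.arr 1 (r * (n + 1) + c) : ℕ) : ZMod 2) * (x c : ℕ)) = 0)
    (huniq : ∀ y : ℕ → ZMod 2, (∀ c < n, blockHit q k (s.var 10) (c / B) = 0 → y c = 0) →
      (∀ r < m, ∑ c ∈ Finset.range n, ((s.arr 1 (r * (n + 1) + c) : ℕ) : ZMod 2) * y c =
        ∑ c ∈ Finset.range n, ((s.arr 1 (r * (n + 1) + c) : ℕ) : ZMod 2) * (x c : ℕ)) →
      ∀ c < n, y c = (x c : ℕ)) :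
    ∀ c < n, (solveSystem.den ω s).arr 6 c = x c := by
  set hit : ℕ → ℕ := fun c => blockHit q k (s.var 10) (c / B) with hhitdef
  have hp1 := h.den ω (p := markColumns) (r := 9) (by decide)
  obtain ⟨c1, -⟩ := markColumns_spec ω h
  have d1 : (markColumns.den ω s).arr 1 = s.arr 1 := den_arr ω _ (by decide) _
  have c3 := solveSystem_errors ω h
  intro c hc
  simp only [solveSystem, den_seq] at c3 ⊢
  set s1 := markColumns.den ω s
  have hp2 := hp1.den ω (p := markErrors) (r := 9) (by decide)
  have d2 : (markErrors.den ω s1).arr 1 = s1.arr 1 := den_arr ω _ (by decide) _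
  have d2' : (markErrors.den ω s1).arr 2 = s1.arr 2 := den_arr ω _ (by decide) _
  rw [den_arr ω readSolution (by decide), den_arr ω eliminate (by decide),
    den_arr ω buildSystem (by decide)] at c3
  set s2 := markErrors.den ω s1
  have hp3 := hp2.den ω (p := buildSystem) (r := 9) (by decide)
  have c4 := buildSystem_spec ω hp2
  have d3 : (buildSystem.den ω s2).arr 2 = s2.arr 2 := den_arr ω _ (by decide) _
  set s3 := buildSystem.den ω s2
  have hp4 := hp3.den ω (p := eliminate) (r := 9) (by decide)
  have d4 : (eliminate.den ω s3).arr 2 = s3.arr 2 := den_arr ω _ (by decide) _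
  have hm1 : ∀ r < m, ∀ c < n,
      mat n s3 r c = ((s.arr 1 (r * (n + 1) + c) : ℕ) : ZMod 2) * (hit c : ℕ) := by
    intro r hr c hc
    rw [mat, (c4 r hr).1 c hc, natCast_mod_two, d2, d1, d2', c1 c hc]
    push_cast; rfl
  have hm2 : ∀ r < m, mat n s3 r n = ((s.arr 1 (r * (n + 1) + n) : ℕ) : ZMod 2) +
      (flipBit m k (blockTail q k (s.var 10)) r : ℕ) := by
    intro r hr
    rw [mat, (c4 r hr).2, natCast_mod_two, d2, d1, c3 r hr]
    push_cast; rfl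
  have hhit' : ∀ c < n, hit c = 0 ∨ hit c = 1 := fun c hc => by
    have : hit c ≤ 1 := hhit c hc
    omega
  have hE : Eliminated m n (fun c => hit c ≠ 0) (fun c => ((x c : ℕ) : ZMod 2)) 0 (mat n s3)
      (s3.arr 5) := by
    refine ⟨fun r hr => ?_, fun y hy c hc hcol => ?_, fun r hr c hc hcol => ?_, by simp⟩
    · rw [hm2 r hr, ← ZMod.two_add_eq_zero_iff, ← hsol r hr]
      congr 1
      refine Finset.sum_congr rfl fun c hc => ?_
      have hc' := Finset.mem_range.mp hc
      rw [hm1 r hr c hc']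
      rcases hhit' c hc' with h0 | h0
      · rw [hsupp c hc' h0]; simp
      · rw [h0]; simp
    -- A solution of the masked system is arbitrary at unselected positions, so it is masked before
    -- uniqueness is applied.
    · have := huniq (fun c => (hit c : ZMod 2) * y c) (fun c hc h0 => by
        rw [show hit c = 0 from h0]; simp) (fun r hr => by
        have h1 := hy r hr
        rw [hm2 r hr, ← ZMod.two_add_eq_zero_iff.mp (hsol r hr)] at h1
        rw [← h1]
        refine Finset.sum_congr rfl fun c hc => ?_
        rw [hm1 r hr c (Finset.mem_range.mp hc), mul_assoc]) c hc
      rcases hhit' c hc with h0 | h0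
      · exact absurd h0 hcol
      · simpa [h0] using this
    · rw [hm1 r hr c hc, not_not.mp hcol]; simp
  have hE' := eliminate_spec ω hp3 hE
  rw [readSolution_spec ω hp4 c hc]
  refine eq_of_natCast_eq (Nat.mod_lt _ Nat.two_pos) (hx c hc) ?_
  rw [natCast_mod_two, d4, d3, d2', c1 c hc]
  rcases hhit' c hc with h0 | h0
  · rw [hsupp c hc h0]
    rw [show blockHit q k (s.var 10) (c / B) = 0 from h0]
    simp
  · rw [show blockHit q k (s.var 10) (c / B) = 1 from h0, mul_one]
    exact hE'.eq_solution hc (by rw [h0]; norm_num)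

/-- What is asked of a candidate `X` under the error pattern of the code `Z`. -/
def Explains (m n k q : ℕ) (A : ℕ → ℕ) (Z : ℕ) (X : ℕ → ℕ) : Prop :=
  ∑ c ∈ Finset.range n, X c = k ∧ ∀ r < m, ((A (r * (n + 1) + n) : ℕ) +
      (flipBit m k (blockTail q k Z) r : ℕ) +
      ∑ c ∈ Finset.range n, ((A (r * (n + 1) + c) : ℕ) : ZMod 2) * (X c : ℕ)) = 0

/-- Wrong codes may yield any bit vector as candidate; what matters is that the output array changes
only when the candidate passes the test. -/
theorem tryCode_spec (h : Params n k q B m s) (X : ℕ → ℕ)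
    (hX : ∀ c < n, X c = (solveSystem.den ω s).arr 6 c) :
    (Explains m n k q (s.arr 1) (s.var 10) X → ∀ c < n, (tryCode.den ω s).arr 0 c = X c) ∧
    (¬ Explains m n k q (s.arr 1) (s.var 10) X → (tryCode.den ω s).arr 0 = s.arr 0) := by
  have hX2 := solveSystem_lt_two ω h
  have c3 := solveSystem_errors ω h
  have e0 : (solveSystem.den ω s).arr 0 = s.arr 0 := den_arr ω _ (by decide) _
  have e1 : (solveSystem.den ω s).arr 1 = s.arr 1 := den_arr ω _ (by decide) _
  have hp1 := h.den ω (p := solveSystem) (r := 9) (by decide)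
  simp only [tryCode, testCandidate, den_seq]
  set s1 := solveSystem.den ω s
  have hp2 := hp1.den ω (p := checkWeight) (r := 9) (by decide)
  have d2 : ∀ A, (checkWeight.den ω s1).arr A = s1.arr A := fun A =>
    den_arr ω _ (by simp [checkWeight, stores]) _
  have w2 := checkWeight_spec ω hp1
  set s2 := checkWeight.den ω s1
  have hp3 := hp2.den ω (p := checkExamples) (r := 9) (by decide)
  have d3 : ∀ A, (checkExamples.den ω s2).arr A = s2.arr A := fun A =>
    den_arr ω _ (by simp [checkExamples, stores]) _
  have w3 := checkExamples_spec ω hp2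
  have w3' : (checkExamples.den ω s2).var 23 = s2.var 23 := den_var ω _ (by decide) _
  set s3 := checkExamples.den ω s2
  have hout := writeOutput_spec ω hp3
  have hcond : (s3.var 23 + k = n ∧ s3.var 22 = 0) ↔
      Explains m n k q (s.arr 1) (s.var 10) X := by
    rw [w3, w3', w2, Explains, d2, d2, d2, e1]
    have hs : ∑ c ∈ Finset.range n, s1.arr 6 c = ∑ c ∈ Finset.range n, X c :=
      Finset.sum_congr rfl fun c hc => (hX c (Finset.mem_range.mp hc)).symm
    have hle : ∑ c ∈ Finset.range n, X c ≤ n := by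
      calc _ ≤ ∑ c ∈ Finset.range n, 1 := Finset.sum_le_sum fun c hc => by
            have h1 := hX c (Finset.mem_range.mp hc)
            have h2 := hX2 c (Finset.mem_range.mp hc)
            omega
        _ = n := by simp
    rw [hs]
    refine and_congr (by omega) (forall₂_congr fun r hr => ?_)
    rw [c3 r hr, Finset.sum_congr rfl fun c hc => by rw [← hX c (Finset.mem_range.mp hc)]]
  rw [hcond] at hout
  refine ⟨fun hE c hc => ?_, fun hE => ?_⟩
  · rw [hout.1 hE c hc, d3, d2, hX c hc]
  · rw [hout.2 hE, d3, d2, e0]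

/-- Try all codes below the value of variable `9`. -/
def tryAllCodes : FProg := .forb 10 9 tryCode

theorem tryAllCodes_spec (h : Params n k q B m s) (x : ℕ → ℕ) (hx : ∀ c < n, x c < 2)
    (hsound : ∀ Z < s.var 9, ∀ X : ℕ → ℕ, (∀ c < n, X c < 2) →
      Explains m n k q (s.arr 1) Z X → ∀ c < n, X c = x c)
    {Z₀ : ℕ} (hZ : Z₀ < s.var 9) (hE : Explains m n k q (s.arr 1) Z₀ x)
    (hhit : ∀ c < n, blockHit q k Z₀ (c / B) ≤ 1)
    (hsupp : ∀ c < n, blockHit q k Z₀ (c / B) = 0 → x c = 0)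
    (huniq : ∀ y : ℕ → ZMod 2, (∀ c < n, blockHit q k Z₀ (c / B) = 0 → y c = 0) →
      (∀ r < m, ∑ c ∈ Finset.range n, ((s.arr 1 (r * (n + 1) + c) : ℕ) : ZMod 2) * y c =
        ∑ c ∈ Finset.range n, ((s.arr 1 (r * (n + 1) + c) : ℕ) : ZMod 2) * (x c : ℕ)) →
      ∀ c < n, y c = (x c : ℕ)) :
    ∀ c < n, (tryAllCodes.den ω s).arr 0 c = x c := by
  have H := den_forb_frame ω (v := 10) (u := 9) (p := tryCode) (s := s)
    -- The code `Z₀` writes `x`; later codes write nothing or, by `hsound`, write `x` again.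
    (fun i s' => Z₀ < i → ∀ c < n, s'.arr 0 c = x c) rfl (by simp) (by
    intro i hi s' hI hv hw hA hZi c hc
    have hp : Params n k q B m s' := h.congr fun w hw' =>
      hw w (notMem_writes_of_wf (r := 10) (by decide) (by omega))
    have h1 : s'.arr 1 = s.arr 1 := hA 1 (by decide)
    rw [Config.setVar_arr]
    by_cases hiZ : i = Z₀
    · subst hiZ
      have hX := solveSystem_complete ω hp x hx (by rwa [hv]) (by rwa [hv])
        (by rw [hv, h1]; exact hE.2) (by rwa [hv, h1])
      exact (tryCode_spec ω hp x fun c hc => (hX c hc).symm).1 (by rwa [h1, hv]) c hc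
    · have ht := tryCode_spec ω hp (fun c => (solveSystem.den ω s').arr 6 c) fun c _ => rfl
      rw [h1, hv] at ht
      by_cases hex : Explains m n k q (s.arr 1) i fun c => (solveSystem.den ω s').arr 6 c
      · rw [ht.1 hex c hc]
        exact hsound i hi _ (solveSystem_lt_two ω hp) hex c hc
      · rw [ht.2 hex]
        exact hI (by omega) c hc)
  exact H hZ

end FProg

/-! ### The probability of bad examples -/

theorem Bool.toNat_natCast_injective {a b : Bool} (h : (a.toNat : ZMod 2) = b.toNat) : a = b := by
  revert a b; decide

theorem Bool.toNat_xor_natCast (a b : Bool) :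
    ((xor a b).toNat : ZMod 2) = a.toNat + b.toNat := by
  revert a b; decide

theorem parity_natCast {n : ℕ} (x a : Fin n → Bool) :
    ((parity x a).toNat : ZMod 2) = ∑ i, ((a i).toNat : ZMod 2) * (x i).toNat := by
  have h : ∑ i, ((a i).toNat : ZMod 2) * (x i).toNat
      = ((Finset.univ.filter fun i => x i = true ∧ a i = true).card : ℕ) := by
    rw [Finset.card_filter, Nat.cast_sum]
    refine Finset.sum_congr rfl fun i _ => ?_
    cases x i <;> cases a i <;> simp
  rw [h, parity]
  generalize (Finset.univ.filter fun i => x i = true ∧ a i = true).card = c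
  rcases Nat.even_or_odd c with hc | hc
  · rw [decide_eq_false (by simpa using hc), ZMod.natCast_eq_zero_iff_even.mpr hc]; rfl
  · rw [decide_eq_true hc, ZMod.natCast_eq_one_iff_odd.mpr hc]; rfl

/-- Change the `j`-th bit. -/
def flipAt {n : ℕ} (j : Fin n) (a : Fin n → Bool) : Fin n → Bool := Function.update a j (!a j)

theorem flipAt_flipAt {n : ℕ} (j : Fin n) (a : Fin n → Bool) : flipAt j (flipAt j a) = a := by
  simp [flipAt]

theorem parity_flipAt {n : ℕ} (x a : Fin n → Bool) (j : Fin n) :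
    parity x (flipAt j a) = xor (parity x a) (x j) := by
  apply Bool.toNat_natCast_injective
  rw [Bool.toNat_xor_natCast, parity_natCast, parity_natCast,
    ← Finset.add_sum_erase _ _ (Finset.mem_univ j), ← Finset.add_sum_erase (a := j) _
      (fun i => ((a i).toNat : ZMod 2) * (x i).toNat) (Finset.mem_univ j)]
  have h : ∑ i ∈ Finset.univ.erase j, (((flipAt j a) i).toNat : ZMod 2) * (x i).toNat
      = ∑ i ∈ Finset.univ.erase j, ((a i).toNat : ZMod 2) * (x i).toNat :=
    Finset.sum_congr rfl fun i hi => by rw [flipAt, Function.update_of_ne (Finset.ne_of_mem_erase hi)]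
  rw [h]
  simp only [flipAt, Function.update_self]
  cases a j <;> cases x j <;> simp [add_comm]
  rw [← add_assoc, show (1 : ZMod 2) + 1 = 0 from by decide, zero_add]

theorem measurePreserving_flipAt {n : ℕ} (j : Fin n) :
    MeasurePreserving (flipAt j) (PMF.uniformOfFintype (Fin n → Bool)).toMeasure
      (PMF.uniformOfFintype (Fin n → Bool)).toMeasure := by
  classical
  refine ⟨Measurable.of_discrete, ?_⟩
  ext s hs
  rw [Measure.map_apply Measurable.of_discrete hs, PMF.toMeasure_uniformOfFintype_apply _ hs,
    PMF.toMeasure_uniformOfFintype_apply _ (MeasurableSet.of_discrete)]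
  congr 2
  exact Fintype.card_congr
    { toFun := fun a => ⟨flipAt j a.1, a.2⟩
      invFun := fun a => ⟨flipAt j a.1, by simp [flipAt_flipAt, a.2]⟩
      left_inv := fun a => by simp [flipAt_flipAt]
      right_inv := fun a => by simp [flipAt_flipAt] }

theorem measureReal_eq_half {Ω : Type*} [MeasurableSpace Ω] {μ : Measure Ω} [IsProbabilityMeasure μ]
    {φ : Ω → Ω} (hφ : MeasurePreserving φ μ μ) {E : Set Ω} (hE : MeasurableSet E)
    (h : φ ⁻¹' E = Eᶜ) : μ.real E = 1 / 2 := by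
  have h1 : μ.real Eᶜ = μ.real E := by
    rw [← h, measureReal_def, hφ.measure_preimage hE.nullMeasurableSet, measureReal_def]
  rw [probReal_compl_eq_one_sub hE] at h1
  linarith

instance {n : ℕ} (x : Fin n → Bool) (η : unitInterval) : IsProbabilityMeasure (exampleLaw x η) :=
  Measure.isProbabilityMeasure_map (Measurable.of_discrete).aemeasurable

instance {n : ℕ} (x : Fin n → Bool) (η : unitInterval) : IsProbabilityMeasure (sourceLaw x η) := by
  unfold sourceLaw; infer_instance

theorem exampleLaw_real_apply {n : ℕ} (x : Fin n → Bool) (η : unitInterval)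
    (E : Set (Example n)) : (exampleLaw x η).real E =
      ((PMF.uniformOfFintype (Fin n → Bool)).toMeasure.prod (bernoulliMeasure true false η)).real
        ((fun z : (Fin n → Bool) × Bool => (z.1, xor (parity x z.1) z.2)) ⁻¹' E) := by
  rw [exampleLaw, measureReal_def, Measure.map_apply Measurable.of_discrete MeasurableSet.of_discrete,
    measureReal_def]

/-- Flipping a bit of `a` at a place where `x` and `y` differ preserves the law and changes `parity
x a + parity y a`. It therefore exchanges the event with its complement, whatever the noise is. -/
theorem exampleLaw_label {n : ℕ} {x y : Fin n → Bool} (hy : y ≠ x) (η : unitInterval) (b : Bool) :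
    (exampleLaw x η).real {e | xor (parity y e.1) e.2 = b} = 1 / 2 := by
  obtain ⟨j, hj⟩ := Function.ne_iff.mp hy
  rw [exampleLaw_real_apply]
  refine measureReal_eq_half ((measurePreserving_flipAt j).prod (.id _)) .of_discrete ?_
  ext ⟨a, z⟩
  simp only [Set.mem_preimage, Set.mem_ofPred_eq, Prod.map, id, parity_flipAt, Set.mem_compl_iff]
  revert hj
  cases parity y a <;> cases parity x a <;> cases y j <;> cases x j <;> cases z <;> cases b <;> simp

theorem exampleLaw_parity {n : ℕ} {x y : Fin n → Bool} (hy : y ≠ x) (η : unitInterval) :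
    (exampleLaw x η).real {e | parity y e.1 = parity x e.1} = 1 / 2 := by
  obtain ⟨j, hj⟩ := Function.ne_iff.mp hy
  rw [exampleLaw_real_apply]
  refine measureReal_eq_half ((measurePreserving_flipAt j).prod (.id _)) .of_discrete ?_
  ext ⟨a, z⟩
  simp only [Set.mem_preimage, Set.mem_ofPred_eq, Prod.map, id, parity_flipAt, Set.mem_compl_iff]
  revert hj
  cases parity y a <;> cases parity x a <;> cases y j <;> cases x j <;> simp

theorem exampleLaw_error {n : ℕ} (x : Fin n → Bool) (η : unitInterval) :
    (exampleLaw x η).real {e | e.2 ≠ parity x e.1} = η := by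
  rw [exampleLaw_real_apply]
  have : (fun z : (Fin n → Bool) × Bool => (z.1, xor (parity x z.1) z.2)) ⁻¹'
      {e | e.2 ≠ parity x e.1} = Set.univ ×ˢ {true} := by
    ext ⟨a, z⟩
    cases h : parity x a <;> cases z <;> simp [h]
  rw [this, measureReal_prod_prod]
  simp

theorem sourceLaw_forall {n : ℕ} (x : Fin n → Bool) (η : unitInterval) (m : ℕ)
    (E : ℕ → Set (Example n)) (hE : ∀ r, (exampleLaw x η).real (E r) = 1 / 2) :
    (sourceLaw x η).real {ω | ∀ r < m, ω r ∈ E r} = (1 / 2) ^ m := by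
  have h : {ω : ℕ → Example n | ∀ r < m, ω r ∈ E r} = Set.pi (Finset.range m) E := by
    ext ω; simp [Set.mem_pi]
  rw [h, sourceLaw, measureReal_def, Measure.infinitePi_pi _ fun _ _ => .of_discrete,
    ENNReal.toReal_prod]
  simp only [← measureReal_def, hE, Finset.prod_const, Finset.card_range]

theorem sourceLaw_exists_le {n : ℕ} {ι : Type*} (x : Fin n → Bool) (η : unitInterval) (m : ℕ)
    (s : Finset ι) (E : ι → ℕ → Set (Example n))
    (hE : ∀ i ∈ s, ∀ r, (exampleLaw x η).real (E i r) = 1 / 2) :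
    (sourceLaw x η).real {ω | ∃ i ∈ s, ∀ r < m, ω r ∈ E i r} ≤ s.card * (1 / 2) ^ m := by
  have h : {ω : ℕ → Example n | ∃ i ∈ s, ∀ r < m, ω r ∈ E i r}
      = ⋃ i ∈ s, {ω | ∀ r < m, ω r ∈ E i r} := by ext ω; simp
  rw [h]
  refine (measureReal_biUnion_finset_le _ _).trans ?_
  rw [Finset.sum_congr rfl fun i hi => sourceLaw_forall x η m (E i) (hE i hi)]
  simp

/-- Another vector than `x`, supported in `S`, agrees with `x` on `m` examples. -/
theorem sourceLaw_ambiguous_le {n : ℕ} (x : Fin n → Bool) (η : unitInterval) (m : ℕ)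
    (S : Finset (Fin n)) :
    (sourceLaw x η).real {ω | ∃ y : Fin n → Bool, y ≠ x ∧ (∀ i, i ∉ S → y i = false) ∧
      ∀ r < m, parity y (ω r).1 = parity x (ω r).1} ≤ 2 ^ S.card * (1 / 2) ^ m := by
  classical
  set s := Finset.univ.filter fun y : Fin n → Bool => y ≠ x ∧ ∀ i, i ∉ S → y i = false
  have hs : s.card ≤ 2 ^ S.card := by
    rw [← Finset.card_powerset]
    refine Finset.card_le_card_of_injOn (fun y => Finset.univ.filter fun i => y i = true)
      (fun y hy => ?_) (fun y _ y' _ h => ?_)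
    · simp only [s, Finset.coe_filter, Finset.mem_univ, true_and, Set.mem_ofPred_eq] at hy
      simp only [Finset.coe_powerset, Set.mem_preimage, Set.mem_powerset_iff]
      intro i hi
      by_contra hiS
      have := hy.2 i hiS
      simp [this] at hi
    · funext i
      have := Finset.ext_iff.mp h i
      simp only [Finset.mem_filter, Finset.mem_univ, true_and] at this
      exact Bool.eq_iff_iff.mpr this
  have h := sourceLaw_exists_le x η m s (fun y _ => {e | parity y e.1 = parity x e.1})
    (fun y hy _ => exampleLaw_parity (Finset.mem_filter.mp hy).2.1 η)
  refine le_trans (measureReal_mono fun ω hω => ?_) (h.trans ?_)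
  · obtain ⟨y, h1, h2, h3⟩ := hω
    exact ⟨y, by simp only [s, Finset.mem_filter, Finset.mem_univ, true_and]; exact ⟨h1, h2⟩, h3⟩
  · gcongr
    exact_mod_cast hs

/-- Another vector than `x`, of weight `k`, explains `m` examples up to one of the error patterns
`G 0, …, G (N - 1)`. -/
theorem sourceLaw_confused_le {n : ℕ} (x : Fin n → Bool) (η : unitInterval) (m k N : ℕ)
    (G : ℕ → ℕ → Bool) :
    (sourceLaw x η).real {ω | ∃ y : Fin n → Bool, y ≠ x ∧ weight y = k ∧ ∃ Z < N,
      ∀ r < m, xor (parity y (ω r).1) (ω r).2 = G Z r} ≤ n.choose k * N * (1 / 2) ^ m := by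
  classical
  set s := Finset.univ.filter fun y : Fin n → Bool => y ≠ x ∧ weight y = k
  have hs : s.card ≤ n.choose k := by
    rw [show n.choose k = (Finset.powersetCard k (Finset.univ : Finset (Fin n))).card by simp]
    refine Finset.card_le_card_of_injOn (fun y => Finset.univ.filter fun i => y i = true)
      (fun y hy => ?_) (fun y _ y' _ h => ?_)
    · simp only [s, Finset.coe_filter, Finset.mem_univ, true_and, Set.mem_ofPred_eq] at hy
      simp only [Finset.mem_coe, Finset.mem_powersetCard, Finset.subset_univ, true_and]
      exact hy.2
    · funext i
      have := Finset.ext_iff.mp h i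
      simp only [Finset.mem_filter, Finset.mem_univ, true_and] at this
      exact Bool.eq_iff_iff.mpr this
  have h := sourceLaw_exists_le x η m (s ×ˢ Finset.range N)
    (fun i r => {e | xor (parity i.1 e.1) e.2 = G i.2 r})
    (fun i hi _ => exampleLaw_label (Finset.mem_filter.mp (Finset.mem_product.mp hi).1).2.1 η _)
  refine le_trans (measureReal_mono fun ω hω => ?_) (h.trans ?_)
  · obtain ⟨y, h1, h2, Z, hZ, h3⟩ := hω
    refine ⟨(y, Z), ?_, h3⟩
    simp only [s, Finset.mem_product, Finset.mem_filter, Finset.mem_univ, true_and,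
      Finset.mem_range]
    exact ⟨⟨h1, h2⟩, hZ⟩
  · rw [Finset.card_product, Finset.card_range]
    push_cast
    gcongr

/-- The numbers of the wrong labels among the first `m` examples. -/
def errorSet {n : ℕ} (x : Fin n → Bool) (ω : ℕ → Example n) (m : ℕ) : Finset ℕ :=
  (Finset.range m).filter fun r => (ω r).2 ≠ parity x (ω r).1

theorem sourceLaw_errors_le {n : ℕ} (x : Fin n → Bool) (η : unitInterval) (m w : ℕ) :
    (sourceLaw x η).real {ω | w < (errorSet x ω m).card} ≤ m * η / (w + 1) := by
  set E : ℕ → Set (ℕ → Example n) := fun r => {ω | (ω r).2 ≠ parity x (ω r).1}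
  have hE : ∀ r, MeasurableSet (E r) := fun r =>
    measurableSet_preimage (t := {e : Example n | e.2 ≠ parity x e.1})
      (measurable_pi_apply (X := fun _ : ℕ => Example n) r) .of_discrete
  have hEr : ∀ r, (sourceLaw x η).real (E r) = η := fun r => by
    rw [← exampleLaw_error x η, measureReal_def, measureReal_def]
    congr 1
    exact (measurePreserving_eval_infinitePi (fun _ : ℕ => exampleLaw x η) r).measure_preimage
      (s := {e : Example n | e.2 ≠ parity x e.1}) MeasurableSet.of_discrete.nullMeasurableSet
  have hcard : ∀ ω : ℕ → Example n, ((errorSet x ω m).card : ℝ)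
      = ∑ r ∈ Finset.range m, (E r).indicator (fun _ => (1 : ℝ)) ω := fun ω => by
    rw [errorSet, Finset.card_filter]
    push_cast
    refine Finset.sum_congr rfl fun r _ => ?_
    simp [E, Set.indicator_apply]
  have hint : ∀ r ∈ Finset.range m,
      Integrable ((E r).indicator fun _ => (1 : ℝ)) (sourceLaw x η) := fun r _ =>
    (integrable_const _).indicator (hE r)
  -- Markov's inequality at level `w + 1`, as the number of errors is an integer above `w`.
  have h := mul_meas_ge_le_integral_of_nonneg (μ := sourceLaw x η)
    (f := fun ω => ∑ r ∈ Finset.range m, (E r).indicator (fun _ => (1 : ℝ)) ω)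
    (ae_of_all _ fun ω => Finset.sum_nonneg fun r _ => Set.indicator_nonneg (by simp) _)
    (integrable_finsetSum _ hint) (w + 1)
  rw [integral_finsetSum _ hint] at h
  have h2 : ∑ r ∈ Finset.range m, ∫ ω, (E r).indicator (fun _ => (1 : ℝ)) ω ∂(sourceLaw x η)
      = m * η := by
    rw [Finset.sum_congr rfl fun r _ => by
      rw [integral_indicator (hE r), setIntegral_const, hEr, smul_eq_mul, mul_one]]
    simp
  rw [h2] at h
  rw [le_div_iff₀ (by positivity), mul_comm]
  refine le_trans (mul_le_mul_of_nonneg_left (measureReal_mono fun ω hω => ?_) (by positivity)) h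
  simp only [Set.mem_ofPred_eq, ← hcard] at hω ⊢
  exact_mod_cast hω

/-! ### The program finds the hidden vector from good examples -/

open FProg in
/-- Draw all examples, then try all codes. -/
def FProg.search : FProg := .seq readExamples tryAllCodes

/-- The positions in the blocks of length `B` that `x` meets. -/
def blockSupport {n : ℕ} (x : Fin n → Bool) (B : ℕ) : Finset (Fin n) :=
  Finset.univ.filter fun i => ∃ j : Fin n, x j = true ∧ (j : ℕ) / B = i / B

theorem card_blockSupport_le {n : ℕ} (x : Fin n → Bool) {B : ℕ} (hB : 0 < B) :
    (blockSupport x B).card ≤ weight x * B := by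
  classical
  have h := Finset.card_le_mul_card_image (f := fun i : Fin n => (i : ℕ) / B) (blockSupport x B) B
    (fun b _ => by
      calc _ = (((blockSupport x B).filter fun i : Fin n => (i : ℕ) / B = b).image
            fun i : Fin n => (i : ℕ)).card :=
            (Finset.card_image_of_injective _ Fin.val_injective).symm
        _ ≤ (Finset.Ico (b * B) (b * B + B)).card := Finset.card_le_card fun j hj => by
            simp only [Finset.mem_image, Finset.mem_filter] at hj
            obtain ⟨i, ⟨-, hi⟩, rfl⟩ := hj
            rw [Finset.mem_Ico, ← hi]
            have h1 := Nat.div_add_mod (i : ℕ) B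
            have h2 := Nat.mod_lt (i : ℕ) hB
            rw [mul_comm] at h1
            omega
        _ = B := by simp)
  rw [mul_comm]
  refine h.trans (Nat.mul_le_mul_left _ ?_)
  refine (Finset.card_le_card (t := (Finset.univ.filter fun i => x i = true).image
    fun i : Fin n => (i : ℕ) / B) fun b hb => ?_).trans Finset.card_image_le
  simp only [blockSupport, Finset.mem_image, Finset.mem_filter, Finset.mem_univ, true_and] at hb ⊢
  obtain ⟨i, ⟨j, hj, hji⟩, rfl⟩ := hb
  exact ⟨j, hj, hji⟩

/-- The error bit of the `r`-th example in the error pattern of the code `Z`. -/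
def codeError (m k q Z r : ℕ) : Bool := decide (flipBit m k (blockTail q k Z) r = 1)

theorem codeError_toNat (m k q Z r : ℕ) :
    (codeError m k q Z r).toNat = flipBit m k (blockTail q k Z) r := by
  have := flipBit_lt_two m k (blockTail q k Z) r
  rw [codeError]
  by_cases h : flipBit m k (blockTail q k Z) r = 1
  · simp [h]
  · simp only [h, decide_false, Bool.toNat_false]; omega

theorem FProg.search_spec {n k q B m w : ℕ} {s : Config} (hs : Params n k q B m s)
    (hd : s.drawn = 0) (h9 : s.var 9 = (8 * q) ^ k) (hq : 1 ≤ q) (hB : n < k * q * B)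
    (hw : (m + 1) ^ w ≤ 2 ^ k) (hwk : w ≤ k) {x : Fin n → Bool} (hx : weight x = k)
    {ω : ℕ → Example n} (herr : (errorSet x ω m).card ≤ w)
    (huniq : ∀ y : Fin n → Bool, (∀ i, i ∉ blockSupport x B → y i = false) →
      (∀ r < m, parity y (ω r).1 = parity x (ω r).1) → y = x)
    (hconf : ∀ y : Fin n → Bool, weight y = k → ∀ Z < (8 * q) ^ k,
      (∀ r < m, xor (parity y (ω r).1) (ω r).2 = codeError m k q Z r) → y = x) :
    (search.den ω s).Outputs x := by
  classical
  have hs1 := hs.den ω (p := readExamples) (r := 9) (by decide)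
  obtain ⟨hA, -⟩ := readExamples_spec ω hs
  have h91 : (readExamples.den ω s).var 9 = (8 * q) ^ k := (den_var ω _ (by decide) _).trans h9
  rw [search, den_seq]
  set s1 := readExamples.den ω s
  simp only [hd, zero_add] at hA
  have hsum : ∀ (X : ℕ → ℕ) (y : Fin n → Bool), (∀ i : Fin n, X i = (y i).toNat) →
      ∀ r < m, ∑ c ∈ Finset.range n, ((s1.arr 1 (r * (n + 1) + c) : ℕ) : ZMod 2) * (X c : ℕ)
        = ((parity y (ω r).1).toNat : ZMod 2) := by
    intro X y hy r hr
    rw [parity_natCast, Finset.sum_range]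
    exact Finset.sum_congr rfl fun i _ => by rw [(hA r hr).1 i, hy i]
  have hwt : ∀ (X : ℕ → ℕ) (y : Fin n → Bool), (∀ i : Fin n, X i = (y i).toNat) →
      ∑ c ∈ Finset.range n, X c = weight y := by
    intro X y hy
    rw [weight, Finset.card_filter, Finset.sum_range]
    exact Finset.sum_congr rfl fun i _ => by rw [hy i]; cases y i <;> rfl
  have hexp : ∀ (X : ℕ → ℕ) (y : Fin n → Bool), (∀ i : Fin n, X i = (y i).toNat) → ∀ Z,
      (FProg.Explains m n k q (s1.arr 1) Z X ↔ weight y = k ∧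
        ∀ r < m, xor (parity y (ω r).1) (ω r).2 = codeError m k q Z r) := by
    intro X y hy Z
    rw [FProg.Explains, hwt X y hy]
    refine and_congr_right fun _ => forall₂_congr fun r hr => ?_
    rw [hsum X y hy r hr, (hA r hr).2, ← codeError_toNat]
    cases parity y (ω r).1 <;> cases (ω r).2 <;> cases codeError m k q Z r <;> simp <;> decide
  set X₀ : ℕ → ℕ := fun c => if h : c < n then (x ⟨c, h⟩).toNat else 0
  have hX₀ : ∀ i : Fin n, X₀ i = (x i).toNat := fun i => by simp [X₀]
  have hBpos : 0 < B := Nat.pos_of_ne_zero (by rintro rfl; omega)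
  set S : Finset ℕ := (Finset.univ.filter fun i => x i = true).image fun i : Fin n => (i : ℕ) / B
  obtain ⟨Z₀, hZ₀, hblock, hflip⟩ := exists_code (k := k) (m := m) hq (S := S)
    (E := errorSet x ω m) (fun b hb => by
      simp only [S, Finset.mem_image] at hb
      obtain ⟨i, -, rfl⟩ := hb
      exact Nat.div_lt_of_lt_mul (by rw [mul_comm]; omega))
    (Finset.card_image_le.trans hx.le) (fun e he => by
      simpa using (Finset.mem_filter.mp he).1) (herr.trans hwk)
    ((Nat.pow_le_pow_right (by omega) herr).trans hw)
  have hmemS : ∀ i : Fin n, (i : ℕ) / B ∈ S ↔ i ∈ blockSupport x B := fun i => by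
    simp [S, blockSupport]
  have key := tryAllCodes_spec ω hs1 X₀ (fun c hc => by
      have := Bool.toNat_lt (x ⟨c, hc⟩); simpa [X₀, hc] using this)
    (fun Z hZ X hX hE c hc => by
      have hy : ∀ i : Fin n, X i = (decide (X i = 1)).toNat := fun i => by
        have := hX i i.2
        by_cases h : X i = 1
        · simp [h]
        · simp only [h, decide_false, Bool.toNat_false]; omega
      obtain ⟨h1, h2⟩ := (hexp X (fun i => decide (X i = 1)) hy Z).mp hE
      have h3 := hconf _ h1 Z (h91 ▸ hZ) h2
      have h4 := hy ⟨c, hc⟩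
      have h5 := congrFun h3 ⟨c, hc⟩
      have h6 := hX₀ ⟨c, hc⟩
      simp only at h4 h5 h6
      rw [h4, h5, h6])
    (Z₀ := Z₀) (by rw [h91]; exact hZ₀) ((hexp X₀ x hX₀ Z₀).mpr ⟨hx, fun r hr => by
      rw [codeError, hflip r]
      have : r ∈ errorSet x ω m ↔ (ω r).2 ≠ parity x (ω r).1 := by simp [errorSet, hr]
      simp only [this]
      cases parity x (ω r).1 <;> cases (ω r).2 <;> simp⟩)
    (fun c _ => by rw [hblock]; split_ifs <;> omega)
    (fun c hc h0 => by
      rw [hblock] at h0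
      have h1 : c / B ∉ S := fun h => by simp [h] at h0
      have h2 : ⟨c, hc⟩ ∉ blockSupport x B := fun h => h1 ((hmemS ⟨c, hc⟩).mpr h)
      rw [hX₀ ⟨c, hc⟩]
      cases h3 : x ⟨c, hc⟩
      · rfl
      · exact absurd (Finset.mem_filter.mpr ⟨Finset.mem_univ _, ⟨c, hc⟩, h3, rfl⟩) h2)
    (fun y hy1 hy2 c hc => by
      set y' : Fin n → Bool := fun i => decide (y i = 1)
      have hy' : ∀ i : Fin n, ((y' i).toNat : ZMod 2) = y i := fun i => by
        simp only [y']
        generalize y i = a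
        revert a; decide
      have h1 := huniq y' (fun i hi => by
          have h0 := hy1 i i.2 (by rw [hblock, if_neg fun h => hi ((hmemS i).mp h)])
          simp [y', h0]) (fun r hr => by
          apply Bool.toNat_natCast_injective
          rw [← hsum X₀ x hX₀ r hr, ← hy2 r hr, parity_natCast, Finset.sum_range]
          exact Finset.sum_congr rfl fun i _ => by rw [(hA r hr).1 i, hy' i])
      rw [← hy' ⟨c, hc⟩, h1]
      exact congrArg Nat.cast (hX₀ ⟨c, hc⟩).symm)
  intro i
  rw [key i i.2, hX₀]

/-! ### The complete program and its running time -/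

/-- `g` is bounded by a polynomial. -/
def PolyBounded (g : ℕ → ℕ) : Prop := ∃ C, ∀ n, g n ≤ C * (n + 1) ^ C

namespace PolyBounded

theorem const (c : ℕ) : PolyBounded fun _ => c :=
  ⟨c, fun n => Nat.le_mul_of_pos_right _ (by positivity)⟩

theorem id : PolyBounded fun n => n := ⟨1, fun n => by simp⟩

theorem pow_mono {n a b : ℕ} (h : a ≤ b) : (n + 1) ^ a ≤ (n + 1) ^ b :=
  Nat.pow_le_pow_right (by omega) h

theorem add {g h : ℕ → ℕ} (hg : PolyBounded g) (hh : PolyBounded h) :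
    PolyBounded fun n => g n + h n := by
  obtain ⟨C, hC⟩ := hg
  obtain ⟨D, hD⟩ := hh
  refine ⟨C + D, fun n => ?_⟩
  rw [add_mul]
  exact Nat.add_le_add ((hC n).trans (Nat.mul_le_mul_left _ (pow_mono (by omega))))
    ((hD n).trans (Nat.mul_le_mul_left _ (pow_mono (by omega))))

theorem mul {g h : ℕ → ℕ} (hg : PolyBounded g) (hh : PolyBounded h) :
    PolyBounded fun n => g n * h n := by
  obtain ⟨C, hC⟩ := hg
  obtain ⟨D, hD⟩ := hh
  refine ⟨C * D + C + D, fun n => (Nat.mul_le_mul (hC n) (hD n)).trans ?_⟩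
  rw [mul_mul_mul_comm, ← pow_add]
  exact Nat.mul_le_mul (by omega) (pow_mono (by omega))

theorem pow {g : ℕ → ℕ} (hg : PolyBounded g) (k : ℕ) : PolyBounded fun n => g n ^ k := by
  induction k with
  | zero => simpa using const 1
  | succ k ih => simpa only [pow_succ] using ih.mul hg

end PolyBounded

/-! ### Computing the parameters and assembling the program. -/

theorem Nat.size_two_pow (L : ℕ) : (2 ^ L).size = L + 1 := by
  have := Nat.size_shiftLeft (m := 1) one_ne_zero L
  rwa [Nat.one_shiftLeft, Nat.size_one, add_comm] at this

/-- A sequence of assignments. -/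
def Prog.assigns : List (ℕ × Expr) → Prog
  | [] => .skip
  | (v, e) :: l => .seq (.assign v e) (Prog.assigns l)

/-- The result of a sequence of assignments. -/
def Config.assigns : List (ℕ × Expr) → Config → Config
  | [], s => s
  | (v, e) :: l, s => (s.setVar v (e.eval s)).assigns l

/-- Each assignment multiplies the bit length of the bound by at most a constant, and the list is
fixed, so `L` grows by a constant factor only. -/
theorem exists_runs_assigns (l : List (ℕ × Expr)) : ∃ C : ℕ, ∀ (n : ℕ) (ω : ℕ → Example n)
    (s : Config) (L : ℕ), s.Bounded (2 ^ L) → (s.assigns l).Bounded (2 ^ (C * (L + 1))) ∧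
      Runs ω (.assigns l) s (C * (L + 1) ^ 2) (s.assigns l) := by
  induction l with
  | nil =>
    refine ⟨1, fun n ω s L hs => ⟨hs.mono (Nat.pow_le_pow_right (by norm_num) (by omega)), 1, ?_,
      .skip s⟩⟩
    rw [one_mul]; exact Nat.one_le_pow _ _ (by omega)
  | cons a l ih =>
    obtain ⟨v, e⟩ := a
    obtain ⟨C₂, h₂⟩ := ih
    obtain ⟨C₁, h₁⟩ := e.exists_cost_bound
    refine ⟨(6 * C₁ + 1) + C₂ * (2 * C₁ + 2) ^ 2, fun n ω s L hs => ?_⟩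
    obtain ⟨hsz, hcost⟩ := h₁ s _ hs
    rw [Nat.size_two_pow] at hsz hcost
    have hL : L + 1 + 1 ≤ 2 * (L + 1) := by omega
    have hsz' : (e.eval s).size ≤ 2 * C₁ * (L + 1) := by nlinarith
    set L₁ := (2 * C₁ + 1) * (L + 1) with hL₁
    have hb : (s.setVar v (e.eval s)).Bounded (2 ^ L₁) := by
      refine (hs.mono (Nat.pow_le_pow_right (by norm_num) ?_)).setVar ?_
      · nlinarith
      · refine (Nat.lt_size_self _).le.trans (Nat.pow_le_pow_right (by norm_num) (hsz'.trans ?_))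
        nlinarith
    obtain ⟨hb₂, hr₂⟩ := h₂ n ω _ L₁ hb
    have hL₂ : L₁ + 1 ≤ (2 * C₁ + 2) * (L + 1) := by rw [hL₁]; nlinarith
    refine ⟨hb₂.mono (Nat.pow_le_pow_right (by norm_num) ?_), ?_⟩
    · calc C₂ * (L₁ + 1) ≤ C₂ * ((2 * C₁ + 2) * (L + 1)) := Nat.mul_le_mul_left _ hL₂
        _ ≤ C₂ * ((2 * C₁ + 2) ^ 2 * (L + 1)) := by
          gcongr; exact Nat.le_self_pow (by norm_num) _
        _ ≤ _ := by rw [add_mul, mul_assoc C₂]; omega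
    · have hr₁ : Runs ω (.assign v e) s ((6 * C₁ + 1) * (L + 1) ^ 2) (s.setVar v (e.eval s)) := by
        refine ⟨_, ?_, .assign v e s⟩
        have h3 : (L + 1 + 1) ^ 2 ≤ 4 * (L + 1) ^ 2 := by nlinarith
        have h4 := Nat.mul_le_mul_left C₁ h3
        have h5 : L + 1 ≤ (L + 1) ^ 2 := Nat.le_self_pow (by norm_num) _
        have h6 := Nat.mul_le_mul_left (2 * C₁) h5
        have h7 : 1 ≤ (L + 1) ^ 2 := Nat.one_le_pow _ _ (by omega)
        calc _ ≤ C₁ * (4 * (L + 1) ^ 2) + 1 + 2 * C₁ * (L + 1) ^ 2 := by omega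
          _ ≤ _ := by ring_nf at h7 ⊢; omega
      refine (hr₁.seq hr₂).mono ?_
      rw [add_mul (6 * C₁ + 1)]
      refine Nat.add_le_add_left ?_ _
      calc C₂ * (L₁ + 1) ^ 2 ≤ C₂ * ((2 * C₁ + 2) * (L + 1)) ^ 2 := by gcongr
        _ = _ := by ring

/-- Compute the parameters from `k` and `t`, found in the variables `100` and `101`. -/
def setup (D : ℕ) : List (ℕ × Expr) :=
  -- Here `q = t / (D * k)`; the `+ 1` in `B` makes `k * q` blocks cover all positions; `m = 2 * k *
  -- B` is twice the number of unknowns that `k` blocks can contain.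
  [(1, .var 100), (2, .op .div (.var 101) (.op .mul (.lit D) (.var 1))),
    (3, .op .add (.op .div (.var 0) (.op .mul (.var 1) (.var 2))) (.lit 1)),
    (4, .op .mul (.lit 2) (.op .mul (.var 1) (.var 3))),
    (5, .op .add (.var 4) (.lit 1)), (6, .op .mul (.lit 2) (.var 1)),
    (7, .op .add (.var 0) (.lit 1)), (8, .op .mul (.lit 8) (.var 2)), (9, .lit 1)]

theorem setup_spec {D n k t : ℕ} {s : Config} (h0 : s.var 0 = n) (hk : s.var 100 = k)
    (ht : s.var 101 = t) :
    FProg.Params n k (t / (D * k)) (n / (k * (t / (D * k))) + 1)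
      (2 * (k * (n / (k * (t / (D * k))) + 1))) (s.assigns (setup D)) ∧
    (s.assigns (setup D)).var 8 = 8 * (t / (D * k)) ∧ (s.assigns (setup D)).var 9 = 1 ∧
    (s.assigns (setup D)).drawn = s.drawn := by
  refine ⟨⟨?_, ?_, ?_, ?_, ?_, ?_, ?_, ?_⟩, ?_, ?_, ?_⟩ <;>
    simp [setup, Config.assigns, Config.setVar_var, Expr.eval, Op.eval, h0, hk, ht,
      Config.setVar_drawn]

/-- Raise variable `8` to the power in variable `1`, multiplying variable `9`. -/
def powLoop : Prog := .forLoop 10 1 (.assign 9 (.op .mul (.var 9) (.var 8)))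

/-- Multiplication is not tame, so this loop is treated separately: the powers `b ^ i` with `i ≤ k`
have length at most about `L * k`, which is polynomial although their values are not. -/
theorem exists_runs_powLoop : ∃ C : ℕ, ∀ (n : ℕ) (ω : ℕ → Example n) (s : Config) (k b L : ℕ),
    s.Bounded (2 ^ L) → s.var 1 = k → s.var 8 = b → s.var 9 = 1 → k ≤ n →
    ((s.setVar 9 (b ^ k)).setVar 10 k).Bounded (2 ^ ((L + 1) * (n + 1))) ∧
      Runs ω powLoop s (C * ((L + 1) * (n + 1)) ^ 3) ((s.setVar 9 (b ^ k)).setVar 10 k) := by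
  obtain ⟨C, hC⟩ := (Expr.op .mul (.var 9) (.var 8)).exists_cost_bound
  refine ⟨2 * (C * 18 + 150), fun n ω s k b L hs h1 h8 h9 hkn => ?_⟩
  set K := (L + 1) * (n + 1) with hK
  have hKL : L ≤ K := by rw [hK]; nlinarith
  have hKn : n + 1 ≤ K := Nat.le_mul_of_pos_left _ (by omega)
  have hbp : ∀ i ≤ k, b ^ i ≤ 2 ^ K := fun i hi => by
    have hb : b ≤ 2 ^ L := h8 ▸ hs.1 8
    calc b ^ i ≤ (2 ^ L) ^ i := Nat.pow_le_pow_left hb i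
      _ = 2 ^ (L * i) := by rw [← pow_mul]
      _ ≤ 2 ^ K := Nat.pow_le_pow_right (by norm_num) (by rw [hK]; nlinarith)
  have hi2 : ∀ i ≤ k, i ≤ 2 ^ K := fun i hi =>
    (Nat.lt_two_pow_self (n := i)).le.trans (Nat.pow_le_pow_right (by norm_num) (by omega))
  have hs' : s.Bounded (2 ^ K) := hs.mono (Nat.pow_le_pow_right (by norm_num) hKL)
  have hS : ∀ i ≤ k, ((s.setVar 9 (b ^ i)).setVar 10 i).Bounded (2 ^ K) := fun i hi =>
    (hs'.setVar (hbp i hi)).setVar (hi2 i hi)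
  refine ⟨hS k le_rfl, ?_⟩
  have hrun := runs_forLoop (ω := ω) (v := 10) (u := 1)
    (p := .assign 9 (.op .mul (.var 9) (.var 8))) (M := 2 ^ K) (c := k)
    (T := (C * (K + 2) ^ 2 + 1 + (K + 1))) (s := s)
    (fun i => (s.setVar 9 (b ^ i)).setVar 10 i) ?_ ?_ ?_ (hS k le_rfl)
  · refine hrun.mono ?_
    rw [Nat.size_two_pow]
    have h2 : K + 1 + 1 ≤ 3 * K := by omega
    calc (k + 1) * (C * (K + 2) ^ 2 + 1 + (K + 1) + 11 * (K + 1 + 1) ^ 2)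
        ≤ K * (C * (3 * K) ^ 2 + 1 + (K + 1) + 11 * (3 * K) ^ 2) := by
          gcongr
          omega
      _ ≤ K * ((C * 18 + 150) * 2 * K ^ 2) := by
          gcongr
          have : 1 ≤ K := by omega
          nlinarith [Nat.zero_le (C * K ^ 2)]
      _ = _ := by ring
  · have : s.setVar 9 (b ^ 0) = s := by
      rw [pow_zero, ← h9]; simp [Config.setVar]
    simp only [this]
  · intro i hi
    refine ⟨((s.setVar 9 (b ^ i)).setVar 10 i).setVar 9 (b ^ (i + 1)), ?_, ?_,
      (hS i hi.le).setVar (hbp _ hi), ?_⟩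
    · have he : (Expr.op .mul (.var 9) (.var 8)).eval ((s.setVar 9 (b ^ i)).setVar 10 i)
          = b ^ (i + 1) := by
        simp [Expr.eval, Op.eval, Config.setVar_var, h8, pow_succ]
      have hx := Exec.assign (ω := ω) 9 (.op .mul (.var 9) (.var 8))
        ((s.setVar 9 (b ^ i)).setVar 10 i)
      rw [he] at hx
      refine ⟨_, ?_, hx⟩
      have h1 := (hC _ _ (hS i hi.le)).2
      have h2 := Nat.size_le_size (hbp (i + 1) hi)
      rw [Nat.size_two_pow] at h1 h2
      have h3 : K + 1 + 1 = K + 2 := rfl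
      rw [h3] at h1
      omega
    · simp [Config.setVar_var]
    · simp only [Config.setVar, Config.mk.injEq, and_true]
      funext w
      by_cases h : w = 10
      · subst h; simp
      · by_cases h' : w = 9
        · subst h'; simp
        · simp [h, h']
  · intro i _
    simp [Config.setVar_var, h1]

/-- The two programs use the even and the odd indices from `100` on. Hence each one starts from a
renamed copy of the initial configuration, the second leaves the result of the first alone, and
variable `0` keeps `n`. Polynomial time bounds the lengths of all the numbers that they leave. -/
theorem exists_runs_constructible {k t : ℕ → ℕ} (hk : Constructible k) (ht : Constructible t) :
    ∃ (pk pt : Prog) (g : ℕ → ℕ), PolyBounded g ∧ ∀ (n : ℕ) (ω : ℕ → Example n),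
      ∃ s : Config, s.Bounded (2 ^ g n) ∧ s.var 0 = n ∧ s.var 100 = k n ∧ s.var 101 = t n ∧
        s.drawn = 0 ∧ ∀ (q : Prog) (T : ℕ) (s' : Config), Runs ω q s T s' →
        Runs ω (.seq (.assign 100 (.var 0)) (.seq (pk.rename fun v => 2 * v + 100)
          (.seq (.assign 101 (.var 0)) (.seq (pt.rename fun v => 2 * v + 101) q))))
          (Config.init n) (g n + T) s' := by
  obtain ⟨pk, c, hpk⟩ := hk
  obtain ⟨pt, d, hpt⟩ := ht
  refine ⟨pk, pt, fun n => c * (n + 1) ^ c + d * (n + 1) ^ d + (4 * n + 4),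
    ((PolyBounded.const c).mul ((PolyBounded.id.add (.const 1)).pow c)).add
      ((PolyBounded.const d).mul ((PolyBounded.id.add (.const 1)).pow d)) |>.add
      (((PolyBounded.const 4).mul .id).add (.const 4)), fun n ω => ?_⟩
  set g := c * (n + 1) ^ c + d * (n + 1) ^ d + (4 * n + 4) with hg
  obtain ⟨τ₁, s₁, e₁, hτ₁, hd₁, hv₁⟩ := hpk n ω
  obtain ⟨τ₂, s₂, e₂, hτ₂, hd₂, hv₂⟩ := hpt n ω
  have hpow : ∀ {a}, a ≤ g → 2 ^ a ≤ 2 ^ g := fun h => Nat.pow_le_pow_right (by norm_num) h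
  have hn : n ≤ 2 ^ g := Nat.lt_two_pow_self.le.trans (hpow (a := n) (by omega))
  have hsz : n.size ≤ n := by rw [Nat.size_le]; exact Nat.lt_two_pow_self
  have hb : (Config.init n).Bounded (2 ^ g) :=
    ⟨fun v => by simp only [Config.init]; split_ifs <;> omega, fun A i => Nat.zero_le _⟩
  have hmod : ∀ a b : ℕ, ¬ 2 * a + 100 = 2 * b + 101 := fun a b => by omega
  have r₀ := Exec.assign (ω := ω) 100 (.var 0) (Config.init n)
  have h0 : (Expr.var 0).eval (Config.init n) = n := by simp [Expr.eval, Config.init]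
  rw [h0] at r₀
  have hb₀ := hb.setVar (v := 100) hn
  set u₀ := (Config.init n).setVar 100 n with hu₀
  obtain ⟨u₁, r₁, hr₁, ha₁⟩ := e₁.rename (φ := fun v => 2 * v + 100)
    (fun a b h => by simpa using h) (u := u₀) ⟨fun v => by
      rw [hu₀, Config.setVar_var]
      by_cases hv : v = 0
      · simp [hv, Config.init]
      · simp [Config.init, hv], fun A => rfl, rfl⟩
  have hb₁ := r₁.bounded hb₀ (hpow (by omega))
  have h1 : (Expr.var 0).eval u₁ = n := by
    rw [Expr.eval, ha₁.1 0 (by simp), hu₀]; simp [Config.setVar_var, Config.init]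
  have r₂ := Exec.assign (ω := ω) 101 (.var 0) u₁
  rw [h1] at r₂
  have hb₂ := hb₁.setVar (v := 101) hn
  set u₂ := u₁.setVar 101 n with hu₂
  obtain ⟨u₃, r₃, hr₃, ha₃⟩ := e₂.rename (φ := fun v => 2 * v + 101)
    (fun a b h => by simpa using h) (u := u₂) ⟨fun v => by
      rw [hu₂, Config.setVar_var]
      by_cases hv : v = 0
      · simp [hv, Config.init]
      · rw [if_neg (by omega), ha₁.1 _ (fun ⟨x, hx⟩ => hmod _ _ hx), hu₀, Config.setVar_var, if_neg (by omega)]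
        simp [Config.init, hv], fun A => by
      rw [hu₂, Config.setVar_arr, ha₁.2 _ (fun ⟨x, hx⟩ => hmod _ _ hx)]; rfl, by
      rw [hu₂, Config.setVar_drawn, hr₁.drawn, hd₁]; rfl⟩
  have hb₃ := r₃.bounded hb₂ (hpow (by omega))
  refine ⟨u₃, hb₃, ?_, ?_, (hr₃.var 0).trans hv₂, by rw [hr₃.drawn, hd₂],
    fun q T s' ⟨τ, hτ, r₄⟩ => ⟨_, ?_, .seq r₀ (.seq r₁ (.seq r₂ (.seq r₃ r₄)))⟩⟩
  · rw [ha₃.1 0 (by simp), hu₂, Config.setVar_var, if_neg (by norm_num)]; exact h1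
  · rw [ha₃.1 100 (fun ⟨x, hx⟩ => hmod 0 x hx.symm), hu₂, Config.setVar_var,
      if_neg (by norm_num)]
    exact (hr₁.var 0).trans hv₁
  · simp only [Expr.cost, Config.init, if_true, ha₁.1 0 (by simp), hu₀, Config.setVar_var]
    norm_num
    omega

/-- Only the loop over codes is long. Its number of rounds is kept as an explicit factor, and
everything else goes into the polynomial `g`. -/
theorem exists_prog_runs {k t : ℕ → ℕ} (hk : Constructible k) (ht : Constructible t) (D : ℕ) :
    ∃ (p : Prog) (g : ℕ → ℕ), PolyBounded g ∧ ∀ (n q B m : ℕ), q = t n / (D * k n) →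
      B = n / (k n * q) + 1 → m = 2 * (k n * B) → k n ≤ n → q ≤ n → m ≤ 2 * n * (n + 1) →
      ∀ ω : ℕ → Example n, ∃ s : Config, FProg.Params n (k n) q B m s ∧
        s.drawn = 0 ∧ s.var 9 = (8 * q) ^ k n ∧
        Runs ω p (Config.init n) (((8 * q) ^ k n + 1) * g n) (FProg.search.den ω s) := by
  obtain ⟨pk, pt, g₁, hg₁, hrun⟩ := exists_runs_constructible hk ht
  obtain ⟨C₁, hC₁⟩ := exists_runs_assigns (setup D)
  obtain ⟨C₂, hC₂⟩ := exists_runs_powLoop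
  obtain ⟨C₃, hC₃⟩ := FProg.exists_time_bound (r := 9) (by norm_num) FProg.wf_readExamples
  obtain ⟨C₄, hC₄⟩ := FProg.exists_time_bound (r := 9) (by norm_num) FProg.wf_tryCode
  have one := PolyBounded.id.add (.const 1)
  set L₂ : ℕ → ℕ := fun n => C₁ * (g₁ n + 1) with hL₂
  have pL₂ : PolyBounded L₂ := (PolyBounded.const C₁).mul (hg₁.add (.const 1))
  set L₃ : ℕ → ℕ := fun n => (L₂ n + 1) * (n + 1) with hL₃
  have pL₃ : PolyBounded L₃ := (pL₂.add (.const 1)).mul one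
  set R : ℕ → ℕ := fun n => 2 * n * (n + 1) + (8 * n + 10) with hR
  have pR : PolyBounded R := (((PolyBounded.const 2).mul .id).mul one).add
    (((PolyBounded.const 8).mul .id).add (.const 10))
  set Y : ℕ → ℕ := fun n => (R n + 1) * (L₃ n + 1 + 1) * (n + 1) with hY
  have pY : PolyBounded Y := ((pR.add (.const 1)).mul ((pL₃.add (.const 1)).add (.const 1))).mul one
  set a : ℕ → ℕ := fun n => g₁ n + (C₁ * (g₁ n + 1) ^ 2 + (C₂ * L₃ n ^ 3 + C₃ * Y n ^ C₃)) with ha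
  have pa : PolyBounded a := hg₁.add (((PolyBounded.const C₁).mul ((hg₁.add (.const 1)).pow 2)).add
    (((PolyBounded.const C₂).mul (pL₃.pow 3)).add ((PolyBounded.const C₃).mul (pY.pow C₃))))
  set b : ℕ → ℕ := fun n => C₄ * Y n ^ C₄ + 11 * (L₃ n + 1 + 1) ^ 2 with hb
  have pb : PolyBounded b := ((PolyBounded.const C₄).mul (pY.pow C₄)).add
    ((PolyBounded.const 11).mul (((pL₃.add (.const 1)).add (.const 1)).pow 2))
  refine ⟨.seq (.assign 100 (.var 0)) (.seq (pk.rename fun v => 2 * v + 100)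
    (.seq (.assign 101 (.var 0)) (.seq (pt.rename fun v => 2 * v + 101)
      (.seq (.assigns (setup D)) (.seq powLoop FProg.search.compile))))), fun n => a n + b n,
    pa.add pb, fun n q B m hq hB hm hkn hqn hmn ω => ?_⟩
  obtain ⟨s, hs, h0, h100, h101, hd, hfin⟩ := hrun n ω
  obtain ⟨hsA, hrA⟩ := hC₁ n ω s _ hs
  obtain ⟨hpA, h8A, h9A, hdA⟩ := setup_spec (D := D) h0 h100 h101
  rw [← hq] at hpA h8A
  rw [← hB] at hpA
  rw [← hm] at hpA
  set sA := s.assigns (setup D)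
  obtain ⟨hsB, hrB⟩ := hC₂ n ω sA (k n) (8 * q) _ hsA hpA.v1 h8A h9A hkn
  have hpB : FProg.Params n (k n) q B m ((sA.setVar 9 ((8 * q) ^ k n)).setVar 10 (k n)) :=
    hpA.congr fun w hw => by
      rw [Config.setVar_var, if_neg (by omega), Config.setVar_var, if_neg (by omega)]
  have h8B : ((sA.setVar 9 ((8 * q) ^ k n)).setVar 10 (k n)).var 8 = 8 * q := by
    simp [Config.setVar_var, h8A]
  have h9B : ((sA.setVar 9 ((8 * q) ^ k n)).setVar 10 (k n)).var 9 = (8 * q) ^ k n := by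
    simp [Config.setVar_var]
  set sB := (sA.setVar 9 ((8 * q) ^ k n)).setVar 10 (k n)
  have hBn : B ≤ n + 1 := by rw [hB]; exact Nat.succ_le_succ (Nat.div_le_self _ _)
  have hRB : ∀ w < 9, sB.var w ≤ R n := by
    intro w hw
    simp only [hR]
    interval_cases w
    · rw [hpB.v0]; omega
    · rw [hpB.v1]; omega
    · rw [hpB.v2]; omega
    · rw [hpB.v3]; omega
    · rw [hpB.v4]; omega
    · rw [hpB.v5]; omega
    · rw [hpB.v6]; omega
    · rw [hpB.v7]; omega
    · rw [h8B]; omega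
  have hone : 1 ≤ 2 ^ L₃ n := Nat.one_le_two_pow
  have hread := hC₃ n ω sB _ (R n) hone hsB hRB
  have hsC := FProg.bounded_den ω hone FProg.wf_readExamples hsB
  have hroC : ∀ w < 10, (FProg.readExamples.den ω sB).var w = sB.var w := fun w hw =>
    FProg.den_var ω _ (FProg.notMem_writes_of_wf FProg.wf_readExamples hw) _
  have htry := FProg.runs_forb ω (v := 10) (u := 9) (p := FProg.tryCode) (r := 10) (by decide)
    (by norm_num) hone hsC (fun s' hs' hw => hC₄ n ω s' _ (R n) hone hs' fun w hw' => by
      rw [hw w (by omega), hroC w (by omega)]; exact hRB w hw')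
  rw [Nat.size_two_pow] at hread htry
  rw [hroC 9 (by norm_num), h9B] at htry
  refine ⟨sB, hpB, by simp [sB, Config.setVar_drawn, hdA, hd], h9B, ?_⟩
  refine (hfin _ _ _ (hrA.seq (hrB.seq (hread.seq htry)))).mono ?_
  have e1 : ((8 * q) ^ k n + 1) * (a n + b n)
      = a n + ((8 * q) ^ k n * a n + ((8 * q) ^ k n + 1) * b n) := by ring
  rw [e1]
  simp only [ha, hb, hY, hL₃, hL₂]
  omega

/-! ### Choice of the parameters -/

/-- Union bound over ambiguity, confusion and excess of errors; the three summands in `hδ` are their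
probabilities. -/
theorem solvesLPN_of_runs {p : Prog} {n k q B m w T : ℕ} {η : unitInterval} {δ : ℝ}
    (hrun : ∀ ω : ℕ → Example n, ∃ s : Config, FProg.Params n k q B m s ∧ s.drawn = 0 ∧
      s.var 9 = (8 * q) ^ k ∧ Runs ω p (Config.init n) T (FProg.search.den ω s))
    (hk : 1 ≤ k) (hq : 1 ≤ q) (hB : B = n / (k * q) + 1) (hm : m = 2 * (k * B))
    (hw : (m + 1) ^ w ≤ 2 ^ k) (hwk : w ≤ k)
    (hδ : (1 / 2 : ℝ) ^ (k * B) + n.choose k * (8 * q) ^ k * (1 / 2) ^ m + m * η / (w + 1) ≤ δ) :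
    SolvesLPN p n k η δ T m := by
  refine ⟨fun ω => ?_, fun x hx => ?_⟩
  · obtain ⟨s, hs, hd, -, τ, hτ, he⟩ := hrun ω
    refine ⟨τ, _, he, hτ, ?_⟩
    rw [FProg.search, FProg.den_seq, FProg.den_drawn ω _ (by decide),
      (FProg.readExamples_spec ω hs).2, hd, zero_add]
  · have hkq : 0 < k * q := Nat.mul_pos hk hq
    have hBn : n < k * q * B := by rw [hB]; exact Nat.lt_mul_div_succ n hkq
    set A₁ : Set (ℕ → Example n) := {ω | ∃ y : Fin n → Bool, y ≠ x ∧
      (∀ i, i ∉ blockSupport x B → y i = false) ∧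
      ∀ r < m, parity y (ω r).1 = parity x (ω r).1}
    set A₂ : Set (ℕ → Example n) := {ω | ∃ y : Fin n → Bool, y ≠ x ∧ weight y = k ∧
      ∃ Z < (8 * q) ^ k, ∀ r < m, xor (parity y (ω r).1) (ω r).2 = codeError m k q Z r}
    set A₃ : Set (ℕ → Example n) := {ω | w < (errorSet x ω m).card}
    set G : Set (ℕ → Example n) := {ω | ∃ (τ : ℕ) (s : Config),
      Exec ω p (Config.init n) τ s ∧ s.Outputs x}
    -- Covering the whole space and using subadditivity avoids any question of measurability.
    have hcover : (Set.univ : Set (ℕ → Example n)) ⊆ G ∪ (A₁ ∪ A₂ ∪ A₃) := by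
      intro ω _
      by_contra hω
      simp only [Set.mem_union, not_or] at hω
      obtain ⟨hG, ⟨h1, h2⟩, h3⟩ := hω
      obtain ⟨s, hs, hd, h9, τ, hτ, he⟩ := hrun ω
      refine hG ⟨τ, _, he, FProg.search_spec hs hd h9 hq hBn hw hwk hx (not_lt.mp h3)
        (fun y hy1 hy2 => ?_) (fun y hy1 Z hZ hy2 => ?_)⟩
      · by_contra hne
        exact h1 ⟨y, hne, hy1, hy2⟩
      · by_contra hne
        exact h2 ⟨y, hne, hy1, Z, hZ, hy2⟩
    have h0 : (1 : ℝ) ≤ (sourceLaw x η).real G + ((sourceLaw x η).real A₁ +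
        (sourceLaw x η).real A₂ + (sourceLaw x η).real A₃) := by
      calc (1 : ℝ) = (sourceLaw x η).real Set.univ := by simp
        _ ≤ (sourceLaw x η).real (G ∪ (A₁ ∪ A₂ ∪ A₃)) := measureReal_mono hcover
        _ ≤ _ := (measureReal_union_le _ _).trans (by
          gcongr
          exact (measureReal_union_le _ _).trans (by gcongr; exact measureReal_union_le _ _))
    have h1 : (sourceLaw x η).real A₁ ≤ (1 / 2) ^ (k * B) := by
      refine (sourceLaw_ambiguous_le x η m _).trans ?_
      have hc := card_blockSupport_le x (B := B) (by rw [hB]; exact Nat.succ_pos _)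
      rw [hx] at hc
      calc (2 : ℝ) ^ (blockSupport x B).card * (1 / 2) ^ m ≤ 2 ^ (k * B) * (1 / 2) ^ m := by
            gcongr; norm_num
        _ = _ := by
          rw [hm, two_mul, pow_add, ← mul_assoc, ← mul_pow]; norm_num
    have h2 := sourceLaw_confused_le x η m k ((8 * q) ^ k) (codeError m k q)
    have h3 := sourceLaw_errors_le x η m w
    push_cast at h2
    change (sourceLaw x η).real A₂ ≤ _ at h2
    change (sourceLaw x η).real A₃ ≤ _ at h3
    linarith

/-! ### Binomial coefficients and asymptotic estimates. -/

theorem pow_le_choose_of_mul_le {f : ℕ} (hf : 1 ≤ f) (k n : ℕ) (h : f * k ≤ n) :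
    f ^ k ≤ n.choose k := by
  induction k generalizing n with
  | zero => simp
  | succ k ih =>
    obtain ⟨n, rfl⟩ : ∃ n', n = n' + 1 := ⟨n - 1, by
      have : 1 ≤ f * (k + 1) := Nat.mul_pos hf (by omega)
      omega⟩
    have h1 := ih n (by rw [mul_add] at h; omega)
    have h2 := Nat.add_one_mul_choose_eq n k
    have h3 : f ^ (k + 1) * (k + 1) ≤ (n + 1).choose (k + 1) * (k + 1) := by
      rw [← h2]
      calc f ^ (k + 1) * (k + 1) = (f * (k + 1)) * f ^ k := by ring
        _ ≤ (n + 1) * n.choose k := Nat.mul_le_mul h h1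
    exact Nat.le_of_mul_le_mul_right h3 (by omega)

/-- Choose `k / 2` of the `k` elements first, then the others. For odd `k` the second part is larger
by one, which costs the factor `n`. -/
theorem choose_le_mul_sq_choose_half (n k : ℕ) (hn : 1 ≤ n) :
    n.choose k ≤ n * n.choose (k / 2) ^ 2 := by
  have h1 := Nat.choose_mul (n := n) (Nat.div_le_self k 2)
  have h2 : n.choose k ≤ n.choose (k / 2) * (n - k / 2).choose (k - k / 2) := by
    rw [← h1]
    exact Nat.le_mul_of_pos_right _ (Nat.choose_pos (Nat.div_le_self k 2))
  have h3 : (n - k / 2).choose (k - k / 2) ≤ n.choose (k - k / 2) :=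
    Nat.choose_le_choose _ (Nat.sub_le _ _)
  have h4 : n.choose (k - k / 2) ≤ n * n.choose (k / 2) := by
    rcases Nat.even_or_odd' k with ⟨j, rfl | rfl⟩
    · rw [show 2 * j - 2 * j / 2 = 2 * j / 2 by omega]
      exact Nat.le_mul_of_pos_left _ hn
    · rw [show 2 * j + 1 - (2 * j + 1) / 2 = (2 * j + 1) / 2 + 1 by omega]
      generalize (2 * j + 1) / 2 = h
      have := Nat.choose_succ_right_eq n h
      calc n.choose (h + 1) ≤ n.choose (h + 1) * (h + 1) := Nat.le_mul_of_pos_right _ (by omega)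
        _ = n.choose h * (n - h) := this
        _ ≤ n.choose h * n := Nat.mul_le_mul_left _ (Nat.sub_le _ _)
        _ = _ := mul_comm _ _
  calc _ ≤ n.choose (k / 2) * (n * n.choose (k / 2)) :=
        h2.trans (Nat.mul_le_mul_left _ (h3.trans h4))
    _ = _ := by ring

/-- The size of the parameters `q` and `B`, for `f` large. -/
theorem params_bounds {n f k t D : ℕ} {c₁ c₂ α : ℝ} (hc₁ : 0 < c₁) (hc₂ : 0 < c₂)
    (hf : 1 ≤ f) (hk : k = n / f) (hk1 : 1 ≤ k)
    (ht₁ : c₁ * (n / (f : ℝ) ^ α) ≤ t) (ht₂ : t ≤ c₂ * (n / (f : ℝ) ^ α))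
    (hD : 16 * c₂ * Real.exp 1 ≤ D) (hfD : D ≤ c₁ * (f : ℝ) ^ (1 - α)) :
    1 ≤ t / (D * k) ∧ 8 * ((t / (D * k) : ℕ) : ℝ) ≤ Real.exp (-1) * (f : ℝ) ^ (1 - α) ∧
    (f : ℝ) ^ α ≤ ((n / (k * (t / (D * k))) + 1 : ℕ) : ℝ) ∧
    ((n / (k * (t / (D * k))) + 1 : ℕ) : ℝ) ≤ 2 * D / c₁ * (f : ℝ) ^ α + 1 := by
  have hf0 : (0 : ℝ) < f := by exact_mod_cast hf
  set X := (f : ℝ) ^ α with hX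
  have hX0 : 0 < X := Real.rpow_pos_of_pos hf0 α
  have hY : (f : ℝ) ^ (1 - α) = f / X := by rw [Real.rpow_sub hf0, Real.rpow_one]
  rw [hY] at hfD ⊢
  have hk0 : (0 : ℝ) < k := by exact_mod_cast hk1
  have hfk : (f : ℝ) * k ≤ n := by
    rw [hk]; exact_mod_cast Nat.mul_div_le n f
  have hn2 : (n : ℝ) ≤ 2 * (f * k) := by
    have h1 : n < f * (n / f + 1) := Nat.lt_mul_div_succ n hf
    rw [← hk] at h1
    have h2 : n ≤ 2 * (f * k) := by nlinarith
    exact_mod_cast h2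
  have he : 0 < Real.exp 1 := Real.exp_pos 1
  have hD0 : (0 : ℝ) < D := lt_of_lt_of_le (by positivity) hD
  have hDn : 0 < D := by exact_mod_cast hD0
  have hDk : 0 < D * k := Nat.mul_pos hDn hk1
  -- Up to constants, `q` is `f / (D * X)` and `B` is `D * X`. The hypothesis `hfD` keeps the
  -- quotient from rounding down to `0`.
  set q := t / (D * k) with hq
  have hDkt : (D : ℝ) * k ≤ t := by
    refine le_trans ?_ ht₁
    calc (D : ℝ) * k ≤ c₁ * (f / X) * k := by gcongr
      _ = c₁ * ((f * k) / X) := by ring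
      _ ≤ c₁ * (n / X) := by gcongr
  have hq1 : 1 ≤ q := (Nat.one_le_div_iff hDk).mpr (by exact_mod_cast hDkt)
  have hq0 : (0 : ℝ) < q := by exact_mod_cast hq1
  have hqt : (q : ℝ) * (D * k) ≤ t := by
    rw [hq]; exact_mod_cast Nat.div_mul_le_self t (D * k)
  have htq : (t : ℝ) ≤ 2 * (q * (D * k)) := by
    have h1 : t < D * k * (q + 1) := Nat.lt_mul_div_succ t hDk
    have h2 : t ≤ 2 * (q * (D * k)) := by nlinarith
    exact_mod_cast h2
  have hkq : 0 < k * q := Nat.mul_pos hk1 hq1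
  have hkq0 : (0 : ℝ) < k * q := by positivity
  refine ⟨hq1, ?_, ?_, ?_⟩
  · have h1 : (q : ℝ) * (D * k) ≤ c₂ * (2 * (f * k) / X) := hqt.trans (ht₂.trans (by gcongr))
    have h2 : (q : ℝ) * D ≤ 2 * c₂ * (f / X) := by
      have : (q : ℝ) * D * k ≤ 2 * c₂ * (f / X) * k := by
        calc (q : ℝ) * D * k = q * (D * k) := by ring
          _ ≤ _ := h1
          _ = _ := by ring
      exact le_of_mul_le_mul_right this hk0
    -- The constant `16 * c₂ * e` in `hD` is made of the `8` in the code length, the `2` from `n ≤ 2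
    -- * f * k`, and the factor `e` to be gained for each of the `k` blocks.
    have h3 : 8 * (q : ℝ) * Real.exp 1 * (2 * c₂) ≤ 2 * c₂ * (f / X) := by
      calc 8 * (q : ℝ) * Real.exp 1 * (2 * c₂) = q * (16 * c₂ * Real.exp 1) := by ring
        _ ≤ q * D := by gcongr
        _ ≤ _ := h2
    have h4 : 8 * (q : ℝ) * Real.exp 1 ≤ f / X :=
      le_of_mul_le_mul_right (by linarith) (show (0 : ℝ) < 2 * c₂ by positivity)
    rw [Real.exp_neg, inv_mul_eq_div, le_div_iff₀ he]
    exact h4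
  · have h1 : (n : ℝ) ≤ k * q * ((n / (k * q) + 1 : ℕ) : ℝ) := by
      have := (Nat.lt_mul_div_succ n hkq).le
      exact_mod_cast this
    have h2 : (k * q : ℝ) * D ≤ c₂ * (n / X) := by
      calc (k * q : ℝ) * D = q * (D * k) := by ring
        _ ≤ _ := hqt.trans ht₂
    have h3 : c₂ ≤ D := by
      have : (1 : ℝ) ≤ Real.exp 1 := Real.one_le_exp (by norm_num)
      nlinarith
    have hn0 : (0 : ℝ) < n := lt_of_lt_of_le (by positivity) hfk
    have h4 : (k * q : ℝ) * X ≤ n := by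
      have h5 : (k * q : ℝ) * D * X ≤ c₂ * n := by
        calc (k * q : ℝ) * D * X ≤ c₂ * (n / X) * X := by gcongr
          _ = c₂ * n := by field_simp
      have h6 : D * ((k * q : ℝ) * X) ≤ D * n := by nlinarith
      exact le_of_mul_le_mul_left h6 hD0
    exact le_of_mul_le_mul_left (h4.trans h1) hkq0
  · push_cast
    have h1 : ((n / (k * q) : ℕ) : ℝ) ≤ n / (k * q) := by
      have := @Nat.cast_div_le ℝ _ _ _ n (k * q)
      simpa using this
    have h2 : (n : ℝ) / (k * q) ≤ 2 * D / c₁ * X := by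
      rw [div_le_iff₀ hkq0]
      have h3 : c₁ * (n / X) ≤ 2 * (q * (D * k)) := ht₁.trans htq
      have h4 : c₁ * n ≤ 2 * (q * (D * k)) * X := by
        calc c₁ * n = c₁ * (n / X) * X := by field_simp
          _ ≤ _ := by gcongr
      calc (n : ℝ) = (c₁ * n) / c₁ := by field_simp
        _ ≤ (2 * (q * (D * k)) * X) / c₁ := by gcongr
        _ = _ := by ring
    linarith

theorem tendsto_div_of_isLittleO {f k : ℕ → ℕ}
    (hf : (fun n => (f n : ℝ)) =o[atTop] fun n => (n : ℝ) / Real.log (Real.log n))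
    (hf1 : ∀ᶠ n in atTop, 1 ≤ f n) (hk : ∀ n, k n = n / f n) : Tendsto k atTop atTop := by
  refine tendsto_atTop.mpr fun A => ?_
  have hlog : ∀ᶠ n : ℕ in atTop, 1 ≤ Real.log (Real.log n) :=
    (Real.tendsto_log_atTop.comp (Real.tendsto_log_atTop.comp
      tendsto_natCast_atTop_atTop)).eventually_ge_atTop 1
  filter_upwards [hlog, hf1, hf.bound (c := 1 / ((A : ℝ) + 1)) (by positivity)] with n hl h1 hb
  rw [hk, Nat.le_div_iff_mul_le (by omega)]
  rw [Real.norm_natCast, Real.norm_of_nonneg (by positivity)] at hb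
  have h2 : (n : ℝ) / Real.log (Real.log n) ≤ n := div_le_self (by positivity) hl
  have h3 : (f n : ℝ) ≤ 1 / ((A : ℝ) + 1) * n := hb.trans (by gcongr)
  rw [one_div, inv_mul_eq_div, le_div_iff₀ (by positivity)] at h3
  have h4 : ((A * f n : ℕ) : ℝ) ≤ n := by
    push_cast
    have : (0 : ℝ) ≤ f n := by positivity
    nlinarith
  exact_mod_cast h4

theorem choose_le_pow_of_le {n f k : ℕ} (h : (n : ℝ) ≤ 2 * (f * k)) :
    (n.choose k : ℝ) ≤ (2 * Real.exp 1 * f) ^ k := by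
  have h1 : (n.choose k : ℝ) ≤ (n : ℝ) ^ k / (k.factorial : ℝ) := Nat.choose_le_pow_div k n
  have h2 : (k : ℝ) ^ k / (k.factorial : ℝ) ≤ Real.exp k :=
    Real.pow_div_factorial_le_exp (k : ℝ) (by positivity) k
  calc (n.choose k : ℝ) ≤ (2 * (f * k)) ^ k / (k.factorial : ℝ) := h1.trans (by gcongr)
    _ = (2 * f) ^ k * ((k : ℝ) ^ k / (k.factorial : ℝ)) := by rw [← mul_assoc, mul_pow]; ring
    _ ≤ (2 * f) ^ k * Real.exp k := by gcongr
    _ = (2 * Real.exp 1 * f) ^ k := by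
      rw [← Real.exp_one_pow, ← mul_pow]; ring

theorem pow_le_exp_mul_choose_rpow {n f k q : ℕ} {α : ℝ} (hf : 1 ≤ f) (hα : α ≤ 1)
    (hfk : f * k ≤ n) (hq : 8 * (q : ℝ) ≤ Real.exp (-1) * (f : ℝ) ^ (1 - α)) :
    (8 * (q : ℝ)) ^ k ≤ Real.exp (-k) * ((n.choose k : ℕ) : ℝ) ^ (1 - α) := by
  have h1 : ((f : ℝ) ^ k) ≤ n.choose k := by exact_mod_cast pow_le_choose_of_mul_le hf k n hfk
  calc (8 * (q : ℝ)) ^ k ≤ (Real.exp (-1) * (f : ℝ) ^ (1 - α)) ^ k := by gcongr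
    _ = Real.exp (-k) * ((f : ℝ) ^ k) ^ (1 - α) := by
      rw [mul_pow, ← Real.exp_nat_mul, Real.rpow_pow_comm (by positivity)]
      congr 2; ring
    _ ≤ _ := by gcongr

/-- All three factors are `k`-th powers: at most `2 * e * f` for the vectors, `f` for the codes and
`4 ^ (-B)` for the examples. -/
theorem confusion_bound {n f k q B : ℕ} (hn : (n : ℝ) ≤ 2 * (f * k)) (hq : 8 * (q : ℝ) ≤ f)
    (hB : 4 * Real.exp 1 * (f : ℝ) ^ 2 ≤ 4 ^ B) :
    (n.choose k : ℝ) * (8 * q) ^ k * (1 / 2) ^ (2 * (k * B)) ≤ (1 / 2) ^ k := by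
  have h1 : (2 * Real.exp 1 * f) * f * (1 / 4) ^ B ≤ 1 / 2 := by
    rw [one_div_pow, mul_one_div, div_le_iff₀ (by positivity)]
    nlinarith
  calc (n.choose k : ℝ) * (8 * q) ^ k * (1 / 2) ^ (2 * (k * B))
      ≤ (2 * Real.exp 1 * f) ^ k * (f : ℝ) ^ k * (1 / 2) ^ (2 * (k * B)) := by
        gcongr; exact choose_le_pow_of_le hn
    _ = ((2 * Real.exp 1 * f) * f * (1 / 4) ^ B) ^ k := by
        have e : (1 / 2 : ℝ) ^ (2 * (k * B)) = ((1 / 4 : ℝ) ^ B) ^ k := by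
          rw [show 2 * (k * B) = 2 * (B * k) by ring, pow_mul, ← pow_mul (1 / 4 : ℝ)]
          norm_num
        rw [e, ← mul_pow, ← mul_pow]
    _ ≤ _ := by gcongr

/-- Used at `x = f n`, where `B ≥ f ^ α ≥ f ^ (1 / 2)` makes `4 ^ B` beat the polynomial in `f` of
the confusion bound. -/
theorem eventually_sq_le_exp : ∀ᶠ x : ℝ in atTop,
    4 * Real.exp 1 * x ^ 2 ≤ Real.exp (x ^ (1 / 2 : ℝ)) := by
  have h1 := (tendsto_rpow_atTop (show (0 : ℝ) < 1 / 2 by norm_num)).eventually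
    ((Real.tendsto_pow_mul_exp_neg_atTop_nhds_zero 4).eventually_le_const
      (show (0 : ℝ) < 1 / (4 * Real.exp 1) by positivity))
  filter_upwards [h1, eventually_ge_atTop 0] with x hx hx0
  have h2 : (x ^ (1 / 2 : ℝ)) ^ 4 = x ^ 2 := by
    rw [← Real.rpow_natCast, ← Real.rpow_mul hx0]
    norm_num
  rw [h2, Real.exp_neg, ← div_eq_mul_inv, div_le_div_iff₀ (by positivity) (by positivity)] at hx
  linarith

theorem size_le_three_mul_log {n : ℕ} (hn : 3 ≤ n) : (n.size : ℝ) ≤ 3 * Real.log n := by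
  have hs : 2 ^ (n.size - 1) ≤ n := by
    by_contra h
    push Not at h
    have h1 := Nat.size_le.mpr h
    have h2 : 0 < n.size := Nat.size_pos.mpr (by omega)
    omega
  have hs1 : 1 ≤ n.size := Nat.size_pos.mpr (by omega)
  have h1 : ((n.size - 1 : ℕ) : ℝ) * Real.log 2 ≤ Real.log n := by
    rw [← Real.log_pow]
    exact Real.log_le_log (by positivity) (by exact_mod_cast hs)
  rw [Nat.cast_sub hs1, Nat.cast_one] at h1
  have h2 := Real.log_two_gt_d9
  have h3 : (1 : ℝ) ≤ Real.log n := by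
    rw [Real.le_log_iff_exp_le (by positivity)]
    have := Real.exp_one_lt_d9
    have h4 : (3 : ℝ) ≤ n := by exact_mod_cast hn
    linarith
  nlinarith

/-- The `18` is `2 * 3 * 3`: the `2` in the bound on `m`, the `3` in `n.size ≤ 3 * log n`, and the
share `δ / 3` of the failure probability. -/
theorem error_bound {m n k : ℕ} {η C X δ : ℝ} (hn : 3 ≤ n) (hk : 1 ≤ k) (hη : 0 ≤ η) (hX : 0 < X)
    (hC : 0 < C) (hδ : 0 < δ) (hm : (m : ℝ) ≤ 2 * (k * (C * X)))
    (h : η ≤ δ / (18 * C) * (1 / (X * Real.log n))) :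
    m * η / (((k / n.size : ℕ) : ℝ) + 1) ≤ δ / 3 := by
  have hs := size_le_three_mul_log hn
  have hs0 : 0 < n.size := Nat.size_pos.mpr (by omega)
  have hs0' : (0 : ℝ) < n.size := by exact_mod_cast hs0
  have hlog : 0 < Real.log n := by linarith
  have hw : (k : ℝ) ≤ n.size * (((k / n.size : ℕ) : ℝ) + 1) := by
    exact_mod_cast (Nat.lt_mul_div_succ k hs0).le
  have hw' : (k : ℝ) ≤ 3 * Real.log n * (((k / n.size : ℕ) : ℝ) + 1) := hw.trans (by gcongr)
  rw [div_le_iff₀ (by positivity)]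
  calc (m : ℝ) * η ≤ (2 * (k * (C * X))) * (δ / (18 * C) * (1 / (X * Real.log n))) := by gcongr
    _ = δ / 3 * (k / (3 * Real.log n)) := by field_simp; ring
    _ ≤ _ := by
      gcongr
      rw [div_le_iff₀ (by positivity)]
      linarith

theorem PolyBounded.eventually_le_pow {g : ℕ → ℕ} (hg : PolyBounded g) :
    ∃ c : ℕ, ∀ᶠ n in atTop, 2 * g n ≤ n ^ c := by
  obtain ⟨C, hC⟩ := hg
  refine ⟨1 + 2 * C, ?_⟩
  filter_upwards [eventually_ge_atTop (2 * C + 2)] with n hn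
  have h1 : n + 1 ≤ n ^ 2 := by nlinarith
  calc 2 * g n ≤ 2 * (C * (n + 1) ^ C) := Nat.mul_le_mul_left _ (hC n)
    _ = 2 * C * (n + 1) ^ C := by ring
    _ ≤ n * (n ^ 2) ^ C := Nat.mul_le_mul (by omega) (Nat.pow_le_pow_left h1 C)
    _ = n ^ (1 + 2 * C) := by rw [← pow_mul, pow_add, pow_one]

/-- If the time is below `e ^ (-k) * (n choose k) ^ (1 - α)` up to a polynomial factor, then it
breaks the `n choose k / 2` barrier. -/
theorem isLittleO_choose_half {T k : ℕ → ℕ} {α : ℝ} {c : ℕ} (hα : 1 / 2 ≤ α)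
    (hk : Tendsto k atTop atTop) (hkn : ∀ᶠ n in atTop, k n ≤ n)
    (hT : ∀ᶠ n in atTop, (T n : ℝ) ≤
      Real.exp (-(k n : ℝ)) * ((n.choose (k n) : ℕ) : ℝ) ^ (1 - α) * (n : ℝ) ^ c)
    (hlog : (fun n : ℕ => Real.log n) =o[atTop] fun n => (k n : ℝ)) :
    (fun n => (T n : ℝ)) =o[atTop] fun n => ((n.choose (k n / 2) : ℕ) : ℝ) := by
  have hk' : Tendsto (fun n => Real.exp (-((k n : ℝ) / 2))) atTop (𝓝 0) :=
    Real.tendsto_exp_neg_atTop_nhds_zero.comp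
      ((tendsto_natCast_atTop_atTop.comp hk).atTop_div_const (by norm_num))
  refine IsLittleO.of_bound fun ε hε => ?_
  filter_upwards [hT, hkn, hk'.eventually_le_const hε, eventually_ge_atTop 1,
    hlog.bound (c := 1 / (2 * ((c : ℝ) + 1))) (by positivity)] with n hT hkn hε' hn hl
  have hn0 : (0 : ℝ) < n := by exact_mod_cast hn
  have hn1 : (1 : ℝ) ≤ n := by exact_mod_cast hn
  rw [Real.norm_natCast, Real.norm_natCast]
  rw [Real.norm_natCast, Real.norm_of_nonneg (Real.log_nonneg hn1)] at hl
  have h1 : (1 : ℝ) ≤ n.choose (k n) := by exact_mod_cast Nat.choose_pos hkn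
  have h2 : ((n.choose (k n) : ℕ) : ℝ) ≤ (n * n.choose (k n / 2)) ^ 2 := by
    have h3 := choose_le_mul_sq_choose_half n (k n) hn
    have h4 : n.choose (k n) ≤ (n * n.choose (k n / 2)) ^ 2 := by
      refine h3.trans ?_
      rw [mul_pow]
      exact Nat.mul_le_mul_right _ (Nat.le_self_pow (by norm_num) n)
    exact_mod_cast h4
  have h3 : ((n.choose (k n) : ℕ) : ℝ) ^ (1 - α) ≤ n * n.choose (k n / 2) := by
    calc ((n.choose (k n) : ℕ) : ℝ) ^ (1 - α) ≤ ((n.choose (k n) : ℕ) : ℝ) ^ (1 / 2 : ℝ) :=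
          Real.rpow_le_rpow_of_exponent_le h1 (by linarith)
      _ = √((n.choose (k n) : ℕ) : ℝ) := (Real.sqrt_eq_rpow _).symm
      _ ≤ _ := Real.sqrt_le_iff.mpr ⟨by positivity, h2⟩
  -- Half of the exponent `-k` absorbs the powers of `n`; the other half gives the factor tending to
  -- `0`.
  have h4 : (n : ℝ) ^ (c + 1) ≤ Real.exp ((k n : ℝ) / 2) := by
    rw [← Real.exp_log (pow_pos hn0 (c + 1)), Real.log_pow]
    refine Real.exp_le_exp.mpr ?_
    push_cast
    calc ((c : ℝ) + 1) * Real.log n ≤ (c + 1) * (1 / (2 * (c + 1)) * k n) := by gcongr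
      _ = k n / 2 := by field_simp
  calc (T n : ℝ) ≤ Real.exp (-(k n : ℝ)) * (n * n.choose (k n / 2)) * (n : ℝ) ^ c :=
        hT.trans (by gcongr)
    _ = Real.exp (-(k n : ℝ)) * (n : ℝ) ^ (c + 1) * n.choose (k n / 2) := by ring
    _ ≤ Real.exp (-(k n : ℝ)) * Real.exp ((k n : ℝ) / 2) * n.choose (k n / 2) := by gcongr
    _ = Real.exp (-((k n : ℝ) / 2)) * n.choose (k n / 2) := by
      rw [← Real.exp_add]; congr 2; ring
    _ ≤ _ := by gcongr

theorem solvesLPN_and_time_of_params {p : Prog} {n f k q B m g c : ℕ} {η : unitInterval}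
    {α δ Cb : ℝ}
    (hrun : k ≤ n → q ≤ n → m ≤ 2 * n * (n + 1) → ∀ ω : ℕ → Example n, ∃ s : Config,
      FProg.Params n k q B m s ∧ s.drawn = 0 ∧ s.var 9 = (8 * q) ^ k ∧
      Runs ω p (Config.init n) (((8 * q) ^ k + 1) * g) (FProg.search.den ω s))
    (hn : 3 ≤ n) (hf : 1 ≤ f) (hkf : k = n / f) (hk : 1 ≤ k) (hα : α ∈ Set.Ico (1 / 2 : ℝ) 1)
    (hδ : 0 < δ) (hCb : 0 < Cb) (hq1 : 1 ≤ q)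
    (hq : 8 * (q : ℝ) ≤ Real.exp (-1) * (f : ℝ) ^ (1 - α))
    (hB : B = n / (k * q) + 1) (hB1 : (f : ℝ) ^ α ≤ B) (hB2 : (B : ℝ) ≤ Cb * (f : ℝ) ^ α)
    (hm : m = 2 * (k * B)) (hCf : 4 * Cb ≤ (f : ℝ) ^ (1 - α))
    (hexp : 4 * Real.exp 1 * (f : ℝ) ^ 2 ≤ Real.exp ((f : ℝ) ^ (1 / 2 : ℝ)))
    (hη : (η : ℝ) ≤ δ / (18 * Cb) * (1 / ((f : ℝ) ^ α * Real.log n)))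
    (hkδ : (1 / 2 : ℝ) ^ k ≤ δ / 3) (hg : 2 * g ≤ n ^ c) :
    SolvesLPN p n k η δ (((8 * q) ^ k + 1) * g) m ∧
    (((((8 * q) ^ k + 1) * g : ℕ) : ℝ) ≤
      Real.exp (-(k : ℝ)) * ((n.choose k : ℕ) : ℝ) ^ (1 - α) * (n : ℝ) ^ c) ∧
    (m : ℝ) ≤ 2 * Cb * (k * (f : ℝ) ^ α) := by
  obtain ⟨hα1, hα2⟩ := hα
  have hf' : (1 : ℝ) ≤ f := by exact_mod_cast hf
  have hf0 : (0 : ℝ) < f := by linarith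
  have hfk : f * k ≤ n := hkf ▸ Nat.mul_div_le n f
  have hfk' : (f : ℝ) * k ≤ n := by exact_mod_cast hfk
  have hn2 : n ≤ 2 * (f * k) := by
    have h1 : n < f * (k + 1) := hkf ▸ Nat.lt_mul_div_succ n hf
    nlinarith
  have hn2' : (n : ℝ) ≤ 2 * (f * k) := by exact_mod_cast hn2
  have hkn : k ≤ n := hkf ▸ Nat.div_le_self n f
  have hfn : f ≤ n := (Nat.le_mul_of_pos_right f hk).trans hfk
  have hX : 0 < (f : ℝ) ^ α := by positivity
  have hq8 : 8 * (q : ℝ) ≤ f := by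
    calc 8 * (q : ℝ) ≤ Real.exp (-1) * (f : ℝ) ^ (1 - α) := hq
      _ ≤ 1 * (f : ℝ) ^ (1 : ℝ) := by
        gcongr
        · exact Real.exp_le_one_iff.mpr (by norm_num)
        linarith
      _ = f := by rw [one_mul, Real.rpow_one]
  have hqn : q ≤ n := by
    have h1 : 8 * q ≤ f := by exact_mod_cast hq8
    omega
  have hmX : (m : ℝ) ≤ 2 * (k * (Cb * (f : ℝ) ^ α)) := by
    rw [hm]; push_cast; gcongr
  -- The number of examples is of order `k * f ^ α`, smaller than `k * f ≤ n` by the factor `f ^ (1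
  -- - α)`. Thus `n.size` bits hold one digit of an error pattern, and `k / n.size` digits fit into
  -- `k` bits.
  have hmn : m + 1 ≤ n := by
    have h1 : (f : ℝ) ^ α * (f : ℝ) ^ (1 - α) = f := by
      rw [← Real.rpow_add hf0, add_sub_cancel, Real.rpow_one]
    have h2 : 2 * (m : ℝ) ≤ n := by
      calc 2 * (m : ℝ) ≤ k * ((f : ℝ) ^ α * (4 * Cb)) := by linarith
        _ ≤ k * ((f : ℝ) ^ α * (f : ℝ) ^ (1 - α)) := by gcongr
        _ ≤ n := by rw [h1, mul_comm]; exact hfk'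
    have h3 : 2 * m ≤ n := by exact_mod_cast h2
    omega
  have hw : (m + 1) ^ (k / n.size) ≤ 2 ^ k := by
    calc (m + 1) ^ (k / n.size) ≤ (2 ^ n.size) ^ (k / n.size) :=
          Nat.pow_le_pow_left (hmn.trans (Nat.lt_size_self n).le) _
      _ = 2 ^ (n.size * (k / n.size)) := (pow_mul _ _ _).symm
      _ ≤ 2 ^ k := Nat.pow_le_pow_right (by norm_num) (Nat.mul_div_le _ _)
  have hB0 : 1 ≤ B := hB ▸ Nat.succ_pos _
  have hB4 : 4 * Real.exp 1 * (f : ℝ) ^ 2 ≤ 4 ^ B := by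
    have h4 : Real.exp 1 ≤ 4 := by linarith [Real.exp_one_lt_d9]
    calc 4 * Real.exp 1 * (f : ℝ) ^ 2 ≤ Real.exp ((f : ℝ) ^ (1 / 2 : ℝ)) := hexp
      _ ≤ Real.exp B := Real.exp_le_exp.mpr
        ((Real.rpow_le_rpow_of_exponent_le hf' hα1).trans hB1)
      _ = Real.exp 1 ^ B := (Real.exp_one_pow B).symm
      _ ≤ 4 ^ B := by gcongr
  have hp1 : (1 / 2 : ℝ) ^ (k * B) ≤ δ / 3 :=
    (pow_le_pow_of_le_one (by norm_num) (by norm_num) (Nat.le_mul_of_pos_right k hB0)).trans hkδ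
  have hp2 : (n.choose k : ℝ) * (8 * q) ^ k * (1 / 2) ^ m ≤ δ / 3 := by
    rw [hm]; exact (confusion_bound hn2' hq8 hB4).trans hkδ
  have hp3 := error_bound hn hk η.2.1 hX hCb hδ hmX hη
  refine ⟨solvesLPN_of_runs (hrun hkn hqn (by nlinarith)) hk hq1 hB hm hw (Nat.div_le_self _ _)
    (by linarith), ?_, by linarith⟩
  have h1 : ((8 * q) ^ k + 1) * g ≤ (8 * q) ^ k * (2 * g) := by
    have : 1 ≤ (8 * q) ^ k := Nat.one_le_pow _ _ (by omega)
    nlinarith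
  calc ((((8 * q) ^ k + 1) * g : ℕ) : ℝ) ≤ (((8 * q) ^ k * n ^ c : ℕ) : ℝ) :=
        Nat.cast_le.mpr (h1.trans (Nat.mul_le_mul_left _ hg))
    _ = (8 * (q : ℝ)) ^ k * (n : ℝ) ^ c := by push_cast; ring
    _ ≤ _ := by
      gcongr
      exact pow_le_exp_mul_choose_rpow hf hα2.le hfk hq

theorem mainTheorem4 (f k t : ℕ → ℕ) (α : ℝ) (η : ℕ → unitInterval) (δ : ℝ)
    (hα : α ∈ Set.Ico (1 / 2 : ℝ) 1)
    (hδ : δ ∈ Set.Ioo (0 : ℝ) 1)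
    (hf_top : Tendsto f atTop atTop)
    (hf : (fun n => (f n : ℝ)) =o[atTop] fun n => (n : ℝ) / Real.log (Real.log n))
    (hk : ∀ n, k n = n / f n)
    (hη_half : ∀ n, (η n : ℝ) < 1 / 2)
    (hη : (fun n => (η n : ℝ)) =o[atTop] fun n => 1 / ((f n : ℝ) ^ α * Real.log n))
    (hk_con : Constructible k)
    (ht_con : Constructible t)
    (ht : (fun n => (t n : ℝ)) =Θ[atTop] fun n => (n : ℝ) / (f n : ℝ) ^ α) :
    ∃ (p : Prog) (T S : ℕ → ℕ) (r : ℕ → ℝ) (c : ℕ) (C : ℝ),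
      (∀ᶠ n in atTop, SolvesLPN p n (k n) (η n) δ (T n) (S n)) ∧
      (r =o[atTop] fun n => (k n : ℝ)) ∧
      (∀ᶠ n in atTop, (T n : ℝ) ≤
        Real.exp (-(k n : ℝ) / 4.01 + r n) * ((n.choose (k n) : ℕ) : ℝ) ^ (1 - α) * (n : ℝ) ^ c) ∧
      (∀ᶠ n in atTop, (S n : ℝ) ≤ C * ((k n : ℝ) * (f n : ℝ) ^ α)) ∧
      (((fun n : ℕ => Real.log n) =o[atTop] fun n => (k n : ℝ)) →
        (fun n => (T n : ℝ)) =o[atTop] fun n => ((n.choose (k n / 2) : ℕ) : ℝ)) := by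
  obtain ⟨c₂, hc₂, hu⟩ := ht.1.exists_pos
  obtain ⟨c₁', hc₁', hl⟩ := ht.2.exists_pos
  have hα' := hα
  obtain ⟨hα1, hα2⟩ := hα'
  set c₁ := c₁'⁻¹ with hc₁_def
  have hc₁ : 0 < c₁ := inv_pos.mpr hc₁'
  -- `D` shrinks `q` until every block gains a factor `e` in time, at the price of a constant factor
  -- in `B`.
  obtain ⟨D, hD⟩ := exists_nat_ge (16 * c₂ * Real.exp 1)
  obtain ⟨p, g, hg, hrun⟩ := exists_prog_runs hk_con ht_con D
  obtain ⟨c, hc⟩ := hg.eventually_le_pow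
  set Cb : ℝ := 2 * D / c₁ + 1 with hCb_def
  have hCb : 0 < Cb := by positivity
  have hf1 : ∀ᶠ n in atTop, 1 ≤ f n := hf_top.eventually_ge_atTop 1
  have hk_top := tendsto_div_of_isLittleO hf hf1 hk
  have hfR : Tendsto (fun n => (f n : ℝ)) atTop atTop := tendsto_natCast_atTop_atTop.comp hf_top
  have hfα : Tendsto (fun n => (f n : ℝ) ^ (1 - α)) atTop atTop :=
    (tendsto_rpow_atTop (by linarith)).comp hfR
  have hhalf : Tendsto (fun n => (1 / 2 : ℝ) ^ k n) atTop (𝓝 0) :=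
    (tendsto_pow_atTop_nhds_zero_of_lt_one (by norm_num) (by norm_num)).comp hk_top
  have main : ∀ᶠ n in atTop,
      SolvesLPN p n (k n) (η n) δ (((8 * (t n / (D * k n))) ^ k n + 1) * g n)
        (2 * (k n * (n / (k n * (t n / (D * k n))) + 1))) ∧
      (((((8 * (t n / (D * k n))) ^ k n + 1) * g n : ℕ) : ℝ) ≤
        Real.exp (-(k n : ℝ)) * ((n.choose (k n) : ℕ) : ℝ) ^ (1 - α) * (n : ℝ) ^ c) ∧
      ((2 * (k n * (n / (k n * (t n / (D * k n))) + 1)) : ℕ) : ℝ) ≤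
        2 * Cb * (k n * (f n : ℝ) ^ α) := by
    filter_upwards [hu.bound, hl.bound, hc, hf1, hk_top.eventually_ge_atTop 1,
      hfα.eventually_ge_atTop (D / c₁), hfα.eventually_ge_atTop (4 * Cb),
      hfR.eventually eventually_sq_le_exp, hhalf.eventually_le_const (div_pos hδ.1 three_pos),
      eventually_ge_atTop 3,
      hη.bound (c := δ / (18 * Cb)) (div_pos hδ.1 (by positivity))] with n hu hl hc hf1 hk1
      hD' hCf hexp hkδ hn hη
    have hn1 : (1 : ℝ) ≤ n := by exact_mod_cast (by omega : 1 ≤ n)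
    have hlog : 0 ≤ Real.log n := Real.log_nonneg hn1
    have hf1' : (1 : ℝ) ≤ f n := by exact_mod_cast hf1
    rw [Real.norm_natCast, Real.norm_of_nonneg (by positivity)] at hu
    rw [Real.norm_natCast, Real.norm_of_nonneg (by positivity)] at hl
    rw [Real.norm_of_nonneg (η n).2.1, Real.norm_of_nonneg (by positivity)] at hη
    have hl' : c₁ * ((n : ℝ) / (f n : ℝ) ^ α) ≤ t n := by
      rw [hc₁_def, inv_mul_le_iff₀ hc₁']; exact hl
    obtain ⟨hq1, hq, hB1, hB2⟩ := params_bounds hc₁ hc₂ hf1 (hk n) hk1 hl' hu hD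
      (by rw [div_le_iff₀ hc₁] at hD'; linarith)
    have hfα1 : 1 ≤ (f n : ℝ) ^ α := Real.one_le_rpow hf1' (by linarith)
    refine solvesLPN_and_time_of_params (hrun n _ _ _ rfl rfl rfl) hn hf1 (hk n) hk1 hα hδ.1 hCb
      hq1 hq rfl hB1 ?_ rfl hCf hexp hη hkδ hc
    rw [hCb_def, add_mul, one_mul]
    linarith
  -- The bound proved has `e ^ (-k)`, which is stronger than `e ^ (-k / 4.01)`, so the error term in
  -- the exponent can be `0`.
  refine ⟨p, _, _, fun _ => 0, c, 2 * Cb, main.mono fun n h => h.1, isLittleO_zero _ _, ?_,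
    main.mono fun n h => h.2.2, fun hlog => isLittleO_choose_half hα1 hk_top
      (Eventually.of_forall fun n => hk n ▸ Nat.div_le_self _ _) (main.mono fun n h => h.2.1) hlog⟩
  filter_upwards [main] with n h
  refine h.2.1.trans ?_
  gcongr
  rw [add_zero, neg_div]
  exact neg_le_neg (div_le_self (by positivity) (by norm_num))
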